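/- **Nets.** A *marked net* $N=(P,T,Fl,M_{init})$ has finite disjoint sets $P$ of places and $T$ of transitions, a flow relation $Fl\subseteq (T\times P)\cup(P\times T)$ and an initial marking $M_{init}\subseteq P$, such that every place has an input or an output transition and every transition has a pre-place. Write ${}^\bullet x$ and $x^\bullet$ for the sets of predecessors and successors of $x$ under $Fl$. A transition $t$ is fireable at a marking $M\subseteq P$ if ${}^\bullet t\subseteq M$, and firing it leads to $(M\setminus{}^\bullet t)\cup t^\bullet$. $N$ is *safe* if $t^\bullet\cap(M\setminus{}^\bullet t)=\emptyset$ whenever $M$ is reachable from $M_{init}$ and $t$ is fireable at $M$. The *reachability graph* of $N$ has the reachable markings as nodes, the firings $(M,t,M')$ as labelled arcs, and $M_{init}$ as initial node; isomorphisms preserve the initial node and the labelled arcs in both directions. A place is written $\pi_Z$, where $Z$ is a set of tagged transitions $t^{in}$, $t^{out}$: there is an arc from $t$ to $\pi_Z$ iff $t^{in}\in Z$, and an arc from $\pi_Z$ to $t$ iff $t^{out}\in Z$. For sets of places let $Q\otimes R=\{\pi_{Z\cup Z'}\mid \pi_Z\in Q,\ \pi_{Z'}\in R\}$. **Boxes.**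 Let $E$ be a box expression generated from the nonterminal $E$ of the grammar $$E::=a\mid E;E\mid E\,\square\,E\mid\langle E*H*E\rangle\mid E\,\|\,E,\qquad H::=a\mid E;E\mid H\,\square\,H\mid\langle E*H*E\rangle,$$ in which no action $a$ occurs more than once. Define sets $(\Pi^e,\Pi^x,\Pi^i)$ of entry, exit and internal places by - $\Pi_a=(\{\pi_{\{a^{out}\}}\},\{\pi_{\{a^{in}\}}\},\emptyset)$; - $\Pi_{E\|F}=(\Pi_E^e\cup\Pi_F^e,\ \Pi_E^x\cup\Pi_F^x,\ \Pi_E^i\cup\Pi_F^i)$; - $\Pi_{E;F}=(\Pi_E^e,\ \Pi_F^x,\ \Pi_E^i\cup\Pi_F^i\cup(\Pi_E^x\otimes\Pi_F^e))$; - $\Pi_{E\square F}=(\Pi_E^e\otimes\Pi_F^e,\ \Pi_E^x\otimes\Pi_F^x,\ \Pi_E^i\cup\Pi_F^i)$; - $\Pi_{\langle E*F*G\rangle}=(\Pi_E^e,\ \Pi_G^x,\ \Pi_E^i\cup\Pi_F^i\cup\Pi_G^i\cup((\Pi_E^x\otimes\Pi_F^x)\otimes(\Pi_G^e\otimes\Pi_F^e)))$.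 $BOX(E)$ is the net with places $\Pi_E^e\cup\Pi_E^x\cup\Pi_E^i$, the actions of $E$ as transitions, and initial marking $\Pi_E^e$. **Connection graph.** Define undirected graphs $(\Gamma_E^e,\Gamma_E^x,\Gamma_E^i)$ on tagged actions by the same clauses, with $\pi_{\{a^{out}\}}$ and $\pi_{\{a^{in}\}}$ replaced by the one-vertex graphs $a^{out}$ and $a^{in}$, $\cup$ by disjoint union, and $\otimes$ by graph join (disjoint union plus all edges between the two parts). The connection graph $CG_E$ is the disjoint union of $\Gamma_E^e$, $\Gamma_E^x$ and $\Gamma_E^i$. An *edge clique cover* of $CG_E$ is a set $\mathcal C$ of (inclusion-)maximal cliques of $CG_E$ such that every edge has both endpoints in some member of $\mathcal C$ and every isolated vertex belongs to some member of $\mathcal C$. A *partial* edge clique cover is defined in the same way, except that the edges between two vertices of the forms $a^{in}$ and $b^{in}$ need not be covered. Let $N_{\mathcal C}$ be the net with places $\{\pi_Z\mid Z\in\mathcal C\}$, with the actions occurring (tagged) in members of $\mathcal C$ as transitions, and with initial marking $\{p\mid{}^\bullet p=\emptyset\}$. Let $N'_{\mathcal C}$ be obtained from $N_{\mathcal C}$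 by deleting all the places $p$ with $p^\bullet=\emptyset$. **Theorem.** For every edge clique cover $\mathcal C$ of $CG_E$, $N_{\mathcal C}$ is a safe marked net whose reachability graph is isomorphic to that of $BOX(E)$. The same holds for $N'_{\mathcal C}$, and both claims also hold for every partial edge clique cover $\mathcal C$ of $CG_E$. -/

import Mathlib

/-! ## Marked nets -/

/-- The data `(P, T, Fl, M_init)` of a marked net with places in `π` and transitions in `τ`.
The flow relation is split into the arcs `arcTP` (transition to place) and `arcPT` (place to
transition); the axioms of a marked net are collected in `PetriNet.IsMarkedNet`. -/
structure PetriNet (π τ : Type*) where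
  places : Set π
  trans : Set τ
  arcTP : τ → π → Prop
  arcPT : π → τ → Prop
  init : Set π

namespace PetriNet

variable {π π' τ : Type*}

/-- Pre-places of a transition. -/
def pre (N : PetriNet π τ) (t : τ) : Set π := {p | N.arcPT p t}

/-- Post-places of a transition. -/
def post (N : PetriNet π τ) (t : τ) : Set π := {p | N.arcTP t p}

/-- Input transitions of a place. -/
def inputs (N : PetriNet π τ) (p : π) : Set τ := {t | N.arcTP t p}

/-- Output transitions of a place. -/
def outputs (N : PetriNet π τ) (p : π) : Set τ := {t | N.arcPT p t}

/-- Finitely many places and transitions, the flow relation is contained in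
`(T × P) ∪ (P × T)`, the initial marking is a set of places, every place has an input or an
output transition, and every transition has a pre-place. -/
structure IsMarkedNet (N : PetriNet π τ) : Prop where
  finite_places : N.places.Finite
  finite_trans : N.trans.Finite
  arcTP_mem : ∀ t p, N.arcTP t p → t ∈ N.trans ∧ p ∈ N.places
  arcPT_mem : ∀ p t, N.arcPT p t → p ∈ N.places ∧ t ∈ N.trans
  init_subset : N.init ⊆ N.places
  place_connected : ∀ p ∈ N.places, (N.inputs p).Nonempty ∨ (N.outputs p).Nonempty
  pre_nonempty : ∀ t ∈ N.trans, (N.pre t).Nonempty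

/-- `t` is fireable at the marking `M`. -/
def Fireable (N : PetriNet π τ) (M : Set π) (t : τ) : Prop :=
  t ∈ N.trans ∧ N.pre t ⊆ M

/-- Firing `t` at `M` leads to `M'`. -/
def Step (N : PetriNet π τ) (M : Set π) (t : τ) (M' : Set π) : Prop :=
  N.Fireable M t ∧ M' = (M \ N.pre t) ∪ N.post t

/-- The set of reachable markings. -/
def reach (N : PetriNet π τ) : Set (Set π) :=
  {M | Relation.ReflTransGen (fun M₁ M₂ => ∃ t, N.Step M₁ t M₂) N.init M}

theorem init_mem_reach (N : PetriNet π τ) : N.init ∈ N.reach :=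
  Relation.ReflTransGen.refl

/-- Safeness: no fireable transition puts a token on a place that keeps a token. -/
def Safe (N : PetriNet π τ) : Prop :=
  ∀ M ∈ N.reach, ∀ t, N.Fireable M t → N.post t ∩ (M \ N.pre t) = ∅

/-- Isomorphism of reachability graphs: a bijection between the reachable markings that
preserves the initial node and preserves and reflects the arcs labelled by transitions. -/
def RGIso (N : PetriNet π τ) (N' : PetriNet π' τ) : Prop :=
  ∃ ι : N.reach ≃ N'.reach,
    ι ⟨N.init, N.init_mem_reach⟩ = ⟨N'.init, N'.init_mem_reach⟩ ∧
      ∀ (M M' : N.reach) (t : τ),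
        N.Step (M : Set π) t (M' : Set π) ↔
          N'.Step (ι M : Set π') t (ι M' : Set π')

/-- Deletion of all the places without output transitions (transitions are kept). -/
def deleteSinks (N : PetriNet π τ) : PetriNet π τ where
  places := {p ∈ N.places | (N.outputs p).Nonempty}
  trans := N.trans
  arcTP t p := N.arcTP t p ∧ (N.outputs p).Nonempty
  arcPT p t := N.arcPT p t ∧ (N.outputs p).Nonempty
  init := {p ∈ N.init | (N.outputs p).Nonempty}

end PetriNet

/-! ## Box expressions -/

/-- Box expressions over the actions `α`; `iter E F G` starts with `E`, repeats `F` any number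
of times, and ends with `G`. -/
inductive BoxExpr (α : Type*) where
  | act (a : α)
  | seq (E F : BoxExpr α)
  | choice (E F : BoxExpr α)
  | par (E F : BoxExpr α)
  | iter (E F G : BoxExpr α)

/-- The two nonterminals of the safe syntax. -/
inductive NonTerm where
  | E
  | H

/-- The safe syntax:
`E ::= a | E;E | E[]E | <E*H*E> | E||E` and `H ::= a | E;E | H[]H | <E*H*E>`. -/
inductive Derives {α : Type*} : NonTerm → BoxExpr α → Prop
  | actE (a : α) : Derives .E (.act a)
  | seqE {A B : BoxExpr α} : Derives .E A → Derives .E B → Derives .E (.seq A B)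
  | choiceE {A B : BoxExpr α} : Derives .E A → Derives .E B → Derives .E (.choice A B)
  | iterE {A B C : BoxExpr α} :
      Derives .E A → Derives .H B → Derives .E C → Derives .E (.iter A B C)
  | parE {A B : BoxExpr α} : Derives .E A → Derives .E B → Derives .E (.par A B)
  | actH (a : α) : Derives .H (.act a)
  | seqH {A B : BoxExpr α} : Derives .E A → Derives .E B → Derives .H (.seq A B)
  | choiceH {A B : BoxExpr α} : Derives .H A → Derives .H B → Derives .H (.choice A B)
  | iterH {A B C : BoxExpr α} :
      Derives .E A → Derives .H B → Derives .E C → Derives .H (.iter A B C)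

/-- Tagged actions `a^in` and `a^out`. -/
inductive Tagged (α : Type*) where
  | inp (a : α)
  | out (a : α)

/-- A place `π_Z` is identified with the set `Z` of its tagged transitions: `t^in ∈ Z` means that
`t` is an input transition, and `t^out ∈ Z` that `t` is an output transition. -/
abbrev Place (α : Type*) := Set (Tagged α)

/-- The net with places `P`, transitions `T`, initial marking `M`, and the arcs implied by the
names of the places. -/
def netOfPlaces {α : Type*} (P : Set (Place α)) (T : Set α) (M : Set (Place α)) :
    PetriNet (Place α) α where
  places := P
  trans := T
  arcTP t Z := t ∈ T ∧ Z ∈ P ∧ Tagged.inp t ∈ Z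
  arcPT Z t := Z ∈ P ∧ t ∈ T ∧ Tagged.out t ∈ Z
  init := M

/-- The cross-product of two sets of places. -/
def crossProd {α : Type*} (Q R : Set (Place α)) : Set (Place α) :=
  Set.image2 (fun Z Z' => Z ∪ Z') Q R

namespace BoxExpr

variable {α : Type*}

/-- The list of occurrences of actions. -/
def actions : BoxExpr α → List α
  | act a => [a]
  | seq E F => E.actions ++ F.actions
  | choice E F => E.actions ++ F.actions
  | par E F => E.actions ++ F.actions
  | iter E F G => E.actions ++ F.actions ++ G.actions

/-- Entry places. -/
def entry : BoxExpr α → Set (Place α)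
  | act a => {{Tagged.out a}}
  | seq E _ => E.entry
  | choice E F => crossProd E.entry F.entry
  | par E F => E.entry ∪ F.entry
  | iter E _ _ => E.entry

/-- Exit places. -/
def exit : BoxExpr α → Set (Place α)
  | act a => {{Tagged.inp a}}
  | seq _ F => F.exit
  | choice E F => crossProd E.exit F.exit
  | par E F => E.exit ∪ F.exit
  | iter _ _ G => G.exit

/-- Internal places. -/
def internal : BoxExpr α → Set (Place α)
  | act _ => ∅
  | seq E F => E.internal ∪ F.internal ∪ crossProd E.exit F.entry
  | choice E F => E.internal ∪ F.internal
  | par E F => E.internal ∪ F.internal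
  | iter E F G => E.internal ∪ F.internal ∪ G.internal ∪
      crossProd (crossProd E.exit F.exit) (crossProd G.entry F.entry)

/-- The marked net `BOX(E)`. -/
def box (E : BoxExpr α) : PetriNet (Place α) α :=
  netOfPlaces (E.entry ∪ E.exit ∪ E.internal) {a | a ∈ E.actions} E.entry

end BoxExpr

/-! ## Connection graphs -/

/-- Undirected loopless graphs whose vertex set is a set of tagged actions. -/
abbrev ConnGraph (α : Type*) := (⊤ : SimpleGraph (Tagged α)).Subgraph

namespace ConnGraph

variable {α : Type*}

/-- The graph with the single vertex `v`. -/
def single (v : Tagged α) : ConnGraph α := SimpleGraph.singletonSubgraph _ v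

/-- The join of two graphs (meant for disjoint vertex sets, where `v ≠ w` holds automatically):
their union together with all the edges between a vertex of `G` and a vertex of `G'`. -/
def join (G G' : ConnGraph α) : ConnGraph α where
  verts := G.verts ∪ G'.verts
  Adj v w := G.Adj v w ∨ G'.Adj v w ∨
    (v ≠ w ∧ ((v ∈ G.verts ∧ w ∈ G'.verts) ∨ (v ∈ G'.verts ∧ w ∈ G.verts)))
  adj_sub := by
    rintro v w (h | h | h)
    · exact G.adj_sub h
    · exact G'.adj_sub h
    · exact h.1
  edge_vert := by
    rintro v w (h | h | ⟨_, h | h⟩)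
    · exact Or.inl (G.edge_vert h)
    · exact Or.inr (G'.edge_vert h)
    · exact Or.inl h.1
    · exact Or.inr h.1
  symm := ⟨by
    rintro v w (h | h | ⟨hne, h | h⟩)
    · exact Or.inl h.symm
    · exact Or.inr (Or.inl h.symm)
    · exact Or.inr (Or.inr ⟨hne.symm, Or.inr ⟨h.2, h.1⟩⟩)
    · exact Or.inr (Or.inr ⟨hne.symm, Or.inl ⟨h.2, h.1⟩⟩)⟩

/-- A clique: a non-empty set of pairwise adjacent vertices. -/
def IsClique (G : ConnGraph α) (K : Set (Tagged α)) : Prop :=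
  K.Nonempty ∧ K ⊆ G.verts ∧ K.Pairwise G.Adj

/-- The maximal cliques. -/
def maxCliques (G : ConnGraph α) : Set (Set (Tagged α)) :=
  {K | Maximal G.IsClique K}

/-- `C` is a set of maximal cliques of `G` that covers every edge except possibly those
in `D` (regarded as covered already), and every isolated vertex. -/
structure IsPartialEdgeCliqueCover (G : ConnGraph α) (D : Tagged α → Tagged α → Prop)
    (C : Set (Set (Tagged α))) : Prop where
  subset_maxCliques : C ⊆ G.maxCliques
  covers_edge : ∀ v w, G.Adj v w → ¬ D v w → ∃ K ∈ C, v ∈ K ∧ w ∈ K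
  covers_isolated : ∀ v ∈ G.verts, (∀ w, ¬ G.Adj v w) → ∃ K ∈ C, v ∈ K

/-- An edge clique cover by maximal cliques: no edge is regarded as covered already. -/
def IsEdgeCliqueCover (G : ConnGraph α) (C : Set (Set (Tagged α))) : Prop :=
  G.IsPartialEdgeCliqueCover (fun _ _ => False) C

/-- The pairs of vertices both of which have the form `a^in`. -/
def InIn (v w : Tagged α) : Prop := (∃ a, v = Tagged.inp a) ∧ ∃ b, w = Tagged.inp b

end ConnGraph

namespace BoxExpr

variable {α : Type*}

/-- The graph of the entry places. -/
def entryGraph : BoxExpr α → ConnGraph α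
  | act a => ConnGraph.single (Tagged.out a)
  | seq E _ => E.entryGraph
  | choice E F => ConnGraph.join E.entryGraph F.entryGraph
  | par E F => E.entryGraph ⊔ F.entryGraph
  | iter E _ _ => E.entryGraph

/-- The graph of the exit places. -/
def exitGraph : BoxExpr α → ConnGraph α
  | act a => ConnGraph.single (Tagged.inp a)
  | seq _ F => F.exitGraph
  | choice E F => ConnGraph.join E.exitGraph F.exitGraph
  | par E F => E.exitGraph ⊔ F.exitGraph
  | iter _ _ G => G.exitGraph

/-- The graph of the internal places. -/
def internalGraph : BoxExpr α → ConnGraph α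
  | act _ => ⊥
  | seq E F => E.internalGraph ⊔ F.internalGraph ⊔ ConnGraph.join E.exitGraph F.entryGraph
  | choice E F => E.internalGraph ⊔ F.internalGraph
  | par E F => E.internalGraph ⊔ F.internalGraph
  | iter E F G => E.internalGraph ⊔ F.internalGraph ⊔ G.internalGraph ⊔
      ConnGraph.join (ConnGraph.join E.exitGraph F.exitGraph)
        (ConnGraph.join F.entryGraph G.entryGraph)

/-- The connection graph `CG_E`. The three parts, and all the graphs united or joined above, have
disjoint vertex sets when no action occurs twice, so `⊔` is their disjoint union. -/
def connGraph (E : BoxExpr α) : ConnGraph α :=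
  E.entryGraph ⊔ E.exitGraph ⊔ E.internalGraph

end BoxExpr

/-- The net `N_C`: its places are the cliques in `C`, its transitions are the actions that occur
in them, and the initially marked places are those without input transitions. -/
def cliqueNet {α : Type*} (C : Set (Set (Tagged α))) : PetriNet (Place α) α :=
  netOfPlaces C
    ({t | ∃ Z ∈ C, Tagged.inp t ∈ Z} ∪ {t | ∃ Z ∈ C, Tagged.out t ∈ Z})
    {Z ∈ C | ∀ t, Tagged.inp t ∉ Z}

/-! The places of BOX(E) are cliques of the connection graph, and every clique extends to one of
them (`represents_places`). Hence maximal cliques are places of BOX(E), and $N_C$ is BOX(E) with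
some places deleted. The theorem thus says that deleted places are redundant if any $t^{out}$ and
any tag $v$ that share a place still share a remaining one (`CoveredBy`). Pairs $a^{in}, b^{in}$
play no role in this condition, so partial covers satisfy it too, and deleting places without
outputs does not harm it.

Redundancy is proved by induction on the expression, over boxes with abstract places and an
invariant set `states` of markings. `Dynamic.separated` says that two states agreeing on a good
selection of places are equal; exit places are never selected, since the others determine them.
`Dynamic.fire` says that at a state every transition either fires safely into a state or lacks a
token on some selected pre-place, whatever the good selection. Both quantify over all good
selections, because a selection in a composite box induces one in each component.

At a junction formed by $\otimes$, coverage provides a selected place for a prescribed pair of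
transitions, but does not prescribe its coordinates. So the induction also carries `ent_marked`,
`ent_unmarked` and `ex_unmarked`: from one marked or unmarked place they produce a transition all of
whose entry (or exit) places are marked or unmarked. `eq_start` and `eq_final` identify the markings
at which control passes between components.

In an iteration a junction place is marked if an exit or an entry place of the body is. This
disjunction can be undone only if the body never has entry and exit tokens together (`Exclusive`);
the nonterminal H ensures it by forbidding a parallel composition whose entry and exit places would
be those of the body.

Finally, `Determines` and `IsRestriction` are general: if restriction to a set of places is faithful
and reflects fireability on an invariant set, then $M\mapsto M\cap S$ is an isomorphism of
reachability graphs (`IsRestriction.rgIso`). -/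

/-! ## Abstract boxes -/

/-- Markings of a net whose places are split into entry, exit and internal places. -/
@[ext]
structure BoxMarking (P Q I : Type) where
  e : P → Prop
  x : Q → Prop
  i : I → Prop

namespace BoxMarking

variable {P Q I : Type}

/-- Exactly the entry places are marked. -/
def start : BoxMarking P Q I := ⟨fun _ => True, fun _ => False, fun _ => False⟩

/-- Exactly the exit places are marked. -/
def final : BoxMarking P Q I := ⟨fun _ => False, fun _ => True, fun _ => False⟩

end BoxMarking

/-- A box with abstract places. `entOut`, `exIn`, `intIn`, `intOut` give the output transitions
of entry places, the input transitions of exit places, and the input and output transitions of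
internal places; `states` is an invariant set of markings. -/
structure BoxSys (α : Type*) where
  acts : Set α
  Ent : Type
  Ex : Type
  Int : Type
  entOut : Ent → α → Prop
  exIn : Ex → α → Prop
  intIn : Int → α → Prop
  intOut : Int → α → Prop
  states : BoxMarking Ent Ex Int → Prop

namespace BoxSys

variable {α : Type*}

abbrev Marking (B : BoxSys α) := BoxMarking B.Ent B.Ex B.Int

/-- The marking obtained by firing `t`. -/
def fire (B : BoxSys α) (m : B.Marking) (t : α) : B.Marking where
  e p := m.e p ∧ ¬ B.entOut p t
  x p := m.x p ∨ B.exIn p t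
  i p := (m.i p ∧ ¬ B.intOut p t) ∨ B.intIn p t

/-- Any two transitions connected to a common place, one of them as an output transition,
are connected in the same way to a common place among the selected ones. -/
structure Good (B : BoxSys α) (Se : B.Ent → Prop) (Si : B.Int → Prop) : Prop where
  ent : ∀ p t w, B.entOut p t → B.entOut p w → ∃ q, Se q ∧ B.entOut q t ∧ B.entOut q w
  out_out : ∀ p t w, B.intOut p t → B.intOut p w → ∃ q, Si q ∧ B.intOut q t ∧ B.intOut q w
  out_in : ∀ p t w, B.intOut p t → B.intIn p w → ∃ q, Si q ∧ B.intOut q t ∧ B.intIn q w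

/-- Every good selection of places contains an unmarked pre-place of `t`. -/
def Blocked (B : BoxSys α) (m : B.Marking) (t : α) : Prop :=
  ∀ Se Si, B.Good Se Si →
    (∃ p, Se p ∧ B.entOut p t ∧ ¬ m.e p) ∨ ∃ p, Si p ∧ B.intOut p t ∧ ¬ m.i p

/-- `t` can fire at `m`, safely, and firing it does not leave the invariant set. -/
structure CanFire (B : BoxSys α) (m : B.Marking) (t : α) : Prop where
  ent : ∀ p, B.entOut p t → m.e p
  out : ∀ p, B.intOut p t → m.i p
  ex_safe : ∀ p, B.exIn p t → ¬ m.x p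
  int_safe : ∀ p, B.intIn p t → m.i p → B.intOut p t
  mem : B.states (B.fire m t)

/-- Structural properties of boxes. -/
structure Static (B : BoxSys α) : Prop where
  entOut_mem : ∀ p t, B.entOut p t → t ∈ B.acts
  exIn_mem : ∀ p t, B.exIn p t → t ∈ B.acts
  intIn_mem : ∀ p t, B.intIn p t → t ∈ B.acts
  intOut_mem : ∀ p t, B.intOut p t → t ∈ B.acts
  ent_nonempty : Nonempty B.Ent
  ex_nonempty : Nonempty B.Ex
  entOut_nonempty : ∀ p, ∃ t, B.entOut p t
  exIn_nonempty : ∀ p, ∃ t, B.exIn p t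
  intIn_nonempty : ∀ p, ∃ t, B.intIn p t
  intOut_nonempty : ∀ p, ∃ t, B.intOut p t
  exists_out : ∀ t ∈ B.acts, (∃ p, B.entOut p t) ∨ ∃ p, B.intOut p t
  out_disjoint : ∀ p q t, B.entOut p t → ¬ B.intOut q t
  ent_inj : ∀ p q, (∀ t, B.entOut p t ↔ B.entOut q t) → p = q
  ex_inj : ∀ p q, (∀ t, B.exIn p t ↔ B.exIn q t) → p = q
  int_inj : ∀ p q, (∀ t, B.intIn p t ↔ B.intIn q t) →
    (∀ t, B.intOut p t ↔ B.intOut q t) → p = q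

/-- Behavioural properties of boxes. -/
structure Dynamic (B : BoxSys α) : Prop where
  start_mem : B.states .start
  final_mem : B.states .final
  eq_start : ∀ m, B.states m → (∀ p, m.e p) → m = .start
  eq_final : ∀ m, B.states m → (∀ p, m.x p) → m = .final
  ent_marked : ∀ m, B.states m → (∃ p, m.e p) →
    ∃ t, (∃ p, B.entOut p t) ∧ ∀ p, B.entOut p t → m.e p
  ent_unmarked : ∀ m, B.states m → (∃ p, ¬ m.e p) →
    ∃ t, (∃ p, B.entOut p t) ∧ ∀ p, B.entOut p t → ¬ m.e p
  ex_unmarked : ∀ m, B.states m → (∃ p, ¬ m.x p) →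
    ∃ t, (∃ p, B.exIn p t) ∧ ∀ p, B.exIn p t → ¬ m.x p
  fire : ∀ m, B.states m → ∀ t ∈ B.acts, B.CanFire m t ∨ B.Blocked m t
  separated : ∀ Se Si, B.Good Se Si → ∀ m m', B.states m → B.states m' →
    (∀ p, Se p → (m.e p ↔ m'.e p)) → (∀ p, Si p → (m.i p ↔ m'.i p)) → m = m'

/-- No marking has both an entry and an exit place marked. -/
def Exclusive (B : BoxSys α) : Prop :=
  ∀ m, B.states m → ∀ p q, m.e p → ¬ m.x q

/-- A selection cannot tell an empty component from a finished one, since it contains no exit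
places. This is used to compare a running component with a marking in which another one runs. -/
theorem Dynamic.eq_final_of_unmarked {B : BoxSys α} (hB : B.Dynamic) {Se : B.Ent → Prop}
    {Si : B.Int → Prop} (hS : B.Good Se Si) {m : B.Marking} (hm : B.states m)
    (he : ∀ p, Se p → ¬ m.e p) (hi : ∀ p, Si p → ¬ m.i p) : m = .final :=
  hB.separated Se Si hS m .final hm hB.final_mem
    (fun p hp => iff_of_false (he p hp) not_false) (fun p hp => iff_of_false (hi p hp) not_false)

/-- The pair of `t` with itself has to be covered, so `t` keeps a pre-place. This blocks the
transitions of a component that holds no tokens. -/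
theorem Good.exists_out {B : BoxSys α} (hB : B.Static) {Se : B.Ent → Prop}
    {Si : B.Int → Prop} (hS : B.Good Se Si) {t : α} (ht : t ∈ B.acts) :
    (∃ p, Se p ∧ B.entOut p t) ∨ ∃ p, Si p ∧ B.intOut p t := by
  rcases hB.exists_out t ht with ⟨p, hp⟩ | ⟨p, hp⟩
  · obtain ⟨q, hq, h, -⟩ := hS.ent p t t hp hp
    exact Or.inl ⟨q, hq, h⟩
  · obtain ⟨q, hq, h, -⟩ := hS.out_out p t t hp hp
    exact Or.inr ⟨q, hq, h⟩

/-! ### Single actions -/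

/-- The box of a single action. -/
abbrev single (a : α) : BoxSys α where
  acts := {a}
  Ent := Unit
  Ex := Unit
  Int := Empty
  entOut _ t := t = a
  exIn _ t := t = a
  intIn _ _ := False
  intOut _ _ := False
  states m := m = .start ∨ m = .final

theorem single_static (a : α) : (single a).Static where
  entOut_mem _ _ h := h
  exIn_mem _ _ h := h
  intIn_mem _ _ h := h.elim
  intOut_mem _ _ h := h.elim
  ent_nonempty := ⟨()⟩
  ex_nonempty := ⟨()⟩
  entOut_nonempty _ := ⟨a, rfl⟩
  exIn_nonempty _ := ⟨a, rfl⟩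
  intIn_nonempty p := p.elim
  intOut_nonempty p := p.elim
  exists_out _ h := Or.inl ⟨(), h⟩
  out_disjoint _ q := q.elim
  ent_inj _ _ _ := rfl
  ex_inj _ _ _ := rfl
  int_inj p := p.elim

theorem single_dynamic (a : α) : (single a).Dynamic where
  start_mem := Or.inl rfl
  final_mem := Or.inr rfl
  eq_start m hm h := by
    rcases hm with rfl | rfl
    · rfl
    · exact (h ()).elim
  eq_final m hm h := by
    rcases hm with rfl | rfl
    · exact (h ()).elim
    · rfl
  ent_marked m _ h := ⟨a, ⟨(), rfl⟩, fun _ _ => h.choose_spec⟩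
  ent_unmarked m _ h := ⟨a, ⟨(), rfl⟩, fun _ _ => h.choose_spec⟩
  ex_unmarked m _ h := ⟨a, ⟨(), rfl⟩, fun _ _ => h.choose_spec⟩
  fire m hm t ht := by
    rcases hm with rfl | rfl
    · refine Or.inl ⟨fun _ _ => trivial, fun p => p.elim, fun _ _ h => h, fun p => p.elim,
        Or.inr ?_⟩
      have ht' : t = a := ht
      ext p
      · simp [BoxSys.fire, BoxMarking.start, BoxMarking.final, ht']
      · simp [BoxSys.fire, BoxMarking.start, BoxMarking.final, ht']
      · exact p.elim
    · refine Or.inr fun Se Si hS => Or.inl ?_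
      obtain ⟨q, hq, h, -⟩ := hS.ent () t t ht ht
      exact ⟨q, hq, h, fun h => h⟩
  separated Se Si hS m m' hm hm' he _ := by
    -- The pair `(a, a)` forces the only entry place to be selected, and that place distinguishes
    -- start from final.
    obtain ⟨⟨⟩, hq, -, -⟩ := hS.ent () a a rfl rfl
    have := he () hq
    rcases hm with rfl | rfl <;> rcases hm' with rfl | rfl <;>
      first | rfl | simp [BoxMarking.start, BoxMarking.final] at this

theorem single_exclusive (a : α) : (single a).Exclusive := by
  rintro m (rfl | rfl) p q h
  · exact not_false
  · exact h.elim

/-! ### Parallel composition -/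

/-- Juxtaposition of markings. -/
def parMark (B C : BoxSys α) (m : B.Marking) (n : C.Marking) :
    BoxMarking (B.Ent ⊕ C.Ent) (B.Ex ⊕ C.Ex) (B.Int ⊕ C.Int) where
  e := Sum.elim m.e n.e
  x := Sum.elim m.x n.x
  i := Sum.elim m.i n.i

/-- Parallel composition of boxes. -/
abbrev par (B C : BoxSys α) : BoxSys α where
  acts := B.acts ∪ C.acts
  Ent := B.Ent ⊕ C.Ent
  Ex := B.Ex ⊕ C.Ex
  Int := B.Int ⊕ C.Int
  entOut := Sum.elim B.entOut C.entOut
  exIn := Sum.elim B.exIn C.exIn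
  intIn := Sum.elim B.intIn C.intIn
  intOut := Sum.elim B.intOut C.intOut
  states M := ∃ m n, B.states m ∧ C.states n ∧ M = parMark B C m n

/-- Nonempty sets of labels from disjoint alphabets differ; this keeps places of different
components apart. -/
theorem labels_ne {β γ : Type*} {f : β → α → Prop} {g : γ → α → Prop} {S T : Set α}
    (hST : Disjoint S T) (hf : ∀ p t, f p t → t ∈ S) (hg : ∀ p t, g p t → t ∈ T)
    (hf' : ∀ p, ∃ t, f p t) (p : β) (q : γ) :
    ¬ ∀ t, f p t ↔ g q t := by
  intro h
  obtain ⟨t, ht⟩ := hf' p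
  exact Set.disjoint_left.1 hST (hf _ _ ht) (hg _ _ ((h t).1 ht))

theorem par_static {B C : BoxSys α} (hB : B.Static) (hC : C.Static)
    (hd : Disjoint B.acts C.acts) : (par B C).Static where
  entOut_mem p t h := by
    rcases p with p | p
    · exact Or.inl (hB.entOut_mem p t h)
    · exact Or.inr (hC.entOut_mem p t h)
  exIn_mem p t h := by
    rcases p with p | p
    · exact Or.inl (hB.exIn_mem p t h)
    · exact Or.inr (hC.exIn_mem p t h)
  intIn_mem p t h := by
    rcases p with p | p
    · exact Or.inl (hB.intIn_mem p t h)
    · exact Or.inr (hC.intIn_mem p t h)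
  intOut_mem p t h := by
    rcases p with p | p
    · exact Or.inl (hB.intOut_mem p t h)
    · exact Or.inr (hC.intOut_mem p t h)
  ent_nonempty := hB.ent_nonempty.map Sum.inl
  ex_nonempty := hB.ex_nonempty.map Sum.inl
  entOut_nonempty := by
    rintro (p | p)
    exacts [hB.entOut_nonempty p, hC.entOut_nonempty p]
  exIn_nonempty := by
    rintro (p | p)
    exacts [hB.exIn_nonempty p, hC.exIn_nonempty p]
  intIn_nonempty := by
    rintro (p | p)
    exacts [hB.intIn_nonempty p, hC.intIn_nonempty p]
  intOut_nonempty := by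
    rintro (p | p)
    exacts [hB.intOut_nonempty p, hC.intOut_nonempty p]
  exists_out := by
    rintro t (ht | ht)
    · rcases hB.exists_out t ht with ⟨p, hp⟩ | ⟨p, hp⟩
      exacts [Or.inl ⟨Sum.inl p, hp⟩, Or.inr ⟨Sum.inl p, hp⟩]
    · rcases hC.exists_out t ht with ⟨p, hp⟩ | ⟨p, hp⟩
      exacts [Or.inl ⟨Sum.inr p, hp⟩, Or.inr ⟨Sum.inr p, hp⟩]
  out_disjoint := by
    rintro (p | p) (q | q) t h h'
    · exact hB.out_disjoint p q t h h'
    · exact Set.disjoint_left.1 hd (hB.entOut_mem _ _ h) (hC.intOut_mem _ _ h')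
    · exact Set.disjoint_left.1 hd (hB.intOut_mem _ _ h') (hC.entOut_mem _ _ h)
    · exact hC.out_disjoint p q t h h'
  ent_inj := by
    have key := labels_ne hd hB.entOut_mem hC.entOut_mem hB.entOut_nonempty
    rintro (p | p) (q | q) h
    · rw [hB.ent_inj p q h]
    · exact (key p q h).elim
    · exact (key q p fun t => (h t).symm).elim
    · rw [hC.ent_inj p q h]
  ex_inj := by
    have key := labels_ne hd hB.exIn_mem hC.exIn_mem hB.exIn_nonempty
    rintro (p | p) (q | q) h
    · rw [hB.ex_inj p q h]
    · exact (key p q h).elim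
    · exact (key q p fun t => (h t).symm).elim
    · rw [hC.ex_inj p q h]
  int_inj := by
    have key := labels_ne hd hB.intIn_mem hC.intIn_mem hB.intIn_nonempty
    rintro (p | p) (q | q) h h'
    · rw [hB.int_inj p q h h']
    · exact (key p q h).elim
    · exact (key q p fun t => (h t).symm).elim
    · rw [hC.int_inj p q h h']

section Par

variable {B C : BoxSys α}

/-- The covering place has an action of `B` as an output, so by disjointness of the alphabets it is
a place of `B`. -/
theorem par_good_left (hB : B.Static) (hC : C.Static) (hd : Disjoint B.acts C.acts)
    {Se : B.Ent ⊕ C.Ent → Prop} {Si : B.Int ⊕ C.Int → Prop} (hS : (par B C).Good Se Si) :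
    B.Good (fun p => Se (.inl p)) (fun p => Si (.inl p)) := by
  rw [Set.disjoint_left] at hd
  refine ⟨fun p t w h h' => ?_, fun p t w h h' => ?_, fun p t w h h' => ?_⟩
  · obtain ⟨q | q, hq, h₁, h₂⟩ := hS.ent (.inl p) t w h h'
    · exact ⟨q, hq, h₁, h₂⟩
    · exact (hd (hB.entOut_mem _ _ h) (hC.entOut_mem _ _ h₁)).elim
  · obtain ⟨q | q, hq, h₁, h₂⟩ := hS.out_out (.inl p) t w h h'
    · exact ⟨q, hq, h₁, h₂⟩
    · exact (hd (hB.intOut_mem _ _ h) (hC.intOut_mem _ _ h₁)).elim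
  · obtain ⟨q | q, hq, h₁, h₂⟩ := hS.out_in (.inl p) t w h h'
    · exact ⟨q, hq, h₁, h₂⟩
    · exact (hd (hB.intOut_mem _ _ h) (hC.intOut_mem _ _ h₁)).elim

theorem par_good_right (hB : B.Static) (hC : C.Static) (hd : Disjoint B.acts C.acts)
    {Se : B.Ent ⊕ C.Ent → Prop} {Si : B.Int ⊕ C.Int → Prop} (hS : (par B C).Good Se Si) :
    C.Good (fun p => Se (.inr p)) (fun p => Si (.inr p)) := by
  rw [Set.disjoint_left] at hd
  refine ⟨fun p t w h h' => ?_, fun p t w h h' => ?_, fun p t w h h' => ?_⟩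
  · obtain ⟨q | q, hq, h₁, h₂⟩ := hS.ent (.inr p) t w h h'
    · exact (hd (hB.entOut_mem _ _ h₁) (hC.entOut_mem _ _ h)).elim
    · exact ⟨q, hq, h₁, h₂⟩
  · obtain ⟨q | q, hq, h₁, h₂⟩ := hS.out_out (.inr p) t w h h'
    · exact (hd (hB.intOut_mem _ _ h₁) (hC.intOut_mem _ _ h)).elim
    · exact ⟨q, hq, h₁, h₂⟩
  · obtain ⟨q | q, hq, h₁, h₂⟩ := hS.out_in (.inr p) t w h h'
    · exact (hd (hB.intOut_mem _ _ h₁) (hC.intOut_mem _ _ h)).elim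
    · exact ⟨q, hq, h₁, h₂⟩

theorem par_start : (.start : (par B C).Marking) = parMark B C .start .start := by
  ext (p | p) <;> rfl

theorem par_final : (.final : (par B C).Marking) = parMark B C .final .final := by
  ext (p | p) <;> rfl

theorem par_fire_left (hC : C.Static) (hd : Disjoint B.acts C.acts) {m : B.Marking}
    {n : C.Marking} {t : α} (ht : t ∈ B.acts) :
    (par B C).fire (parMark B C m n) t = parMark B C (B.fire m t) n := by
  have ht' := Set.disjoint_left.1 hd ht
  ext (p | p)
  · rfl
  · exact and_iff_left fun h => ht' (hC.entOut_mem _ _ h)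
  · rfl
  · exact or_iff_left fun h => ht' (hC.exIn_mem _ _ h)
  · rfl
  · exact (or_iff_left fun h => ht' (hC.intIn_mem _ _ h)).trans
      (and_iff_left fun h => ht' (hC.intOut_mem _ _ h))

theorem par_fire_right (hB : B.Static) (hd : Disjoint B.acts C.acts) {m : B.Marking}
    {n : C.Marking} {t : α} (ht : t ∈ C.acts) :
    (par B C).fire (parMark B C m n) t = parMark B C m (C.fire n t) := by
  have ht' := Set.disjoint_right.1 hd ht
  ext (p | p)
  · exact and_iff_left fun h => ht' (hB.entOut_mem _ _ h)
  · rfl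
  · exact or_iff_left fun h => ht' (hB.exIn_mem _ _ h)
  · rfl
  · exact (or_iff_left fun h => ht' (hB.intIn_mem _ _ h)).trans
      (and_iff_left fun h => ht' (hB.intOut_mem _ _ h))
  · rfl

/-- The components do not interact: a transition of one is not connected to any place of the other,
so each property is inherited coordinatewise. -/
theorem par_dynamic (hB : B.Static) (hC : C.Static) (hB' : B.Dynamic) (hC' : C.Dynamic)
    (hd : Disjoint B.acts C.acts) : (par B C).Dynamic where
  start_mem := ⟨_, _, hB'.start_mem, hC'.start_mem, par_start⟩
  final_mem := ⟨_, _, hB'.final_mem, hC'.final_mem, par_final⟩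
  eq_start := by
    rintro _ ⟨m, n, hm, hn, rfl⟩ h
    rw [hB'.eq_start m hm fun p => h (.inl p), hC'.eq_start n hn fun p => h (.inr p), par_start]
  eq_final := by
    rintro _ ⟨m, n, hm, hn, rfl⟩ h
    rw [hB'.eq_final m hm fun p => h (.inl p), hC'.eq_final n hn fun p => h (.inr p), par_final]
  ent_marked := by
    rintro _ ⟨m, n, hm, hn, rfl⟩ ⟨p | p, h⟩
    · obtain ⟨t, ⟨p, hp⟩, ht⟩ := hB'.ent_marked m hm ⟨p, h⟩
      refine ⟨t, ⟨.inl p, hp⟩, ?_⟩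
      rintro (q | q) hq
      · exact ht q hq
      · exact (Set.disjoint_left.1 hd (hB.entOut_mem _ _ hp) (hC.entOut_mem _ _ hq)).elim
    · obtain ⟨t, ⟨p, hp⟩, ht⟩ := hC'.ent_marked n hn ⟨p, h⟩
      refine ⟨t, ⟨.inr p, hp⟩, ?_⟩
      rintro (q | q) hq
      · exact (Set.disjoint_left.1 hd (hB.entOut_mem _ _ hq) (hC.entOut_mem _ _ hp)).elim
      · exact ht q hq
  ent_unmarked := by
    rintro _ ⟨m, n, hm, hn, rfl⟩ ⟨p | p, h⟩
    · obtain ⟨t, ⟨p, hp⟩, ht⟩ := hB'.ent_unmarked m hm ⟨p, h⟩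
      refine ⟨t, ⟨.inl p, hp⟩, ?_⟩
      rintro (q | q) hq
      · exact ht q hq
      · exact (Set.disjoint_left.1 hd (hB.entOut_mem _ _ hp) (hC.entOut_mem _ _ hq)).elim
    · obtain ⟨t, ⟨p, hp⟩, ht⟩ := hC'.ent_unmarked n hn ⟨p, h⟩
      refine ⟨t, ⟨.inr p, hp⟩, ?_⟩
      rintro (q | q) hq
      · exact (Set.disjoint_left.1 hd (hB.entOut_mem _ _ hq) (hC.entOut_mem _ _ hp)).elim
      · exact ht q hq
  ex_unmarked := by
    rintro _ ⟨m, n, hm, hn, rfl⟩ ⟨p | p, h⟩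
    · obtain ⟨t, ⟨p, hp⟩, ht⟩ := hB'.ex_unmarked m hm ⟨p, h⟩
      refine ⟨t, ⟨.inl p, hp⟩, ?_⟩
      rintro (q | q) hq
      · exact ht q hq
      · exact (Set.disjoint_left.1 hd (hB.exIn_mem _ _ hp) (hC.exIn_mem _ _ hq)).elim
    · obtain ⟨t, ⟨p, hp⟩, ht⟩ := hC'.ex_unmarked n hn ⟨p, h⟩
      refine ⟨t, ⟨.inr p, hp⟩, ?_⟩
      rintro (q | q) hq
      · exact (Set.disjoint_left.1 hd (hB.exIn_mem _ _ hq) (hC.exIn_mem _ _ hp)).elim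
      · exact ht q hq
  fire := by
    rintro _ ⟨m, n, hm, hn, rfl⟩ t (ht | ht)
    · have ht' := Set.disjoint_left.1 hd ht
      rcases hB'.fire m hm t ht with h | h
      · refine Or.inl ⟨?_, ?_, ?_, ?_, par_fire_left hC hd ht ▸ ⟨_, _, h.mem, hn, rfl⟩⟩
        · rintro (p | p) hp
          exacts [h.ent p hp, (ht' (hC.entOut_mem _ _ hp)).elim]
        · rintro (p | p) hp
          exacts [h.out p hp, (ht' (hC.intOut_mem _ _ hp)).elim]
        · rintro (p | p) hp
          exacts [h.ex_safe p hp, (ht' (hC.exIn_mem _ _ hp)).elim]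
        · rintro (p | p) hp
          exacts [h.int_safe p hp, (ht' (hC.intIn_mem _ _ hp)).elim]
      · refine Or.inr fun Se Si hS => ?_
        rcases h _ _ (par_good_left hB hC hd hS) with ⟨p, hp⟩ | ⟨p, hp⟩
        exacts [Or.inl ⟨.inl p, hp⟩, Or.inr ⟨.inl p, hp⟩]
    · have ht' := Set.disjoint_right.1 hd ht
      rcases hC'.fire n hn t ht with h | h
      · refine Or.inl ⟨?_, ?_, ?_, ?_, par_fire_right hB hd ht ▸ ⟨_, _, hm, h.mem, rfl⟩⟩
        · rintro (p | p) hp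
          exacts [(ht' (hB.entOut_mem _ _ hp)).elim, h.ent p hp]
        · rintro (p | p) hp
          exacts [(ht' (hB.intOut_mem _ _ hp)).elim, h.out p hp]
        · rintro (p | p) hp
          exacts [(ht' (hB.exIn_mem _ _ hp)).elim, h.ex_safe p hp]
        · rintro (p | p) hp
          exacts [(ht' (hB.intIn_mem _ _ hp)).elim, h.int_safe p hp]
      · refine Or.inr fun Se Si hS => ?_
        rcases h _ _ (par_good_right hB hC hd hS) with ⟨p, hp⟩ | ⟨p, hp⟩
        exacts [Or.inl ⟨.inr p, hp⟩, Or.inr ⟨.inr p, hp⟩]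
  separated := by
    rintro Se Si hS _ _ ⟨m, n, hm, hn, rfl⟩ ⟨m', n', hm', hn', rfl⟩ he hi
    rw [hB'.separated _ _ (par_good_left hB hC hd hS) m m' hm hm' (fun p => he (.inl p))
        (fun p => hi (.inl p)),
      hC'.separated _ _ (par_good_right hB hC hd hS) n n' hn hn' (fun p => he (.inr p))
        (fun p => hi (.inr p))]

end Par

/-! ### Sequential composition -/

/-- The marking of `B;C` while `B` is running. -/
def seqLeft (B C : BoxSys α) (m : B.Marking) :
    BoxMarking B.Ent C.Ex (B.Int ⊕ C.Int ⊕ B.Ex × C.Ent) where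
  e := m.e
  x _ := False
  i := Sum.elim m.i (Sum.elim (fun _ => False) fun p => m.x p.1)

/-- The marking of `B;C` while `C` is running. -/
def seqRight (B C : BoxSys α) (m : C.Marking) :
    BoxMarking B.Ent C.Ex (B.Int ⊕ C.Int ⊕ B.Ex × C.Ent) where
  e _ := False
  x := m.x
  i := Sum.elim (fun _ => False) (Sum.elim m.i fun p => m.e p.2)

/-- Sequential composition of boxes. -/
abbrev seq (B C : BoxSys α) : BoxSys α where
  acts := B.acts ∪ C.acts
  Ent := B.Ent
  Ex := C.Ex
  Int := B.Int ⊕ C.Int ⊕ B.Ex × C.Ent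
  entOut := B.entOut
  exIn := C.exIn
  intIn := Sum.elim B.intIn (Sum.elim C.intIn fun p => B.exIn p.1)
  intOut := Sum.elim B.intOut (Sum.elim C.intOut fun p => C.entOut p.2)
  states M := (∃ m, B.states m ∧ M = seqLeft B C m) ∨ ∃ m, C.states m ∧ M = seqRight B C m

section Seq

variable {B C : BoxSys α}

theorem seq_static (hB : B.Static) (hC : C.Static) (hd : Disjoint B.acts C.acts) :
    (seq B C).Static where
  entOut_mem p t h := Or.inl (hB.entOut_mem p t h)
  exIn_mem p t h := Or.inr (hC.exIn_mem p t h)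
  intIn_mem := by
    rintro (p | p | p) t h
    exacts [Or.inl (hB.intIn_mem _ _ h), Or.inr (hC.intIn_mem _ _ h), Or.inl (hB.exIn_mem _ _ h)]
  intOut_mem := by
    rintro (p | p | p) t h
    exacts [Or.inl (hB.intOut_mem _ _ h), Or.inr (hC.intOut_mem _ _ h),
      Or.inr (hC.entOut_mem _ _ h)]
  ent_nonempty := hB.ent_nonempty
  ex_nonempty := hC.ex_nonempty
  entOut_nonempty := hB.entOut_nonempty
  exIn_nonempty := hC.exIn_nonempty
  intIn_nonempty := by
    rintro (p | p | p)
    exacts [hB.intIn_nonempty _, hC.intIn_nonempty _, hB.exIn_nonempty _]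
  intOut_nonempty := by
    rintro (p | p | p)
    exacts [hB.intOut_nonempty _, hC.intOut_nonempty _, hC.entOut_nonempty _]
  exists_out := by
    obtain ⟨b⟩ := hB.ex_nonempty
    rintro t (ht | ht)
    · rcases hB.exists_out t ht with ⟨p, hp⟩ | ⟨p, hp⟩
      exacts [Or.inl ⟨p, hp⟩, Or.inr ⟨.inl p, hp⟩]
    · rcases hC.exists_out t ht with ⟨p, hp⟩ | ⟨p, hp⟩
      exacts [Or.inr ⟨.inr (.inr (b, p)), hp⟩, Or.inr ⟨.inr (.inl p), hp⟩]
  out_disjoint := by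
    rintro p (q | q | q) t h h'
    · exact hB.out_disjoint p q t h h'
    · exact Set.disjoint_left.1 hd (hB.entOut_mem _ _ h) (hC.intOut_mem _ _ h')
    · exact Set.disjoint_left.1 hd (hB.entOut_mem _ _ h) (hC.entOut_mem _ _ h')
  ent_inj := hB.ent_inj
  ex_inj := hC.ex_inj
  int_inj := by
    have k₁ := labels_ne hd hB.intIn_mem hC.intIn_mem hB.intIn_nonempty
    have k₂ := labels_ne hd hB.intOut_mem hC.entOut_mem hB.intOut_nonempty
    have k₃ := labels_ne hd.symm hC.intIn_mem hB.exIn_mem hC.intIn_nonempty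
    rintro (p | p | p) (q | q | q) h h'
    · rw [hB.int_inj p q h h']
    · exact (k₁ p q h).elim
    · exact (k₂ p q.2 h').elim
    · exact (k₁ q p fun t => (h t).symm).elim
    · rw [hC.int_inj p q h h']
    · exact (k₃ p q.1 h).elim
    · exact (k₂ q p.2 fun t => (h' t).symm).elim
    · exact (k₃ q p.1 fun t => (h t).symm).elim
    · rw [Prod.ext (hB.ex_inj p.1 q.1 h) (hC.ent_inj p.2 q.2 h')]

theorem seq_good_left (hB : B.Static) (hC : C.Static) (hd : Disjoint B.acts C.acts)
    {Se : B.Ent → Prop} {Si : B.Int ⊕ C.Int ⊕ B.Ex × C.Ent → Prop}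
    (hS : (seq B C).Good Se Si) : B.Good Se (fun p => Si (.inl p)) := by
  rw [Set.disjoint_left] at hd
  refine ⟨hS.ent, fun p t w h h' => ?_, fun p t w h h' => ?_⟩
  · obtain ⟨q | q | q, hq, h₁, h₂⟩ := hS.out_out (.inl p) t w h h'
    · exact ⟨q, hq, h₁, h₂⟩
    · exact (hd (hB.intOut_mem _ _ h) (hC.intOut_mem _ _ h₁)).elim
    · exact (hd (hB.intOut_mem _ _ h) (hC.entOut_mem _ _ h₁)).elim
  · obtain ⟨q | q | q, hq, h₁, h₂⟩ := hS.out_in (.inl p) t w h h'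
    · exact ⟨q, hq, h₁, h₂⟩
    · exact (hd (hB.intOut_mem _ _ h) (hC.intOut_mem _ _ h₁)).elim
    · exact (hd (hB.intOut_mem _ _ h) (hC.entOut_mem _ _ h₁)).elim

/-- An entry place of `C` survives only as a coordinate of junction places, and counts as selected
if one of these is. To use the hypothesis, an entry place is paired with an arbitrary exit place of
`B`; `out_disjoint` then ensures that the covering place is again a junction place. -/
theorem seq_good_right (hB : B.Static) (hC : C.Static) (hd : Disjoint B.acts C.acts)
    {Se : B.Ent → Prop} {Si : B.Int ⊕ C.Int ⊕ B.Ex × C.Ent → Prop}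
    (hS : (seq B C).Good Se Si) :
    C.Good (fun q => ∃ p, Si (.inr (.inr (p, q)))) (fun p => Si (.inr (.inl p))) := by
  rw [Set.disjoint_left] at hd
  obtain ⟨b⟩ := hB.ex_nonempty
  refine ⟨fun p t w h h' => ?_, fun p t w h h' => ?_, fun p t w h h' => ?_⟩
  · obtain ⟨q | q | q, hq, h₁, h₂⟩ := hS.out_out (.inr (.inr (b, p))) t w h h'
    · exact (hd (hB.intOut_mem _ _ h₁) (hC.entOut_mem _ _ h)).elim
    · exact (hC.out_disjoint _ _ _ h h₁).elim
    · exact ⟨q.2, ⟨q.1, hq⟩, h₁, h₂⟩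
  · obtain ⟨q | q | q, hq, h₁, h₂⟩ := hS.out_out (.inr (.inl p)) t w h h'
    · exact (hd (hB.intOut_mem _ _ h₁) (hC.intOut_mem _ _ h)).elim
    · exact ⟨q, hq, h₁, h₂⟩
    · exact (hC.out_disjoint _ _ _ h₁ h).elim
  · obtain ⟨q | q | q, hq, h₁, h₂⟩ := hS.out_in (.inr (.inl p)) t w h h'
    · exact (hd (hB.intOut_mem _ _ h₁) (hC.intOut_mem _ _ h)).elim
    · exact ⟨q, hq, h₁, h₂⟩
    · exact (hC.out_disjoint _ _ _ h₁ h).elim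

/-- A good selection covers each pair of an exit transition of `B` and an entry transition
of `C`. -/
theorem seq_good_cross (hB : B.Static) (hC : C.Static) (hd : Disjoint B.acts C.acts)
    {Se : B.Ent → Prop} {Si : B.Int ⊕ C.Int ⊕ B.Ex × C.Ent → Prop}
    (hS : (seq B C).Good Se Si) {p : B.Ex} {q : C.Ent} {t w : α} (ht : C.entOut q t)
    (hw : B.exIn p w) :
    ∃ p' q', Si (.inr (.inr (p', q'))) ∧ C.entOut q' t ∧ B.exIn p' w := by
  obtain ⟨r | r | r, hr, h₁, h₂⟩ := hS.out_in (.inr (.inr (p, q))) t w ht hw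
  · exact (Set.disjoint_left.1 hd (hB.intOut_mem _ _ h₁) (hC.entOut_mem _ _ ht)).elim
  · exact (hC.out_disjoint _ _ _ ht h₁).elim
  · exact ⟨r.1, r.2, hr, h₁, h₂⟩

theorem seq_start : (.start : (seq B C).Marking) = seqLeft B C .start := by
  ext p
  · rfl
  · rfl
  · rcases p with p | p | p <;> rfl

theorem seq_final : (.final : (seq B C).Marking) = seqRight B C .final := by
  ext p
  · rfl
  · rfl
  · rcases p with p | p | p <;> rfl

/-- The handover: in both readings exactly the junction places are marked. -/
theorem seq_middle : seqLeft B C .final = seqRight B C .start := by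
  ext p
  · rfl
  · rfl
  · rcases p with p | p | p <;> rfl

theorem seq_fire_left (hC : C.Static) (hd : Disjoint B.acts C.acts) {m : B.Marking} {t : α}
    (ht : t ∈ B.acts) : (seq B C).fire (seqLeft B C m) t = seqLeft B C (B.fire m t) := by
  have ht' := Set.disjoint_left.1 hd ht
  ext p
  · rfl
  · exact or_iff_right (fun h => h) |>.trans (iff_of_false (fun h => ht' (hC.exIn_mem _ _ h))
      (fun h => h))
  · rcases p with p | p | p
    · rfl
    · exact iff_of_false (fun h => h.elim And.left fun h => ht' (hC.intIn_mem _ _ h)) fun h => h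
    · exact or_congr_left (and_iff_left fun h => ht' (hC.entOut_mem _ _ h))

theorem seq_fire_right (hB : B.Static) (hd : Disjoint B.acts C.acts) {m : C.Marking} {t : α}
    (ht : t ∈ C.acts) : (seq B C).fire (seqRight B C m) t = seqRight B C (C.fire m t) := by
  have ht' := Set.disjoint_right.1 hd ht
  ext p
  · exact iff_of_false And.left fun h => h
  · rfl
  · rcases p with p | p | p
    · exact iff_of_false (fun h => h.elim And.left fun h => ht' (hB.intIn_mem _ _ h)) fun h => h
    · rfl
    · exact or_iff_left fun h => ht' (hB.exIn_mem _ _ h)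

theorem seq_canFire_left (hC : C.Static) (hd : Disjoint B.acts C.acts) {m : B.Marking}
    {t : α} (ht : t ∈ B.acts) (h : B.CanFire m t) : (seq B C).CanFire (seqLeft B C m) t := by
  have ht' := Set.disjoint_left.1 hd ht
  refine ⟨h.ent, ?_, fun _ _ h => h, ?_, seq_fire_left hC hd ht ▸ Or.inl ⟨_, h.mem, rfl⟩⟩
  · rintro (p | p | p) hp
    exacts [h.out p hp, (ht' (hC.intOut_mem _ _ hp)).elim, (ht' (hC.entOut_mem _ _ hp)).elim]
  -- A token on a junction place is a token on its exit coordinate as long as `B` runs, so `ex_safe`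
  -- excludes it.
  · rintro (p | p | p) hp hm
    exacts [h.int_safe p hp hm, hm.elim, (h.ex_safe p.1 hp hm).elim]

theorem seq_canFire_right (hB : B.Static) (hd : Disjoint B.acts C.acts) {m : C.Marking}
    {t : α} (ht : t ∈ C.acts) (h : C.CanFire m t) : (seq B C).CanFire (seqRight B C m) t := by
  have ht' := Set.disjoint_right.1 hd ht
  refine ⟨fun p hp => (ht' (hB.entOut_mem _ _ hp)).elim, ?_, h.ex_safe, ?_,
    seq_fire_right hB hd ht ▸ Or.inr ⟨_, h.mem, rfl⟩⟩
  · rintro (p | p | p) hp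
    exacts [(ht' (hB.intOut_mem _ _ hp)).elim, h.out p hp, h.ent p.2 hp]
  · rintro (p | p | p) hp hm
    exacts [hm.elim, h.int_safe p hp hm, (ht' (hB.exIn_mem _ _ hp)).elim]

/-- The right-hand marking leaves `B` empty, so `m` must be final. By `seq_middle` the comparison
then takes place inside `C`, between its start and `n`. -/
theorem seq_separated_left_right (hB : B.Static) (hC : C.Static) (hB' : B.Dynamic)
    (hC' : C.Dynamic) (hd : Disjoint B.acts C.acts) {Se : B.Ent → Prop}
    {Si : B.Int ⊕ C.Int ⊕ B.Ex × C.Ent → Prop} (hS : (seq B C).Good Se Si)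
    {m : B.Marking} {n : C.Marking} (hm : B.states m) (hn : C.states n)
    (he : ∀ p, Se p → ((seqLeft B C m).e p ↔ (seqRight B C n).e p))
    (hi : ∀ p, Si p → ((seqLeft B C m).i p ↔ (seqRight B C n).i p)) :
    seqLeft B C m = seqRight B C n := by
  obtain rfl := hB'.eq_final_of_unmarked (seq_good_left hB hC hd hS) hm
    (fun p hp => (he p hp).1) (fun p hp => (hi (.inl p) hp).1)
  rw [seq_middle]
  congr 1
  exact hC'.separated _ _ (seq_good_right hB hC hd hS) _ _ hC'.start_mem hn
    (fun q ⟨p, hp⟩ => hi (.inr (.inr (p, q))) hp) (fun p hp => hi (.inr (.inl p)) hp)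

theorem seq_dynamic (hB : B.Static) (hC : C.Static) (hB' : B.Dynamic) (hC' : C.Dynamic)
    (hd : Disjoint B.acts C.acts) : (seq B C).Dynamic where
  start_mem := Or.inl ⟨_, hB'.start_mem, seq_start⟩
  final_mem := Or.inr ⟨_, hC'.final_mem, seq_final⟩
  eq_start := by
    rintro _ (⟨m, hm, rfl⟩ | ⟨m, hm, rfl⟩) h
    · rw [hB'.eq_start m hm h, seq_start]
    · exact (h hB.ent_nonempty.some).elim
  eq_final := by
    rintro _ (⟨m, hm, rfl⟩ | ⟨m, hm, rfl⟩) h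
    · exact (h hC.ex_nonempty.some).elim
    · rw [hC'.eq_final m hm h, seq_final]
  ent_marked := by
    rintro _ (⟨m, hm, rfl⟩ | ⟨m, hm, rfl⟩) h
    · exact hB'.ent_marked m hm h
    · exact h.choose_spec.elim
  ent_unmarked := by
    rintro _ (⟨m, hm, rfl⟩ | ⟨m, hm, rfl⟩) h
    · exact hB'.ent_unmarked m hm h
    · obtain ⟨t, ht⟩ := hB.entOut_nonempty h.choose
      exact ⟨t, ⟨_, ht⟩, fun _ _ h => h⟩
  ex_unmarked := by
    rintro _ (⟨m, hm, rfl⟩ | ⟨m, hm, rfl⟩) h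
    · obtain ⟨t, ht⟩ := hC.exIn_nonempty h.choose
      exact ⟨t, ⟨_, ht⟩, fun _ _ h => h⟩
    · exact hC'.ex_unmarked m hm h
  fire := by
    have right : ∀ m, C.states m → ∀ t ∈ C.acts, (seq B C).CanFire (seqRight B C m) t ∨
        (seq B C).Blocked (seqRight B C m) t := by
      intro m hm t ht
      refine (hC'.fire m hm t ht).imp (seq_canFire_right hB hd ht) fun h Se Si hS => Or.inr ?_
      rcases h _ _ (seq_good_right hB hC hd hS) with ⟨q, ⟨p, hp⟩, hq⟩ | ⟨p, hp⟩
      exacts [⟨.inr (.inr (p, q)), hp, hq⟩, ⟨.inr (.inl p), hp⟩]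
    rintro _ (⟨m, hm, rfl⟩ | ⟨m, hm, rfl⟩) t (ht | ht)
    · refine (hB'.fire m hm t ht).imp (seq_canFire_left hC hd ht) fun h Se Si hS => ?_
      refine (h _ _ (seq_good_left hB hC hd hS)).imp id ?_
      rintro ⟨p, hp⟩
      exact ⟨.inl p, hp⟩
    · by_cases hx : ∀ p, m.x p
      · rw [hB'.eq_final m hm hx, seq_middle]
        exact right _ hC'.start_mem t ht
      · push Not at hx
        -- The covering place for `t` and `w` may have any exit coordinate connected to `w`, so `w`
        -- is chosen with all its exit places unmarked.
        obtain ⟨w, ⟨p, hp⟩, hw⟩ := hB'.ex_unmarked m hm hx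
        refine Or.inr fun Se Si hS => Or.inr ?_
        rcases hC.exists_out t ht with ⟨q, hq⟩ | ⟨q, hq⟩
        · obtain ⟨p', q', hS', h₁, h₂⟩ := seq_good_cross hB hC hd hS hq hp
          exact ⟨.inr (.inr (p', q')), hS', h₁, hw p' h₂⟩
        · obtain ⟨r, hr, h, -⟩ := (seq_good_right hB hC hd hS).out_out q t t hq hq
          exact ⟨.inr (.inl r), hr, h, fun h => h⟩
    -- `B` has finished and holds no tokens, while each of its transitions keeps a selected
    -- pre-place.
    · refine Or.inr fun Se Si hS => ?_
      rcases (seq_good_left hB hC hd hS).exists_out hB ht with ⟨p, hp, h⟩ | ⟨p, hp, h⟩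
      exacts [Or.inl ⟨p, hp, h, fun h => h⟩, Or.inr ⟨.inl p, hp, h, fun h => h⟩]
    · exact right m hm t ht
  separated := by
    rintro Se Si hS _ _ (⟨m, hm, rfl⟩ | ⟨m, hm, rfl⟩) (⟨n, hn, rfl⟩ | ⟨n, hn, rfl⟩) he hi
    · rw [hB'.separated _ _ (seq_good_left hB hC hd hS) m n hm hn he fun p => hi (.inl p)]
    · exact seq_separated_left_right hB hC hB' hC' hd hS hm hn he hi
    · exact (seq_separated_left_right hB hC hB' hC' hd hS hn hm (fun p hp => (he p hp).symm)
        (fun p hp => (hi p hp).symm)).symm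
    · rw [hC'.separated _ _ (seq_good_right hB hC hd hS) m n hm hn
        (fun q ⟨p, hp⟩ => hi (.inr (.inr (p, q))) hp) fun p => hi (.inr (.inl p))]

/-- Entry tokens occur only while `B` runs and exit tokens only while `C` runs; this is why H may
contain `E;E` with arbitrary components. -/
theorem seq_exclusive : (seq B C).Exclusive := by
  rintro _ (⟨m, -, rfl⟩ | ⟨m, -, rfl⟩) p q h
  · exact not_false
  · exact h.elim

end Seq

/-! ### Choice -/

/-- The marking of the choice between `B` and `C` while `B` is running. -/
def choiceLeft (B C : BoxSys α) (m : B.Marking) :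
    BoxMarking (B.Ent × C.Ent) (B.Ex × C.Ex) (B.Int ⊕ C.Int) where
  e p := m.e p.1
  x p := m.x p.1
  i := Sum.elim m.i fun _ => False

/-- The marking of the choice between `B` and `C` while `C` is running. -/
def choiceRight (B C : BoxSys α) (m : C.Marking) :
    BoxMarking (B.Ent × C.Ent) (B.Ex × C.Ex) (B.Int ⊕ C.Int) where
  e p := m.e p.2
  x p := m.x p.2
  i := Sum.elim (fun _ => False) m.i

/-- Choice between two boxes. -/
abbrev choice (B C : BoxSys α) : BoxSys α where
  acts := B.acts ∪ C.acts
  Ent := B.Ent × C.Ent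
  Ex := B.Ex × C.Ex
  Int := B.Int ⊕ C.Int
  entOut p t := B.entOut p.1 t ∨ C.entOut p.2 t
  exIn p t := B.exIn p.1 t ∨ C.exIn p.2 t
  intIn := Sum.elim B.intIn C.intIn
  intOut := Sum.elim B.intOut C.intOut
  states M := (∃ m, B.states m ∧ M = choiceLeft B C m) ∨ ∃ m, C.states m ∧ M = choiceRight B C m

/-- Intersecting with each of the two disjoint alphabets recovers both parts of a union of labels.
-/
theorem labels_or_congr {β γ : Type*} {f : β → α → Prop} {g : γ → α → Prop} {S T : Set α}
    (hST : Disjoint S T) (hf : ∀ p t, f p t → t ∈ S) (hg : ∀ p t, g p t → t ∈ T)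
    {p p' : β} {q q' : γ} (h : ∀ t, f p t ∨ g q t ↔ f p' t ∨ g q' t) :
    (∀ t, f p t ↔ f p' t) ∧ ∀ t, g q t ↔ g q' t := by
  have hd : ∀ {p q t}, f p t → ¬ g q t :=
    fun h₁ h₂ => Set.disjoint_left.1 hST (hf _ _ h₁) (hg _ _ h₂)
  refine ⟨fun t => ⟨fun h' => ?_, fun h' => ?_⟩, fun t => ⟨fun h' => ?_, fun h' => ?_⟩⟩
  · exact ((h t).1 (Or.inl h')).resolve_right (hd h')
  · exact ((h t).2 (Or.inl h')).resolve_right (hd h')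
  · exact ((h t).1 (Or.inr h')).resolve_left fun h'' => hd h'' h'
  · exact ((h t).2 (Or.inr h')).resolve_left fun h'' => hd h'' h'

section Choice

variable {B C : BoxSys α}

theorem choice_static (hB : B.Static) (hC : C.Static) (hd : Disjoint B.acts C.acts) :
    (choice B C).Static where
  entOut_mem p t h := h.imp (hB.entOut_mem _ _) (hC.entOut_mem _ _)
  exIn_mem p t h := h.imp (hB.exIn_mem _ _) (hC.exIn_mem _ _)
  intIn_mem := by
    rintro (p | p) t h
    exacts [Or.inl (hB.intIn_mem _ _ h), Or.inr (hC.intIn_mem _ _ h)]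
  intOut_mem := by
    rintro (p | p) t h
    exacts [Or.inl (hB.intOut_mem _ _ h), Or.inr (hC.intOut_mem _ _ h)]
  ent_nonempty := ⟨(hB.ent_nonempty.some, hC.ent_nonempty.some)⟩
  ex_nonempty := ⟨(hB.ex_nonempty.some, hC.ex_nonempty.some)⟩
  entOut_nonempty p := (hB.entOut_nonempty p.1).imp fun _ => Or.inl
  exIn_nonempty p := (hB.exIn_nonempty p.1).imp fun _ => Or.inl
  intIn_nonempty := by
    rintro (p | p)
    exacts [hB.intIn_nonempty p, hC.intIn_nonempty p]
  intOut_nonempty := by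
    rintro (p | p)
    exacts [hB.intOut_nonempty p, hC.intOut_nonempty p]
  exists_out := by
    obtain ⟨b⟩ := hB.ent_nonempty
    obtain ⟨c⟩ := hC.ent_nonempty
    rintro t (ht | ht)
    · rcases hB.exists_out t ht with ⟨p, hp⟩ | ⟨p, hp⟩
      exacts [Or.inl ⟨(p, c), Or.inl hp⟩, Or.inr ⟨.inl p, hp⟩]
    · rcases hC.exists_out t ht with ⟨p, hp⟩ | ⟨p, hp⟩
      exacts [Or.inl ⟨(b, p), Or.inr hp⟩, Or.inr ⟨.inr p, hp⟩]
  out_disjoint := by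
    rintro p (q | q) t (h | h) h'
    · exact hB.out_disjoint _ _ _ h h'
    · exact Set.disjoint_left.1 hd (hB.intOut_mem _ _ h') (hC.entOut_mem _ _ h)
    · exact Set.disjoint_left.1 hd (hB.entOut_mem _ _ h) (hC.intOut_mem _ _ h')
    · exact hC.out_disjoint _ _ _ h h'
  ent_inj p q h := by
    obtain ⟨h₁, h₂⟩ := labels_or_congr hd hB.entOut_mem hC.entOut_mem h
    exact Prod.ext (hB.ent_inj _ _ h₁) (hC.ent_inj _ _ h₂)
  ex_inj p q h := by
    obtain ⟨h₁, h₂⟩ := labels_or_congr hd hB.exIn_mem hC.exIn_mem h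
    exact Prod.ext (hB.ex_inj _ _ h₁) (hC.ex_inj _ _ h₂)
  int_inj := by
    have key := labels_ne hd hB.intIn_mem hC.intIn_mem hB.intIn_nonempty
    rintro (p | p) (q | q) h h'
    · rw [hB.int_inj p q h h']
    · exact (key p q h).elim
    · exact (key q p fun t => (h t).symm).elim
    · rw [hC.int_inj p q h h']

/-- The selection is projected to the first coordinate. An entry place of `B` is lifted with an
arbitrary second coordinate, which contributes no action of `B`. -/
theorem choice_good_left (hB : B.Static) (hC : C.Static) (hd : Disjoint B.acts C.acts)
    {Se : B.Ent × C.Ent → Prop} {Si : B.Int ⊕ C.Int → Prop} (hS : (choice B C).Good Se Si) :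
    B.Good (fun p => ∃ q, Se (p, q)) (fun p => Si (.inl p)) := by
  rw [Set.disjoint_left] at hd
  obtain ⟨c⟩ := hC.ent_nonempty
  refine ⟨fun p t w h h' => ?_, fun p t w h h' => ?_, fun p t w h h' => ?_⟩
  · obtain ⟨q, hq, h₁, h₂⟩ := hS.ent (p, c) t w (Or.inl h) (Or.inl h')
    exact ⟨q.1, ⟨q.2, hq⟩,
      h₁.resolve_right fun h₁ => hd (hB.entOut_mem _ _ h) (hC.entOut_mem _ _ h₁),
      h₂.resolve_right fun h₂ => hd (hB.entOut_mem _ _ h') (hC.entOut_mem _ _ h₂)⟩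
  · obtain ⟨q | q, hq, h₁, h₂⟩ := hS.out_out (.inl p) t w h h'
    · exact ⟨q, hq, h₁, h₂⟩
    · exact (hd (hB.intOut_mem _ _ h) (hC.intOut_mem _ _ h₁)).elim
  · obtain ⟨q | q, hq, h₁, h₂⟩ := hS.out_in (.inl p) t w h h'
    · exact ⟨q, hq, h₁, h₂⟩
    · exact (hd (hB.intOut_mem _ _ h) (hC.intOut_mem _ _ h₁)).elim

theorem choice_good_right (hB : B.Static) (hC : C.Static) (hd : Disjoint B.acts C.acts)
    {Se : B.Ent × C.Ent → Prop} {Si : B.Int ⊕ C.Int → Prop} (hS : (choice B C).Good Se Si) :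
    C.Good (fun q => ∃ p, Se (p, q)) (fun p => Si (.inr p)) := by
  rw [Set.disjoint_left] at hd
  obtain ⟨b⟩ := hB.ent_nonempty
  refine ⟨fun p t w h h' => ?_, fun p t w h h' => ?_, fun p t w h h' => ?_⟩
  · obtain ⟨q, hq, h₁, h₂⟩ := hS.ent (b, p) t w (Or.inr h) (Or.inr h')
    exact ⟨q.2, ⟨q.1, hq⟩,
      h₁.resolve_left fun h₁ => hd (hB.entOut_mem _ _ h₁) (hC.entOut_mem _ _ h),
      h₂.resolve_left fun h₂ => hd (hB.entOut_mem _ _ h₂) (hC.entOut_mem _ _ h')⟩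
  · obtain ⟨q | q, hq, h₁, h₂⟩ := hS.out_out (.inr p) t w h h'
    · exact (hd (hB.intOut_mem _ _ h₁) (hC.intOut_mem _ _ h)).elim
    · exact ⟨q, hq, h₁, h₂⟩
  · obtain ⟨q | q, hq, h₁, h₂⟩ := hS.out_in (.inr p) t w h h'
    · exact (hd (hB.intOut_mem _ _ h₁) (hC.intOut_mem _ _ h)).elim
    · exact ⟨q, hq, h₁, h₂⟩

/-- A good selection covers each pair of entry transitions of `B` and `C`. -/
theorem choice_good_cross (hB : B.Static) (hC : C.Static) (hd : Disjoint B.acts C.acts)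
    {Se : B.Ent × C.Ent → Prop} {Si : B.Int ⊕ C.Int → Prop} (hS : (choice B C).Good Se Si)
    {p : B.Ent} {q : C.Ent} {t w : α} (ht : B.entOut p t) (hw : C.entOut q w) :
    ∃ p' q', Se (p', q') ∧ B.entOut p' t ∧ C.entOut q' w := by
  rw [Set.disjoint_left] at hd
  obtain ⟨r, hr, h₁, h₂⟩ := hS.ent (p, q) t w (Or.inl ht) (Or.inr hw)
  exact ⟨r.1, r.2, hr,
    h₁.resolve_right fun h₁ => hd (hB.entOut_mem _ _ ht) (hC.entOut_mem _ _ h₁),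
    h₂.resolve_left fun h₂ => hd (hB.entOut_mem _ _ h₂) (hC.entOut_mem _ _ hw)⟩

/-- The start marking belongs to both branches, and so does the final marking below. These
coincidences reduce a comparison of different branches to one inside a single branch. -/
theorem choice_start_left : (.start : (choice B C).Marking) = choiceLeft B C .start := by
  ext p
  · rfl
  · rfl
  · rcases p with p | p <;> rfl

theorem choice_start_right : (.start : (choice B C).Marking) = choiceRight B C .start := by
  ext p
  · rfl
  · rfl
  · rcases p with p | p <;> rfl

theorem choice_final_left : (.final : (choice B C).Marking) = choiceLeft B C .final := by
  ext p
  · rfl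
  · rfl
  · rcases p with p | p <;> rfl

theorem choice_final_right : (.final : (choice B C).Marking) = choiceRight B C .final := by
  ext p
  · rfl
  · rfl
  · rcases p with p | p <;> rfl

theorem choice_fire_left (hC : C.Static) (hd : Disjoint B.acts C.acts) {m : B.Marking} {t : α}
    (ht : t ∈ B.acts) :
    (choice B C).fire (choiceLeft B C m) t = choiceLeft B C (B.fire m t) := by
  have ht' := Set.disjoint_left.1 hd ht
  ext p
  · exact and_congr_right' (not_congr (or_iff_left fun h => ht' (hC.entOut_mem _ _ h)))
  · exact or_congr_right (or_iff_left fun h => ht' (hC.exIn_mem _ _ h))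
  · rcases p with p | p
    · rfl
    · exact iff_of_false (fun h => h.elim And.left fun h => ht' (hC.intIn_mem _ _ h)) fun h => h

theorem choice_fire_right (hB : B.Static) (hd : Disjoint B.acts C.acts) {m : C.Marking} {t : α}
    (ht : t ∈ C.acts) :
    (choice B C).fire (choiceRight B C m) t = choiceRight B C (C.fire m t) := by
  have ht' := Set.disjoint_right.1 hd ht
  ext p
  · exact and_congr_right' (not_congr (or_iff_right fun h => ht' (hB.entOut_mem _ _ h)))
  · exact or_congr_right (or_iff_right fun h => ht' (hB.exIn_mem _ _ h))
  · rcases p with p | p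
    · exact iff_of_false (fun h => h.elim And.left fun h => ht' (hB.intIn_mem _ _ h)) fun h => h
    · rfl

theorem choice_fire_or_blocked_left (hB : B.Static) (hC : C.Static) (hB' : B.Dynamic)
    (hd : Disjoint B.acts C.acts) {m : B.Marking} (hm : B.states m) {t : α} (ht : t ∈ B.acts) :
    (choice B C).CanFire (choiceLeft B C m) t ∨ (choice B C).Blocked (choiceLeft B C m) t := by
  have ht' := Set.disjoint_left.1 hd ht
  refine (hB'.fire m hm t ht).imp (fun h => ?_) fun h Se Si hS => ?_
  · refine ⟨?_, ?_, ?_, ?_, choice_fire_left hC hd ht ▸ Or.inl ⟨_, h.mem, rfl⟩⟩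
    · rintro p (hp | hp)
      exacts [h.ent _ hp, (ht' (hC.entOut_mem _ _ hp)).elim]
    · rintro (p | p) hp
      exacts [h.out p hp, (ht' (hC.intOut_mem _ _ hp)).elim]
    · rintro p (hp | hp)
      exacts [h.ex_safe _ hp, (ht' (hC.exIn_mem _ _ hp)).elim]
    · rintro (p | p) hp hm
      exacts [h.int_safe p hp hm, hm.elim]
  · rcases h _ _ (choice_good_left hB hC hd hS) with ⟨p, ⟨q, hq⟩, h₁, h₂⟩ | ⟨p, hp⟩
    exacts [Or.inl ⟨(p, q), hq, Or.inl h₁, h₂⟩, Or.inr ⟨.inl p, hp⟩]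

theorem choice_fire_or_blocked_right (hB : B.Static) (hC : C.Static) (hC' : C.Dynamic)
    (hd : Disjoint B.acts C.acts) {m : C.Marking} (hm : C.states m) {t : α} (ht : t ∈ C.acts) :
    (choice B C).CanFire (choiceRight B C m) t ∨
      (choice B C).Blocked (choiceRight B C m) t := by
  have ht' := Set.disjoint_right.1 hd ht
  refine (hC'.fire m hm t ht).imp (fun h => ?_) fun h Se Si hS => ?_
  · refine ⟨?_, ?_, ?_, ?_, choice_fire_right hB hd ht ▸ Or.inr ⟨_, h.mem, rfl⟩⟩
    · rintro p (hp | hp)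
      exacts [(ht' (hB.entOut_mem _ _ hp)).elim, h.ent _ hp]
    · rintro (p | p) hp
      exacts [(ht' (hB.intOut_mem _ _ hp)).elim, h.out p hp]
    · rintro p (hp | hp)
      exacts [(ht' (hB.exIn_mem _ _ hp)).elim, h.ex_safe _ hp]
    · rintro (p | p) hp hm
      exacts [hm.elim, h.int_safe p hp hm]
  · rcases h _ _ (choice_good_right hB hC hd hS) with ⟨q, ⟨p, hq⟩, h₁, h₂⟩ | ⟨p, hp⟩
    exacts [Or.inl ⟨(p, q), hq, Or.inr h₁, h₂⟩, Or.inr ⟨.inr p, hp⟩]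

/-- Suppose `m` has a marked entry place. If `n` has an unmarked one, a selected place joining a
fully marked entry transition of `B` to a fully unmarked one of `C` tells the markings apart;
otherwise `n` is the start, which is also the start of `B`. If `m` has no marked entry place, it is
final, and its final marking is also that of `C`. -/
theorem choice_separated_left_right (hB : B.Static) (hC : C.Static) (hB' : B.Dynamic)
    (hC' : C.Dynamic) (hd : Disjoint B.acts C.acts) {Se : B.Ent × C.Ent → Prop}
    {Si : B.Int ⊕ C.Int → Prop} (hS : (choice B C).Good Se Si)
    {m : B.Marking} {n : C.Marking} (hm : B.states m) (hn : C.states n)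
    (he : ∀ p, Se p → ((choiceLeft B C m).e p ↔ (choiceRight B C n).e p))
    (hi : ∀ p, Si p → ((choiceLeft B C m).i p ↔ (choiceRight B C n).i p)) :
    choiceLeft B C m = choiceRight B C n := by
  by_cases h : ∃ p, m.e p
  · by_cases h' : ∃ q, ¬ n.e q
    · obtain ⟨t, ⟨p, hp⟩, ht⟩ := hB'.ent_marked m hm h
      obtain ⟨w, ⟨q, hq⟩, hw⟩ := hC'.ent_unmarked n hn h'
      obtain ⟨p', q', hS', h₁, h₂⟩ := choice_good_cross hB hC hd hS hp hq
      exact (hw q' h₂ ((he _ hS').1 (ht p' h₁))).elim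
    · push Not at h'
      obtain rfl := hC'.eq_start n hn h'
      rw [← choice_start_right, choice_start_left]
      congr 1
      exact hB'.separated _ _ (choice_good_left hB hC hd hS) _ _ hm hB'.start_mem
        (fun p ⟨q, hq⟩ => he (p, q) hq) fun p hp => hi (.inl p) hp
  · push Not at h
    obtain rfl := hB'.eq_final_of_unmarked (choice_good_left hB hC hd hS) hm (fun p _ => h p)
      fun p hp => (hi (.inl p) hp).1
    rw [← choice_final_left, choice_final_right]
    congr 1
    exact hC'.separated _ _ (choice_good_right hB hC hd hS) _ _ hC'.final_mem hn
      (fun q ⟨p, hp⟩ => he (p, q) hp) fun p hp => hi (.inr p) hp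

theorem choice_dynamic (hB : B.Static) (hC : C.Static) (hB' : B.Dynamic) (hC' : C.Dynamic)
    (hd : Disjoint B.acts C.acts) : (choice B C).Dynamic where
  start_mem := Or.inl ⟨_, hB'.start_mem, choice_start_left⟩
  final_mem := Or.inl ⟨_, hB'.final_mem, choice_final_left⟩
  eq_start := by
    obtain ⟨b⟩ := hB.ent_nonempty
    obtain ⟨c⟩ := hC.ent_nonempty
    rintro _ (⟨m, hm, rfl⟩ | ⟨m, hm, rfl⟩) h
    · rw [hB'.eq_start m hm fun p => h (p, c), choice_start_left]
    · rw [hC'.eq_start m hm fun p => h (b, p), choice_start_right]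
  eq_final := by
    obtain ⟨b⟩ := hB.ex_nonempty
    obtain ⟨c⟩ := hC.ex_nonempty
    rintro _ (⟨m, hm, rfl⟩ | ⟨m, hm, rfl⟩) h
    · rw [hB'.eq_final m hm fun p => h (p, c), choice_final_left]
    · rw [hC'.eq_final m hm fun p => h (b, p), choice_final_right]
  ent_marked := by
    obtain ⟨b⟩ := hB.ent_nonempty
    obtain ⟨c⟩ := hC.ent_nonempty
    rintro _ (⟨m, hm, rfl⟩ | ⟨m, hm, rfl⟩) ⟨p, h⟩
    · obtain ⟨t, ⟨p, hp⟩, ht⟩ := hB'.ent_marked m hm ⟨_, h⟩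
      exact ⟨t, ⟨(p, c), Or.inl hp⟩, fun q hq => ht _ (hq.resolve_right fun hq =>
        Set.disjoint_left.1 hd (hB.entOut_mem _ _ hp) (hC.entOut_mem _ _ hq))⟩
    · obtain ⟨t, ⟨p, hp⟩, ht⟩ := hC'.ent_marked m hm ⟨_, h⟩
      exact ⟨t, ⟨(b, p), Or.inr hp⟩, fun q hq => ht _ (hq.resolve_left fun hq =>
        Set.disjoint_left.1 hd (hB.entOut_mem _ _ hq) (hC.entOut_mem _ _ hp))⟩
  ent_unmarked := by
    obtain ⟨b⟩ := hB.ent_nonempty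
    obtain ⟨c⟩ := hC.ent_nonempty
    rintro _ (⟨m, hm, rfl⟩ | ⟨m, hm, rfl⟩) ⟨p, h⟩
    · obtain ⟨t, ⟨p, hp⟩, ht⟩ := hB'.ent_unmarked m hm ⟨_, h⟩
      exact ⟨t, ⟨(p, c), Or.inl hp⟩, fun q hq => ht _ (hq.resolve_right fun hq =>
        Set.disjoint_left.1 hd (hB.entOut_mem _ _ hp) (hC.entOut_mem _ _ hq))⟩
    · obtain ⟨t, ⟨p, hp⟩, ht⟩ := hC'.ent_unmarked m hm ⟨_, h⟩
      exact ⟨t, ⟨(b, p), Or.inr hp⟩, fun q hq => ht _ (hq.resolve_left fun hq =>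
        Set.disjoint_left.1 hd (hB.entOut_mem _ _ hq) (hC.entOut_mem _ _ hp))⟩
  ex_unmarked := by
    obtain ⟨b⟩ := hB.ex_nonempty
    obtain ⟨c⟩ := hC.ex_nonempty
    rintro _ (⟨m, hm, rfl⟩ | ⟨m, hm, rfl⟩) ⟨p, h⟩
    · obtain ⟨t, ⟨p, hp⟩, ht⟩ := hB'.ex_unmarked m hm ⟨_, h⟩
      exact ⟨t, ⟨(p, c), Or.inl hp⟩, fun q hq => ht _ (hq.resolve_right fun hq =>
        Set.disjoint_left.1 hd (hB.exIn_mem _ _ hp) (hC.exIn_mem _ _ hq))⟩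
    · obtain ⟨t, ⟨p, hp⟩, ht⟩ := hC'.ex_unmarked m hm ⟨_, h⟩
      exact ⟨t, ⟨(b, p), Or.inr hp⟩, fun q hq => ht _ (hq.resolve_left fun hq =>
        Set.disjoint_left.1 hd (hB.exIn_mem _ _ hq) (hC.exIn_mem _ _ hp))⟩
  fire := by
    rintro _ (⟨m, hm, rfl⟩ | ⟨m, hm, rfl⟩) t (ht | ht)
    · exact choice_fire_or_blocked_left hB hC hB' hd hm ht
    -- If all entry places are still marked, no choice has been made, and the marking is also the
    -- start of `C`.
    · by_cases he : ∀ p, m.e p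
      · rw [hB'.eq_start m hm he, ← choice_start_left, choice_start_right]
        exact choice_fire_or_blocked_right hB hC hC' hd hC'.start_mem ht
      · push Not at he
        -- All entry places of `w` have lost their tokens, so any selected place joining `w` to an
        -- entry transition `t` of `C` is an unmarked pre-place of `t`.
        obtain ⟨w, ⟨p, hp⟩, hw⟩ := hB'.ent_unmarked m hm he
        refine Or.inr fun Se Si hS => ?_
        rcases hC.exists_out t ht with ⟨q, hq⟩ | ⟨q, hq⟩
        · obtain ⟨p', q', hS', h₁, h₂⟩ := choice_good_cross hB hC hd hS hp hq
          exact Or.inl ⟨(p', q'), hS', Or.inr h₂, hw p' h₁⟩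
        · obtain ⟨r, hr, h, -⟩ := (choice_good_right hB hC hd hS).out_out q t t hq hq
          exact Or.inr ⟨.inr r, hr, h, fun h => h⟩
    · by_cases he : ∀ p, m.e p
      · rw [hC'.eq_start m hm he, ← choice_start_right, choice_start_left]
        exact choice_fire_or_blocked_left hB hC hB' hd hB'.start_mem ht
      · push Not at he
        obtain ⟨w, ⟨p, hp⟩, hw⟩ := hC'.ent_unmarked m hm he
        refine Or.inr fun Se Si hS => ?_
        rcases hB.exists_out t ht with ⟨q, hq⟩ | ⟨q, hq⟩
        · obtain ⟨p', q', hS', h₁, h₂⟩ := choice_good_cross hB hC hd hS hq hp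
          exact Or.inl ⟨(p', q'), hS', Or.inl h₁, hw q' h₂⟩
        · obtain ⟨r, hr, h, -⟩ := (choice_good_left hB hC hd hS).out_out q t t hq hq
          exact Or.inr ⟨.inl r, hr, h, fun h => h⟩
    · exact choice_fire_or_blocked_right hB hC hC' hd hm ht
  separated := by
    rintro Se Si hS _ _ (⟨m, hm, rfl⟩ | ⟨m, hm, rfl⟩) (⟨n, hn, rfl⟩ | ⟨n, hn, rfl⟩) he hi
    · rw [hB'.separated _ _ (choice_good_left hB hC hd hS) m n hm hn
        (fun p ⟨q, hq⟩ => he (p, q) hq) fun p => hi (.inl p)]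
    · exact choice_separated_left_right hB hC hB' hC' hd hS hm hn he hi
    · exact (choice_separated_left_right hB hC hB' hC' hd hS hn hm (fun p hp => (he p hp).symm)
        (fun p hp => (hi p hp).symm)).symm
    · rw [hC'.separated _ _ (choice_good_right hB hC hd hS) m n hm hn
        (fun q ⟨p, hp⟩ => he (p, q) hp) fun p => hi (.inr p)]

theorem choice_exclusive (hB : B.Exclusive) (hC : C.Exclusive) : (choice B C).Exclusive := by
  rintro _ (⟨m, hm, rfl⟩ | ⟨m, hm, rfl⟩) p q h
  · exact hB m hm _ _ h
  · exact hC m hm _ _ h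

end Choice

/-! ### Iteration -/

/-- The internal places of `⟨B * C * D⟩` at which the three components meet. -/
@[ext]
structure LoopPlace (B C D : BoxSys α) where
  exB : B.Ex
  exC : C.Ex
  entD : D.Ent
  entC : C.Ent

/-- The internal places of `⟨B * C * D⟩`. -/
abbrev IterInt (B C D : BoxSys α) : Type := B.Int ⊕ C.Int ⊕ D.Int ⊕ LoopPlace B C D

/-- The marking of `⟨B * C * D⟩` while `B` is running. -/
def iterFirst (B C D : BoxSys α) (m : B.Marking) : BoxMarking B.Ent D.Ex (IterInt B C D) where
  e := m.e
  x _ := False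
  i := Sum.elim m.i (Sum.elim (fun _ => False) (Sum.elim (fun _ => False) fun l => m.x l.exB))

/-- The marking of `⟨B * C * D⟩` while `C` is running. -/
def iterLoop (B C D : BoxSys α) (m : C.Marking) : BoxMarking B.Ent D.Ex (IterInt B C D) where
  e _ := False
  x _ := False
  i := Sum.elim (fun _ => False)
    (Sum.elim m.i (Sum.elim (fun _ => False) fun l => m.x l.exC ∨ m.e l.entC))

/-- The marking of `⟨B * C * D⟩` while `D` is running. -/
def iterLast (B C D : BoxSys α) (m : D.Marking) : BoxMarking B.Ent D.Ex (IterInt B C D) where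
  e _ := False
  x := m.x
  i := Sum.elim (fun _ => False) (Sum.elim (fun _ => False) (Sum.elim m.i fun l => m.e l.entD))

/-- Iteration: `B`, then `C` any number of times, then `D`. -/
abbrev iter (B C D : BoxSys α) : BoxSys α where
  acts := B.acts ∪ C.acts ∪ D.acts
  Ent := B.Ent
  Ex := D.Ex
  Int := IterInt B C D
  entOut := B.entOut
  exIn := D.exIn
  intIn := Sum.elim B.intIn (Sum.elim C.intIn (Sum.elim D.intIn
    fun l t => B.exIn l.exB t ∨ C.exIn l.exC t))
  intOut := Sum.elim B.intOut (Sum.elim C.intOut (Sum.elim D.intOut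
    fun l t => D.entOut l.entD t ∨ C.entOut l.entC t))
  states M := (∃ m, B.states m ∧ M = iterFirst B C D m) ∨
    (∃ m, C.states m ∧ M = iterLoop B C D m) ∨ ∃ m, D.states m ∧ M = iterLast B C D m

section Iter

variable {B C D : BoxSys α}

theorem iter_static (hB : B.Static) (hC : C.Static) (hD : D.Static)
    (hBC : Disjoint B.acts C.acts) (hBD : Disjoint B.acts D.acts)
    (hCD : Disjoint C.acts D.acts) : (iter B C D).Static where
  entOut_mem p t h := Or.inl (Or.inl (hB.entOut_mem p t h))
  exIn_mem p t h := Or.inr (hD.exIn_mem p t h)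
  intIn_mem := by
    rintro (p | p | p | p) t h
    exacts [Or.inl (Or.inl (hB.intIn_mem _ _ h)), Or.inl (Or.inr (hC.intIn_mem _ _ h)),
      Or.inr (hD.intIn_mem _ _ h), Or.inl (h.imp (hB.exIn_mem _ _) (hC.exIn_mem _ _))]
  intOut_mem := by
    rintro (p | p | p | p) t h
    exacts [Or.inl (Or.inl (hB.intOut_mem _ _ h)), Or.inl (Or.inr (hC.intOut_mem _ _ h)),
      Or.inr (hD.intOut_mem _ _ h),
      h.elim (fun h => Or.inr (hD.entOut_mem _ _ h)) fun h =>
        Or.inl (Or.inr (hC.entOut_mem _ _ h))]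
  ent_nonempty := hB.ent_nonempty
  ex_nonempty := hD.ex_nonempty
  entOut_nonempty := hB.entOut_nonempty
  exIn_nonempty := hD.exIn_nonempty
  intIn_nonempty := by
    rintro (p | p | p | p)
    exacts [hB.intIn_nonempty _, hC.intIn_nonempty _, hD.intIn_nonempty _,
      (hB.exIn_nonempty p.exB).imp fun _ => Or.inl]
  intOut_nonempty := by
    rintro (p | p | p | p)
    exacts [hB.intOut_nonempty _, hC.intOut_nonempty _, hD.intOut_nonempty _,
      (hD.entOut_nonempty p.entD).imp fun _ => Or.inl]
  exists_out := by
    obtain ⟨b⟩ := hB.ex_nonempty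
    obtain ⟨c⟩ := hC.ex_nonempty
    obtain ⟨c'⟩ := hC.ent_nonempty
    obtain ⟨d⟩ := hD.ent_nonempty
    rintro t ((ht | ht) | ht)
    · rcases hB.exists_out t ht with ⟨p, hp⟩ | ⟨p, hp⟩
      exacts [Or.inl ⟨p, hp⟩, Or.inr ⟨.inl p, hp⟩]
    · rcases hC.exists_out t ht with ⟨p, hp⟩ | ⟨p, hp⟩
      exacts [Or.inr ⟨.inr (.inr (.inr ⟨b, c, d, p⟩)), Or.inr hp⟩, Or.inr ⟨.inr (.inl p), hp⟩]
    · rcases hD.exists_out t ht with ⟨p, hp⟩ | ⟨p, hp⟩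
      exacts [Or.inr ⟨.inr (.inr (.inr ⟨b, c, p, c'⟩)), Or.inl hp⟩,
        Or.inr ⟨.inr (.inr (.inl p)), hp⟩]
  out_disjoint := by
    rintro p (q | q | q | q) t h h'
    · exact hB.out_disjoint p q t h h'
    · exact Set.disjoint_left.1 hBC (hB.entOut_mem _ _ h) (hC.intOut_mem _ _ h')
    · exact Set.disjoint_left.1 hBD (hB.entOut_mem _ _ h) (hD.intOut_mem _ _ h')
    · rcases h' with h' | h'
      · exact Set.disjoint_left.1 hBD (hB.entOut_mem _ _ h) (hD.entOut_mem _ _ h')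
      · exact Set.disjoint_left.1 hBC (hB.entOut_mem _ _ h) (hC.entOut_mem _ _ h')
  ent_inj := hB.ent_inj
  ex_inj := hD.ex_inj
  int_inj := by
    have kBC := labels_ne hBC hB.intIn_mem hC.intIn_mem hB.intIn_nonempty
    have kBD := labels_ne hBD hB.intIn_mem hD.intIn_mem hB.intIn_nonempty
    have kCD := labels_ne hCD hC.intIn_mem hD.intIn_mem hC.intIn_nonempty
    -- A loop place has an entry transition of `D` among its outputs. Such a transition is foreign
    -- to `B` and `C`, and by `out_disjoint` it is not an output of an internal place of `D`.
    have kB : ∀ (p : B.Int) (l : LoopPlace B C D),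
        ¬ ∀ t, D.entOut l.entD t ∨ C.entOut l.entC t ↔ B.intOut p t := by
      intro p l h
      obtain ⟨t, ht⟩ := hD.entOut_nonempty l.entD
      exact Set.disjoint_left.1 hBD (hB.intOut_mem _ _ ((h t).1 (Or.inl ht)))
        (hD.entOut_mem _ _ ht)
    have kC : ∀ (p : C.Int) (l : LoopPlace B C D),
        ¬ ∀ t, D.entOut l.entD t ∨ C.entOut l.entC t ↔ C.intOut p t := by
      intro p l h
      obtain ⟨t, ht⟩ := hD.entOut_nonempty l.entD
      exact Set.disjoint_left.1 hCD (hC.intOut_mem _ _ ((h t).1 (Or.inl ht)))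
        (hD.entOut_mem _ _ ht)
    have kD : ∀ (p : D.Int) (l : LoopPlace B C D),
        ¬ ∀ t, D.entOut l.entD t ∨ C.entOut l.entC t ↔ D.intOut p t := by
      intro p l h
      obtain ⟨t, ht⟩ := hD.entOut_nonempty l.entD
      exact hD.out_disjoint _ _ _ ht ((h t).1 (Or.inl ht))
    rintro (p | p | p | p) (q | q | q | q) h h'
    · rw [hB.int_inj p q h h']
    · exact (kBC p q h).elim
    · exact (kBD p q h).elim
    · exact (kB p q fun t => (h' t).symm).elim
    · exact (kBC q p fun t => (h t).symm).elim
    · rw [hC.int_inj p q h h']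
    · exact (kCD p q h).elim
    · exact (kC p q fun t => (h' t).symm).elim
    · exact (kBD q p fun t => (h t).symm).elim
    · exact (kCD q p fun t => (h t).symm).elim
    · rw [hD.int_inj p q h h']
    · exact (kD p q fun t => (h' t).symm).elim
    · exact (kB q p h').elim
    · exact (kC q p h').elim
    · exact (kD q p h').elim
    · obtain ⟨h₁, h₂⟩ := labels_or_congr hBC hB.exIn_mem hC.exIn_mem h
      obtain ⟨h₃, h₄⟩ := labels_or_congr hCD.symm hD.entOut_mem hC.entOut_mem h'
      rw [LoopPlace.ext (hB.ex_inj _ _ h₁) (hC.ex_inj _ _ h₂) (hD.ent_inj _ _ h₃)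
        (hC.ent_inj _ _ h₄)]

theorem iter_start : (.start : (iter B C D).Marking) = iterFirst B C D .start := by
  ext p
  · rfl
  · rfl
  · rcases p with p | p | p | p <;> rfl

theorem iter_final : (.final : (iter B C D).Marking) = iterLast B C D .final := by
  ext p
  · rfl
  · rfl
  · rcases p with p | p | p | p <;> rfl

/-- The marking of exactly the loop places has four readings: `B` finished, `C` at its start, `C`
finished, `D` at its start. All handovers of control, including the repetition of `C`, happen here.
-/
theorem iterFirst_final : iterFirst B C D .final = iterLast B C D .start := by
  ext p
  · rfl
  · rfl
  · rcases p with p | p | p | p <;> rfl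

theorem iterLoop_start : iterLoop B C D .start = iterLast B C D .start := by
  ext p
  · rfl
  · rfl
  · rcases p with p | p | p | p
    · rfl
    · rfl
    · rfl
    · exact or_iff_right fun h => h

theorem iterLoop_final : iterLoop B C D .final = iterLast B C D .start := by
  ext p
  · rfl
  · rfl
  · rcases p with p | p | p | p
    · rfl
    · rfl
    · rfl
    · exact or_iff_left fun h => h

/-- While `C` is running, it may be assumed not to have terminated. -/
theorem exists_iterLoop_eq (hC : C.Static) (hC' : C.Dynamic) {m : C.Marking}
    (hm : C.states m) :
    ∃ m', C.states m' ∧ iterLoop B C D m = iterLoop B C D m' ∧ ∃ p, ¬ m'.x p := by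
  by_cases h : ∀ p, m.x p
  · obtain rfl := hC'.eq_final m hm h
    exact ⟨.start, hC'.start_mem, by rw [iterLoop_final, iterLoop_start],
      hC.ex_nonempty.some, fun h => h⟩
  · push Not at h
    exact ⟨m, hm, rfl, h⟩

/-! ### Good selections restricted to the components of an iteration. -/

section Good

variable {Se : B.Ent → Prop} {Si : IterInt B C D → Prop}

theorem iter_good_first (hB : B.Static) (hC : C.Static) (hD : D.Static)
    (hBC : Disjoint B.acts C.acts) (hBD : Disjoint B.acts D.acts)
    (hS : (iter B C D).Good Se Si) : B.Good Se (fun p => Si (.inl p)) := by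
  rw [Set.disjoint_left] at hBC hBD
  refine ⟨hS.ent, fun p t w h h' => ?_, fun p t w h h' => ?_⟩
  · obtain ⟨q | q | q | q, hq, h₁, h₂⟩ := hS.out_out (.inl p) t w h h'
    · exact ⟨q, hq, h₁, h₂⟩
    · exact (hBC (hB.intOut_mem _ _ h) (hC.intOut_mem _ _ h₁)).elim
    · exact (hBD (hB.intOut_mem _ _ h) (hD.intOut_mem _ _ h₁)).elim
    · rcases h₁ with h₁ | h₁
      · exact (hBD (hB.intOut_mem _ _ h) (hD.entOut_mem _ _ h₁)).elim
      · exact (hBC (hB.intOut_mem _ _ h) (hC.entOut_mem _ _ h₁)).elim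
  · obtain ⟨q | q | q | q, hq, h₁, h₂⟩ := hS.out_in (.inl p) t w h h'
    · exact ⟨q, hq, h₁, h₂⟩
    · exact (hBC (hB.intOut_mem _ _ h) (hC.intOut_mem _ _ h₁)).elim
    · exact (hBD (hB.intOut_mem _ _ h) (hD.intOut_mem _ _ h₁)).elim
    · rcases h₁ with h₁ | h₁
      · exact (hBD (hB.intOut_mem _ _ h) (hD.entOut_mem _ _ h₁)).elim
      · exact (hBC (hB.intOut_mem _ _ h) (hC.entOut_mem _ _ h₁)).elim

/-- An output transition of a loop place is connected as such only to loop places. -/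
theorem exists_eq_loop_of_intOut (hB : B.Static) (hC : C.Static) (hD : D.Static)
    (hBC : Disjoint B.acts C.acts) (hBD : Disjoint B.acts D.acts)
    (hCD : Disjoint C.acts D.acts) {l : LoopPlace B C D} {t : α}
    (h : D.entOut l.entD t ∨ C.entOut l.entC t) {q : IterInt B C D}
    (hq : (iter B C D).intOut q t) : ∃ l', q = .inr (.inr (.inr l')) := by
  rw [Set.disjoint_left] at hBC hBD hCD
  rcases q with q | q | q | q
  · rcases h with h | h
    · exact (hBD (hB.intOut_mem _ _ hq) (hD.entOut_mem _ _ h)).elim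
    · exact (hBC (hB.intOut_mem _ _ hq) (hC.entOut_mem _ _ h)).elim
  · rcases h with h | h
    · exact (hCD (hC.intOut_mem _ _ hq) (hD.entOut_mem _ _ h)).elim
    · exact (hC.out_disjoint _ _ _ h hq).elim
  · rcases h with h | h
    · exact (hD.out_disjoint _ _ _ h hq).elim
    · exact (hCD (hC.entOut_mem _ _ h) (hD.intOut_mem _ _ hq)).elim
  · exact ⟨q, rfl⟩

/-- Here and in the next three lemmas, the alphabet containing `t` decides which coordinate of the
loop place is responsible for the arc. -/
theorem entD_of_mem (hC : C.Static) (hCD : Disjoint C.acts D.acts) {l : LoopPlace B C D}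
    {t : α} (ht : t ∈ D.acts) (h : D.entOut l.entD t ∨ C.entOut l.entC t) :
    D.entOut l.entD t :=
  h.resolve_right fun h => Set.disjoint_left.1 hCD (hC.entOut_mem _ _ h) ht

theorem entC_of_mem (hD : D.Static) (hCD : Disjoint C.acts D.acts) {l : LoopPlace B C D}
    {t : α} (ht : t ∈ C.acts) (h : D.entOut l.entD t ∨ C.entOut l.entC t) :
    C.entOut l.entC t :=
  h.resolve_left fun h => Set.disjoint_left.1 hCD ht (hD.entOut_mem _ _ h)

theorem exB_of_mem (hC : C.Static) (hBC : Disjoint B.acts C.acts) {l : LoopPlace B C D}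
    {t : α} (ht : t ∈ B.acts) (h : B.exIn l.exB t ∨ C.exIn l.exC t) : B.exIn l.exB t :=
  h.resolve_right fun h => Set.disjoint_left.1 hBC ht (hC.exIn_mem _ _ h)

theorem exC_of_mem (hB : B.Static) (hBC : Disjoint B.acts C.acts) {l : LoopPlace B C D}
    {t : α} (ht : t ∈ C.acts) (h : B.exIn l.exB t ∨ C.exIn l.exC t) : C.exIn l.exC t :=
  h.resolve_left fun h => Set.disjoint_left.1 hBC (hB.exIn_mem _ _ h) ht

/-- A covering place shares the output `t` with a loop place, so it is itself a loop place. -/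
theorem iter_good_out_out (hB : B.Static) (hC : C.Static) (hD : D.Static)
    (hBC : Disjoint B.acts C.acts) (hBD : Disjoint B.acts D.acts)
    (hCD : Disjoint C.acts D.acts) (hS : (iter B C D).Good Se Si) (l : LoopPlace B C D)
    {t w : α} (ht : D.entOut l.entD t ∨ C.entOut l.entC t)
    (hw : D.entOut l.entD w ∨ C.entOut l.entC w) :
    ∃ l', Si (.inr (.inr (.inr l'))) ∧ (D.entOut l'.entD t ∨ C.entOut l'.entC t) ∧
      (D.entOut l'.entD w ∨ C.entOut l'.entC w) := by
  obtain ⟨q, hq, h₁, h₂⟩ := hS.out_out (.inr (.inr (.inr l))) t w ht hw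
  obtain ⟨l', rfl⟩ := exists_eq_loop_of_intOut hB hC hD hBC hBD hCD ht h₁
  exact ⟨l', hq, h₁, h₂⟩

theorem iter_good_out_in (hB : B.Static) (hC : C.Static) (hD : D.Static)
    (hBC : Disjoint B.acts C.acts) (hBD : Disjoint B.acts D.acts)
    (hCD : Disjoint C.acts D.acts) (hS : (iter B C D).Good Se Si) (l : LoopPlace B C D)
    {t w : α} (ht : D.entOut l.entD t ∨ C.entOut l.entC t)
    (hw : B.exIn l.exB w ∨ C.exIn l.exC w) :
    ∃ l', Si (.inr (.inr (.inr l'))) ∧ (D.entOut l'.entD t ∨ C.entOut l'.entC t) ∧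
      (B.exIn l'.exB w ∨ C.exIn l'.exC w) := by
  obtain ⟨q, hq, h₁, h₂⟩ := hS.out_in (.inr (.inr (.inr l))) t w ht hw
  obtain ⟨l', rfl⟩ := exists_eq_loop_of_intOut hB hC hD hBC hBD hCD ht h₁
  exact ⟨l', hq, h₁, h₂⟩

/-- An entry place of `C` counts as selected if it is a coordinate of a selected loop place; when it
is lifted, the other three coordinates are arbitrary. -/
theorem iter_good_loop (hB : B.Static) (hC : C.Static) (hD : D.Static)
    (hBC : Disjoint B.acts C.acts) (hBD : Disjoint B.acts D.acts)
    (hCD : Disjoint C.acts D.acts) (hS : (iter B C D).Good Se Si) :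
    C.Good (fun q => ∃ l, Si (.inr (.inr (.inr l))) ∧ l.entC = q)
      (fun p => Si (.inr (.inl p))) := by
  obtain ⟨b⟩ := hB.ex_nonempty
  obtain ⟨c⟩ := hC.ex_nonempty
  obtain ⟨d⟩ := hD.ent_nonempty
  have hBC' := Set.disjoint_left.1 hBC
  have hCD' := Set.disjoint_left.1 hCD
  refine ⟨fun p t w h h' => ?_, fun p t w h h' => ?_, fun p t w h h' => ?_⟩
  · obtain ⟨l, hl, h₁, h₂⟩ := iter_good_out_out hB hC hD hBC hBD hCD hS ⟨b, c, d, p⟩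
      (Or.inr h) (Or.inr h')
    exact ⟨l.entC, ⟨l, hl, rfl⟩, entC_of_mem hD hCD (hC.entOut_mem _ _ h) h₁,
      entC_of_mem hD hCD (hC.entOut_mem _ _ h') h₂⟩
  · obtain ⟨q | q | q | q, hq, h₁, h₂⟩ := hS.out_out (.inr (.inl p)) t w h h'
    · exact (hBC' (hB.intOut_mem _ _ h₁) (hC.intOut_mem _ _ h)).elim
    · exact ⟨q, hq, h₁, h₂⟩
    · exact (hCD' (hC.intOut_mem _ _ h) (hD.intOut_mem _ _ h₁)).elim
    · exact (hC.out_disjoint _ _ _ (entC_of_mem hD hCD (hC.intOut_mem _ _ h) h₁) h).elim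
  · obtain ⟨q | q | q | q, hq, h₁, h₂⟩ := hS.out_in (.inr (.inl p)) t w h h'
    · exact (hBC' (hB.intOut_mem _ _ h₁) (hC.intOut_mem _ _ h)).elim
    · exact ⟨q, hq, h₁, h₂⟩
    · exact (hCD' (hC.intOut_mem _ _ h) (hD.intOut_mem _ _ h₁)).elim
    · exact (hC.out_disjoint _ _ _ (entC_of_mem hD hCD (hC.intOut_mem _ _ h) h₁) h).elim

theorem iter_good_last (hB : B.Static) (hC : C.Static) (hD : D.Static)
    (hBC : Disjoint B.acts C.acts) (hBD : Disjoint B.acts D.acts)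
    (hCD : Disjoint C.acts D.acts) (hS : (iter B C D).Good Se Si) :
    D.Good (fun q => ∃ l, Si (.inr (.inr (.inr l))) ∧ l.entD = q)
      (fun p => Si (.inr (.inr (.inl p)))) := by
  obtain ⟨b⟩ := hB.ex_nonempty
  obtain ⟨c⟩ := hC.ex_nonempty
  obtain ⟨c'⟩ := hC.ent_nonempty
  have hBD' := Set.disjoint_left.1 hBD
  have hCD' := Set.disjoint_left.1 hCD
  refine ⟨fun p t w h h' => ?_, fun p t w h h' => ?_, fun p t w h h' => ?_⟩
  · obtain ⟨l, hl, h₁, h₂⟩ := iter_good_out_out hB hC hD hBC hBD hCD hS ⟨b, c, p, c'⟩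
      (Or.inl h) (Or.inl h')
    exact ⟨l.entD, ⟨l, hl, rfl⟩, entD_of_mem hC hCD (hD.entOut_mem _ _ h) h₁,
      entD_of_mem hC hCD (hD.entOut_mem _ _ h') h₂⟩
  · obtain ⟨q | q | q | q, hq, h₁, h₂⟩ := hS.out_out (.inr (.inr (.inl p))) t w h h'
    · exact (hBD' (hB.intOut_mem _ _ h₁) (hD.intOut_mem _ _ h)).elim
    · exact (hCD' (hC.intOut_mem _ _ h₁) (hD.intOut_mem _ _ h)).elim
    · exact ⟨q, hq, h₁, h₂⟩
    · exact (hD.out_disjoint _ _ _ (entD_of_mem hC hCD (hD.intOut_mem _ _ h) h₁) h).elim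
  · obtain ⟨q | q | q | q, hq, h₁, h₂⟩ := hS.out_in (.inr (.inr (.inl p))) t w h h'
    · exact (hBD' (hB.intOut_mem _ _ h₁) (hD.intOut_mem _ _ h)).elim
    · exact (hCD' (hC.intOut_mem _ _ h₁) (hD.intOut_mem _ _ h)).elim
    · exact ⟨q, hq, h₁, h₂⟩
    · exact (hD.out_disjoint _ _ _ (entD_of_mem hC hCD (hD.intOut_mem _ _ h) h₁) h).elim

end Good

/-! ### Firing and blocking in an iteration. -/

section Fire

theorem iter_fire_first (hC : C.Static) (hD : D.Static) (hBC : Disjoint B.acts C.acts)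
    (hBD : Disjoint B.acts D.acts) {m : B.Marking} {t : α} (ht : t ∈ B.acts) :
    (iter B C D).fire (iterFirst B C D m) t = iterFirst B C D (B.fire m t) := by
  have htC := Set.disjoint_left.1 hBC ht
  have htD := Set.disjoint_left.1 hBD ht
  ext p
  · rfl
  · exact iff_of_false (fun h => h.elim (fun h => h) fun h => htD (hD.exIn_mem _ _ h))
      fun h => h
  · rcases p with p | p | p | p
    · rfl
    · exact iff_of_false (fun h => h.elim And.left fun h => htC (hC.intIn_mem _ _ h)) fun h => h
    · exact iff_of_false (fun h => h.elim And.left fun h => htD (hD.intIn_mem _ _ h)) fun h => h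
    · exact or_congr (and_iff_left fun h => h.elim (fun h => htD (hD.entOut_mem _ _ h))
        fun h => htC (hC.entOut_mem _ _ h)) (or_iff_left fun h => htC (hC.exIn_mem _ _ h))

theorem iter_fire_last (hB : B.Static) (hC : C.Static) (hBD : Disjoint B.acts D.acts)
    (hCD : Disjoint C.acts D.acts) {m : D.Marking} {t : α} (ht : t ∈ D.acts) :
    (iter B C D).fire (iterLast B C D m) t = iterLast B C D (D.fire m t) := by
  have htB := Set.disjoint_right.1 hBD ht
  have htC := Set.disjoint_right.1 hCD ht
  ext p
  · exact iff_of_false And.left fun h => h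
  · rfl
  · rcases p with p | p | p | p
    · exact iff_of_false (fun h => h.elim And.left fun h => htB (hB.intIn_mem _ _ h)) fun h => h
    · exact iff_of_false (fun h => h.elim And.left fun h => htC (hC.intIn_mem _ _ h)) fun h => h
    · rfl
    · exact (or_iff_left fun h => h.elim (fun h => htB (hB.exIn_mem _ _ h))
        fun h => htC (hC.exIn_mem _ _ h)).trans
        (and_congr_right' (not_congr (or_iff_left fun h => htC (hC.entOut_mem _ _ h))))

theorem iter_fire_loop (hB : B.Static) (hD : D.Static) (hCe : C.Exclusive)
    (hBC : Disjoint B.acts C.acts) (hCD : Disjoint C.acts D.acts) {m : C.Marking}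
    (hm : C.states m) {t : α} (ht : t ∈ C.acts) (h : C.CanFire m t) :
    (iter B C D).fire (iterLoop B C D m) t = iterLoop B C D (C.fire m t) := by
  have htB := Set.disjoint_right.1 hBC ht
  have htD := Set.disjoint_left.1 hCD ht
  ext p
  · exact iff_of_false And.left fun h => h
  · exact iff_of_false (fun h => h.elim (fun h => h) fun h => htD (hD.exIn_mem _ _ h))
      fun h => h
  · rcases p with p | p | p | p
    · exact iff_of_false (fun h => h.elim And.left fun h => htB (hB.intIn_mem _ _ h)) fun h => h
    · rfl
    · exact iff_of_false (fun h => h.elim And.left fun h => htD (hD.intIn_mem _ _ h)) fun h => h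
    · have h₁ : ¬ B.exIn p.exB t := fun h => htB (hB.exIn_mem _ _ h)
      have h₂ : ¬ D.entOut p.entD t := fun h => htD (hD.entOut_mem _ _ h)
      -- If `t` consumes the token of a loop place, that token comes from the entry coordinate; by
      -- exclusivity the exit coordinate has none that would be lost.
      have h₃ : C.entOut p.entC t → ¬ m.x p.exC := fun h' => hCe m hm _ _ (h.ent _ h')
      change ((m.x p.exC ∨ m.e p.entC) ∧ ¬ (D.entOut p.entD t ∨ C.entOut p.entC t)) ∨
        (B.exIn p.exB t ∨ C.exIn p.exC t) ↔
        (m.x p.exC ∨ C.exIn p.exC t) ∨ (m.e p.entC ∧ ¬ C.entOut p.entC t)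
      tauto

theorem iter_fire_or_blocked_first (hB : B.Static) (hC : C.Static) (hD : D.Static)
    (hB' : B.Dynamic) (hBC : Disjoint B.acts C.acts) (hBD : Disjoint B.acts D.acts)
    {m : B.Marking} (hm : B.states m) {t : α} (ht : t ∈ B.acts) :
    (iter B C D).CanFire (iterFirst B C D m) t ∨ (iter B C D).Blocked (iterFirst B C D m) t := by
  have htC := Set.disjoint_left.1 hBC ht
  have htD := Set.disjoint_left.1 hBD ht
  refine (hB'.fire m hm t ht).imp (fun h => ?_) fun h Se Si hS => ?_
  · refine ⟨h.ent, ?_, fun _ _ h => h, ?_,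
      iter_fire_first hC hD hBC hBD ht ▸ Or.inl ⟨_, h.mem, rfl⟩⟩
    · rintro (p | p | p | p) hp
      exacts [h.out p hp, (htC (hC.intOut_mem _ _ hp)).elim, (htD (hD.intOut_mem _ _ hp)).elim,
        (hp.elim (fun h => htD (hD.entOut_mem _ _ h)) fun h => htC (hC.entOut_mem _ _ h)).elim]
    · rintro (p | p | p | p) hp hm
      exacts [h.int_safe p hp hm, hm.elim, hm.elim,
        (h.ex_safe _ (exB_of_mem hC hBC ht hp) hm).elim]
  · refine (h _ _ (iter_good_first hB hC hD hBC hBD hS)).imp id ?_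
    rintro ⟨p, hp⟩
    exact ⟨.inl p, hp⟩

theorem iter_fire_or_blocked_last (hB : B.Static) (hC : C.Static) (hD : D.Static)
    (hD' : D.Dynamic) (hBC : Disjoint B.acts C.acts) (hBD : Disjoint B.acts D.acts)
    (hCD : Disjoint C.acts D.acts) {m : D.Marking} (hm : D.states m) {t : α}
    (ht : t ∈ D.acts) :
    (iter B C D).CanFire (iterLast B C D m) t ∨ (iter B C D).Blocked (iterLast B C D m) t := by
  have htB := Set.disjoint_right.1 hBD ht
  have htC := Set.disjoint_right.1 hCD ht
  refine (hD'.fire m hm t ht).imp (fun h => ?_) fun h Se Si hS => Or.inr ?_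
  · refine ⟨fun p hp => (htB (hB.entOut_mem _ _ hp)).elim, ?_, h.ex_safe, ?_,
      iter_fire_last hB hC hBD hCD ht ▸ Or.inr (Or.inr ⟨_, h.mem, rfl⟩)⟩
    · rintro (p | p | p | p) hp
      exacts [(htB (hB.intOut_mem _ _ hp)).elim, (htC (hC.intOut_mem _ _ hp)).elim, h.out p hp,
        h.ent _ (entD_of_mem hC hCD ht hp)]
    · rintro (p | p | p | p) hp hm
      exacts [hm.elim, hm.elim, h.int_safe p hp hm,
        (hp.elim (fun h => htB (hB.exIn_mem _ _ h)) fun h => htC (hC.exIn_mem _ _ h)).elim]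
  · rcases h _ _ (iter_good_last hB hC hD hBC hBD hCD hS) with
      ⟨_, ⟨l, hl, rfl⟩, h₁, h₂⟩ | ⟨p, hp⟩
    exacts [⟨.inr (.inr (.inr l)), hl, Or.inl h₁, h₂⟩, ⟨.inr (.inr (.inl p)), hp⟩]

theorem iter_fire_or_blocked_loop (hB : B.Static) (hC : C.Static) (hD : D.Static)
    (hC' : C.Dynamic) (hCe : C.Exclusive) (hBC : Disjoint B.acts C.acts)
    (hBD : Disjoint B.acts D.acts) (hCD : Disjoint C.acts D.acts) {m : C.Marking}
    (hm : C.states m) {t : α} (ht : t ∈ C.acts) :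
    (iter B C D).CanFire (iterLoop B C D m) t ∨ (iter B C D).Blocked (iterLoop B C D m) t := by
  have htB := Set.disjoint_right.1 hBC ht
  have htD := Set.disjoint_left.1 hCD ht
  -- A transition blocked in `C` at its final marking may still start the next round, so final is
  -- first replaced by start. This also provides the unmarked exit place needed for `ex_unmarked`.
  obtain ⟨m, hm, heq, hx⟩ := exists_iterLoop_eq (B := B) (D := D) hC hC' hm
  rw [heq]
  refine (hC'.fire m hm t ht).imp (fun h => ?_) fun h Se Si hS => Or.inr ?_
  · refine ⟨fun p hp => (htB (hB.entOut_mem _ _ hp)).elim, ?_, fun _ _ h => h, ?_,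
      iter_fire_loop hB hD hCe hBC hCD hm ht h ▸ Or.inr (Or.inl ⟨_, h.mem, rfl⟩)⟩
    · rintro (p | p | p | p) hp
      exacts [(htB (hB.intOut_mem _ _ hp)).elim, h.out p hp, (htD (hD.intOut_mem _ _ hp)).elim,
        Or.inr (h.ent _ (entC_of_mem hD hCD ht hp))]
    · rintro (p | p | p | p) hp hm'
      · exact hm'.elim
      · exact h.int_safe p hp hm'
      · exact hm'.elim
      · have hp' := exC_of_mem hB hBC ht hp
        -- The exit coordinate was unmarked, so the token sits on the entry coordinate. If `t` left
        -- it there, the successor would have both an entry and an exit token.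
        refine Or.inr (by_contra fun hn => ?_)
        exact hCe _ h.mem p.entC p.exC
          ⟨hm'.resolve_left (h.ex_safe _ hp'), hn⟩ (Or.inr hp')
  · rcases h _ _ (iter_good_loop hB hC hD hBC hBD hCD hS) with
      ⟨_, ⟨l, hl, rfl⟩, h₁, h₂⟩ | ⟨p, hp⟩
    -- The loop place `l` with unmarked entry coordinate may still be marked through its exit
    -- coordinate. In that case it is exchanged for `l'`, whose exit coordinate is unmarked by the
    -- choice of `w`; its entry coordinate is unmarked by exclusivity.
    · by_cases h' : ∃ p, m.x p
      · obtain ⟨p, hp⟩ := h'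
        obtain ⟨w, ⟨q, hq⟩, hw⟩ := hC'.ex_unmarked m hm hx
        obtain ⟨l', hl', h₃, h₄⟩ := iter_good_out_in hB hC hD hBC hBD hCD hS
          ⟨l.exB, q, l.entD, l.entC⟩ (Or.inr h₁) (Or.inr hq)
        refine ⟨.inr (.inr (.inr l')), hl', h₃, fun h => h.elim ?_ fun h => ?_⟩
        · exact hw _ (exC_of_mem hB hBC (hC.exIn_mem _ _ hq) h₄)
        · exact hCe m hm _ _ h hp
      · push Not at h'
        exact ⟨.inr (.inr (.inr l)), hl, Or.inr h₁, fun h => h.elim (h' _) h₂⟩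
    · exact ⟨.inr (.inl p), hp⟩

end Fire

/-! ### Separation of the markings of an iteration. -/

section Separated

variable {Se : B.Ent → Prop} {Si : IterInt B C D → Prop}

/-- The transitions of `D` are blocked while `C` has neither its entry places nor its exit places
all marked. -/
theorem iter_blocked_of_loop (hB : B.Static) (hC : C.Static) (hD : D.Static)
    (hC' : C.Dynamic) (hCe : C.Exclusive) (hBC : Disjoint B.acts C.acts)
    (hBD : Disjoint B.acts D.acts) (hCD : Disjoint C.acts D.acts) {m : C.Marking}
    (hm : C.states m) (he : ∃ p, ¬ m.e p) (hx : ∃ p, ¬ m.x p) {t : α} (ht : t ∈ D.acts) :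
    (iter B C D).Blocked (iterLoop B C D m) t := by
  refine fun Se Si hS => Or.inr ?_
  obtain ⟨b⟩ := hB.ex_nonempty
  obtain ⟨c⟩ := hC.ex_nonempty
  obtain ⟨c'⟩ := hC.ent_nonempty
  rcases hD.exists_out t ht with ⟨d, hd⟩ | ⟨q, hq⟩
  -- A loop place is unmarked if both `C` coordinates are. An exit token rules out all entry tokens,
  -- so only the exit coordinate must be controlled; without exit tokens, only the entry coordinate.
  · by_cases h' : ∃ p, m.x p
    · obtain ⟨p, hp⟩ := h'
      obtain ⟨w, ⟨q, hq⟩, hw⟩ := hC'.ex_unmarked m hm hx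
      obtain ⟨l, hl, h₁, h₂⟩ := iter_good_out_in hB hC hD hBC hBD hCD hS ⟨b, q, d, c'⟩
        (Or.inl hd) (Or.inr hq)
      refine ⟨.inr (.inr (.inr l)), hl, h₁, fun h => h.elim ?_ fun h => ?_⟩
      · exact hw _ (exC_of_mem hB hBC (hC.exIn_mem _ _ hq) h₂)
      · exact hCe m hm _ _ h hp
    · push Not at h'
      obtain ⟨w, ⟨q, hq⟩, hw⟩ := hC'.ent_unmarked m hm he
      obtain ⟨l, hl, h₁, h₂⟩ := iter_good_out_out hB hC hD hBC hBD hCD hS ⟨b, c, d, q⟩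
        (Or.inl hd) (Or.inr hq)
      exact ⟨.inr (.inr (.inr l)), hl, h₁, fun h => h.elim (h' _)
        (hw _ (entC_of_mem hD hCD (hC.entOut_mem _ _ hq) h₂))⟩
  · obtain ⟨r, hr, h, -⟩ := (iter_good_last hB hC hD hBC hBD hCD hS).out_out q t t hq hq
    exact ⟨.inr (.inr (.inl r)), hr, h, fun h => h⟩

theorem iter_separated_last_last (hB : B.Static) (hC : C.Static) (hD : D.Static)
    (hD' : D.Dynamic) (hBC : Disjoint B.acts C.acts) (hBD : Disjoint B.acts D.acts)
    (hCD : Disjoint C.acts D.acts) (hS : (iter B C D).Good Se Si) {m n : D.Marking}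
    (hm : D.states m) (hn : D.states n)
    (hi : ∀ p, Si p → ((iterLast B C D m).i p ↔ (iterLast B C D n).i p)) :
    iterLast B C D m = iterLast B C D n := by
  rw [hD'.separated _ _ (iter_good_last hB hC hD hBC hBD hCD hS) m n hm hn]
  · rintro _ ⟨l, hl, rfl⟩
    exact hi (.inr (.inr (.inr l))) hl
  · exact fun p => hi (.inr (.inr (.inl p)))

/-- Otherwise take an entry transition whose entry places are all marked in `n` and an exit
transition whose exit places are all unmarked in `m`. A selected loop place joining them is marked
in `n`; in `m` it would need an entry token beside the exit token at `p`. -/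
theorem iter_loop_not_marked (hB : B.Static) (hC : C.Static) (hD : D.Static)
    (hC' : C.Dynamic) (hCe : C.Exclusive) (hBC : Disjoint B.acts C.acts)
    (hBD : Disjoint B.acts D.acts) (hCD : Disjoint C.acts D.acts)
    (hS : (iter B C D).Good Se Si) {m n : C.Marking} (hm : C.states m) (hn : C.states n)
    (hx : ∃ p, ¬ m.x p)
    (hi : ∀ p, Si p → ((iterLoop B C D m).i p ↔ (iterLoop B C D n).i p)) {p : C.Ex}
    (hp : m.x p) (q : C.Ent) : ¬ n.e q := by
  intro hq
  obtain ⟨b⟩ := hB.ex_nonempty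
  obtain ⟨d⟩ := hD.ent_nonempty
  obtain ⟨t, ⟨c, hc⟩, ht⟩ := hC'.ent_marked n hn ⟨q, hq⟩
  obtain ⟨w, ⟨c', hc'⟩, hw⟩ := hC'.ex_unmarked m hm hx
  obtain ⟨l, hl, h₁, h₂⟩ := iter_good_out_in hB hC hD hBC hBD hCD hS ⟨b, c', d, c⟩
    (Or.inr hc) (Or.inr hc')
  rcases (hi (.inr (.inr (.inr l))) hl).2
    (Or.inr (ht _ (entC_of_mem hD hCD (hC.entOut_mem _ _ hc) h₁))) with h | h
  · exact hw _ (exC_of_mem hB hBC (hC.exIn_mem _ _ hc') h₂) h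
  · exact hCe m hm _ _ h hp

/-- After final is replaced by start, an exit token in either marking excludes entry tokens from
both. If neither has exit tokens, the loop places show the entry coordinates directly. Either way
the markings agree on the selected entry places of `C`. -/
theorem iter_separated_loop_loop (hB : B.Static) (hC : C.Static) (hD : D.Static)
    (hC' : C.Dynamic) (hCe : C.Exclusive) (hBC : Disjoint B.acts C.acts)
    (hBD : Disjoint B.acts D.acts) (hCD : Disjoint C.acts D.acts)
    (hS : (iter B C D).Good Se Si) {m n : C.Marking} (hm : C.states m) (hn : C.states n)
    (hi : ∀ p, Si p → ((iterLoop B C D m).i p ↔ (iterLoop B C D n).i p)) :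
    iterLoop B C D m = iterLoop B C D n := by
  obtain ⟨m, hm, heq, hmx⟩ := exists_iterLoop_eq (B := B) (D := D) hC hC' hm
  obtain ⟨n, hn, heq', hnx⟩ := exists_iterLoop_eq (B := B) (D := D) hC hC' hn
  rw [heq, heq'] at hi ⊢
  have key := fun p => iter_loop_not_marked hB hC hD hC' hCe hBC hBD hCD hS hm hn hmx hi (p := p)
  have key' := fun p => iter_loop_not_marked hB hC hD hC' hCe hBC hBD hCD hS hn hm hnx
    (fun p hp => (hi p hp).symm) (p := p)
  congr 1
  refine hC'.separated _ _ (iter_good_loop hB hC hD hBC hBD hCD hS) m n hm hn ?_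
    fun p => hi (.inr (.inl p))
  rintro _ ⟨l, hl, rfl⟩
  by_cases h : ∃ p, m.x p
  · obtain ⟨p, hp⟩ := h
    exact iff_of_false (fun h => hCe m hm _ _ h hp) (key p hp _)
  by_cases h' : ∃ p, n.x p
  · obtain ⟨p, hp⟩ := h'
    exact iff_of_false (key' p hp _) (fun h => hCe n hn _ _ h hp)
  push Not at h h'
  have := hi (.inr (.inr (.inr l))) hl
  exact (or_iff_right (h _)).symm.trans (this.trans (or_iff_right (h' _)))

/-- If `C` has an entry token, `D` must be at its start: otherwise a selected loop place joining
suitable entry transitions tells the markings apart. If `C` has none, it is final. Either way one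
marking moves to the other component by a handover. -/
theorem iter_separated_loop_last (hB : B.Static) (hC : C.Static) (hD : D.Static)
    (hC' : C.Dynamic) (hD' : D.Dynamic) (hCe : C.Exclusive) (hBC : Disjoint B.acts C.acts)
    (hBD : Disjoint B.acts D.acts) (hCD : Disjoint C.acts D.acts)
    (hS : (iter B C D).Good Se Si) {m : C.Marking} {n : D.Marking} (hm : C.states m)
    (hn : D.states n)
    (hi : ∀ p, Si p → ((iterLoop B C D m).i p ↔ (iterLast B C D n).i p)) :
    iterLoop B C D m = iterLast B C D n := by
  by_cases h : ∃ p, m.e p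
  · by_cases h' : ∃ p, ¬ n.e p
    · obtain ⟨t, ⟨c, hc⟩, ht⟩ := hC'.ent_marked m hm h
      obtain ⟨w, ⟨d, hd⟩, hw⟩ := hD'.ent_unmarked n hn h'
      obtain ⟨b⟩ := hB.ex_nonempty
      obtain ⟨c'⟩ := hC.ex_nonempty
      obtain ⟨l, hl, h₁, h₂⟩ := iter_good_out_out hB hC hD hBC hBD hCD hS ⟨b, c', d, c⟩
        (Or.inr hc) (Or.inl hd)
      exact (hw _ (entD_of_mem hC hCD (hD.entOut_mem _ _ hd) h₂)
        ((hi (.inr (.inr (.inr l))) hl).1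
          (Or.inr (ht _ (entC_of_mem hD hCD (hC.entOut_mem _ _ hc) h₁))))).elim
    · push Not at h'
      obtain rfl := hD'.eq_start n hn h'
      rw [← iterLoop_start (C := C)] at hi ⊢
      exact iter_separated_loop_loop hB hC hD hC' hCe hBC hBD hCD hS hm hC'.start_mem hi
  · push Not at h
    obtain rfl := hC'.eq_final_of_unmarked (iter_good_loop hB hC hD hBC hBD hCD hS) hm
      (fun p _ => h p) fun p hp => (hi (.inr (.inl p)) hp).1
    rw [iterLoop_final] at hi ⊢
    exact iter_separated_last_last hB hC hD hD' hBC hBD hCD hS hD'.start_mem hn hi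

end Separated

theorem iter_dynamic (hB : B.Static) (hC : C.Static) (hD : D.Static) (hB' : B.Dynamic)
    (hC' : C.Dynamic) (hD' : D.Dynamic) (hCe : C.Exclusive) (hBC : Disjoint B.acts C.acts)
    (hBD : Disjoint B.acts D.acts) (hCD : Disjoint C.acts D.acts) : (iter B C D).Dynamic where
  start_mem := Or.inl ⟨_, hB'.start_mem, iter_start⟩
  final_mem := Or.inr (Or.inr ⟨_, hD'.final_mem, iter_final⟩)
  eq_start := by
    rintro _ (⟨m, hm, rfl⟩ | ⟨m, hm, rfl⟩ | ⟨m, hm, rfl⟩) h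
    · rw [hB'.eq_start m hm h, iter_start]
    · exact (h hB.ent_nonempty.some).elim
    · exact (h hB.ent_nonempty.some).elim
  eq_final := by
    rintro _ (⟨m, hm, rfl⟩ | ⟨m, hm, rfl⟩ | ⟨m, hm, rfl⟩) h
    · exact (h hD.ex_nonempty.some).elim
    · exact (h hD.ex_nonempty.some).elim
    · rw [hD'.eq_final m hm h, iter_final]
  ent_marked := by
    rintro _ (⟨m, hm, rfl⟩ | ⟨m, hm, rfl⟩ | ⟨m, hm, rfl⟩) h
    · exact hB'.ent_marked m hm h
    · exact h.choose_spec.elim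
    · exact h.choose_spec.elim
  ent_unmarked := by
    rintro _ (⟨m, hm, rfl⟩ | ⟨m, hm, rfl⟩ | ⟨m, hm, rfl⟩) h
    · exact hB'.ent_unmarked m hm h
    all_goals
      obtain ⟨t, ht⟩ := hB.entOut_nonempty h.choose
      exact ⟨t, ⟨_, ht⟩, fun _ _ h => h⟩
  ex_unmarked := by
    rintro _ (⟨m, hm, rfl⟩ | ⟨m, hm, rfl⟩ | ⟨m, hm, rfl⟩) h
    on_goal 3 => exact hD'.ex_unmarked m hm h
    all_goals
      obtain ⟨t, ht⟩ := hD.exIn_nonempty h.choose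
      exact ⟨t, ⟨_, ht⟩, fun _ _ h => h⟩
  fire := by
    obtain ⟨b⟩ := hB.ex_nonempty
    obtain ⟨c⟩ := hC.ex_nonempty
    obtain ⟨c'⟩ := hC.ent_nonempty
    obtain ⟨d⟩ := hD.ent_nonempty
    have last := fun {m} hm {t} =>
      iter_fire_or_blocked_last hB hC hD hD' hBC hBD hCD (m := m) hm (t := t)
    have loop := fun {m} hm {t} =>
      iter_fire_or_blocked_loop hB hC hD hC' hCe hBC hBD hCD (m := m) hm (t := t)
    have blockedB : ∀ m : (iter B C D).Marking, (∀ p, ¬ m.e p) → (∀ p, ¬ m.i (.inl p)) →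
        ∀ t ∈ B.acts, (iter B C D).Blocked m t := by
      intro m he hi t ht Se Si hS
      rcases (iter_good_first hB hC hD hBC hBD hS).exists_out hB ht with ⟨p, hp, h⟩ | ⟨p, hp, h⟩
      exacts [Or.inl ⟨p, hp, h, he p⟩, Or.inr ⟨.inl p, hp, h, hi p⟩]
    -- The running component against the one owning `t`. Off the diagonal, either the marking is at
    -- a handover and is reread in the owner of `t`, or a selected pre-place of `t` is empty.
    rintro _ (⟨m, hm, rfl⟩ | ⟨m, hm, rfl⟩ | ⟨m, hm, rfl⟩) t ((ht | ht) | ht)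
    · exact iter_fire_or_blocked_first hB hC hD hB' hBC hBD hm ht
    · by_cases hx : ∀ p, m.x p
      · rw [hB'.eq_final m hm hx, iterFirst_final, ← iterLoop_start]
        exact loop hC'.start_mem ht
      · push Not at hx
        obtain ⟨w, ⟨p, hp⟩, hw⟩ := hB'.ex_unmarked m hm hx
        refine Or.inr fun Se Si hS => Or.inr ?_
        rcases hC.exists_out t ht with ⟨q, hq⟩ | ⟨q, hq⟩
        · obtain ⟨l, hl, h₁, h₂⟩ := iter_good_out_in hB hC hD hBC hBD hCD hS ⟨p, c, d, q⟩
            (Or.inr hq) (Or.inl hp)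
          exact ⟨.inr (.inr (.inr l)), hl, h₁,
            hw _ (exB_of_mem hC hBC (hB.exIn_mem _ _ hp) h₂)⟩
        · obtain ⟨r, hr, h, -⟩ := (iter_good_loop hB hC hD hBC hBD hCD hS).out_out q t t hq hq
          exact ⟨.inr (.inl r), hr, h, fun h => h⟩
    · by_cases hx : ∀ p, m.x p
      · rw [hB'.eq_final m hm hx, iterFirst_final]
        exact last hD'.start_mem ht
      · push Not at hx
        obtain ⟨w, ⟨p, hp⟩, hw⟩ := hB'.ex_unmarked m hm hx
        refine Or.inr fun Se Si hS => Or.inr ?_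
        rcases hD.exists_out t ht with ⟨q, hq⟩ | ⟨q, hq⟩
        · obtain ⟨l, hl, h₁, h₂⟩ := iter_good_out_in hB hC hD hBC hBD hCD hS ⟨p, c, q, c'⟩
            (Or.inl hq) (Or.inl hp)
          exact ⟨.inr (.inr (.inr l)), hl, h₁,
            hw _ (exB_of_mem hC hBC (hB.exIn_mem _ _ hp) h₂)⟩
        · obtain ⟨r, hr, h, -⟩ := (iter_good_last hB hC hD hBC hBD hCD hS).out_out q t t hq hq
          exact ⟨.inr (.inr (.inl r)), hr, h, fun h => h⟩
    · exact Or.inr (blockedB _ (fun _ h => h) (fun _ h => h) t ht)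
    · exact loop hm ht
    · obtain ⟨m, hm, heq, hx⟩ := exists_iterLoop_eq (B := B) (D := D) hC hC' hm
      rw [heq]
      by_cases he : ∀ p, m.e p
      · rw [hC'.eq_start m hm he, iterLoop_start]
        exact last hD'.start_mem ht
      · push Not at he
        exact Or.inr (iter_blocked_of_loop hB hC hD hC' hCe hBC hBD hCD hm he hx ht)
    · exact Or.inr (blockedB _ (fun _ h => h) (fun _ h => h) t ht)
    · by_cases he : ∀ p, m.e p
      · rw [hD'.eq_start m hm he, ← iterLoop_start]
        exact loop hC'.start_mem ht
      · push Not at he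
        obtain ⟨w, ⟨p, hp⟩, hw⟩ := hD'.ent_unmarked m hm he
        refine Or.inr fun Se Si hS => Or.inr ?_
        rcases hC.exists_out t ht with ⟨q, hq⟩ | ⟨q, hq⟩
        · obtain ⟨l, hl, h₁, h₂⟩ := iter_good_out_out hB hC hD hBC hBD hCD hS ⟨b, c, p, q⟩
            (Or.inr hq) (Or.inl hp)
          exact ⟨.inr (.inr (.inr l)), hl, h₁,
            hw _ (entD_of_mem hC hCD (hD.entOut_mem _ _ hp) h₂)⟩
        · obtain ⟨r, hr, h, -⟩ := (iter_good_loop hB hC hD hBC hBD hCD hS).out_out q t t hq hq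
          exact ⟨.inr (.inl r), hr, h, fun h => h⟩
    · exact last hm ht
  separated := by
    intro Se Si hS
    -- Against a marking in which `B` is empty, `B` must have finished; the marking is then reread
    -- as the start of `D`.
    have first : ∀ (m : B.Marking) (n : (iter B C D).Marking), B.states m →
        (∀ p, ¬ n.e p) → (∀ p, ¬ n.i (.inl p)) →
        (∀ p, Se p → ((iterFirst B C D m).e p ↔ n.e p)) →
        (∀ p, Si p → ((iterFirst B C D m).i p ↔ n.i p)) → m = .final :=
      fun m n hm hne hni he hi =>
        hB'.eq_final_of_unmarked (iter_good_first hB hC hD hBC hBD hS) hm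
          (fun p hp h => hne p ((he p hp).1 h)) fun p hp h => hni p ((hi (.inl p) hp).1 h)
    have last_last := fun {m n} hm hn =>
      iter_separated_last_last hB hC hD hD' hBC hBD hCD hS (m := m) (n := n) hm hn
    have loop_last := fun {m n} hm hn =>
      iter_separated_loop_last hB hC hD hC' hD' hCe hBC hBD hCD hS (m := m) (n := n) hm hn
    rintro _ _ (⟨m, hm, rfl⟩ | ⟨m, hm, rfl⟩ | ⟨m, hm, rfl⟩)
      (⟨n, hn, rfl⟩ | ⟨n, hn, rfl⟩ | ⟨n, hn, rfl⟩) he hi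
    · rw [hB'.separated _ _ (iter_good_first hB hC hD hBC hBD hS) m n hm hn he
        fun p => hi (.inl p)]
    · obtain rfl := first m _ hm (fun _ h => h) (fun _ h => h) he hi
      rw [iterFirst_final] at hi ⊢
      exact (loop_last hn hD'.start_mem fun p hp => (hi p hp).symm).symm
    · obtain rfl := first m _ hm (fun _ h => h) (fun _ h => h) he hi
      rw [iterFirst_final] at hi ⊢
      exact last_last hD'.start_mem hn hi
    · obtain rfl := first n _ hn (fun _ h => h) (fun _ h => h) (fun p hp => (he p hp).symm)
        fun p hp => (hi p hp).symm
      rw [iterFirst_final] at hi ⊢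
      exact loop_last hm hD'.start_mem hi
    · exact iter_separated_loop_loop hB hC hD hC' hCe hBC hBD hCD hS hm hn hi
    · exact loop_last hm hn hi
    · obtain rfl := first n _ hn (fun _ h => h) (fun _ h => h) (fun p hp => (he p hp).symm)
        fun p hp => (hi p hp).symm
      rw [iterFirst_final] at hi ⊢
      exact last_last hm hD'.start_mem hi
    · exact (loop_last hn hm fun p hp => (hi p hp).symm).symm
    · exact last_last hm hn hi

/-- Entry tokens occur only while `B` runs, exit tokens only while `D` runs. -/
theorem iter_exclusive : (iter B C D).Exclusive := by
  rintro _ (⟨m, -, rfl⟩ | ⟨m, -, rfl⟩ | ⟨m, -, rfl⟩) p q h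
  · exact not_false
  · exact not_false
  · exact h.elim

end Iter

end BoxSys

/-! ## The abstract box of an expression -/

/-- The place with input transitions `I` and output transitions `O`. -/
def placeOf {α : Type*} (I O : α → Prop) : Place α :=
  {v | (∃ a, v = Tagged.inp a ∧ I a) ∨ ∃ a, v = Tagged.out a ∧ O a}

section PlaceOf

variable {α : Type*}

@[simp]
theorem inp_mem_placeOf {I O : α → Prop} {a : α} : Tagged.inp a ∈ placeOf I O ↔ I a := by
  simp [placeOf]

@[simp]
theorem out_mem_placeOf {I O : α → Prop} {a : α} : Tagged.out a ∈ placeOf I O ↔ O a := by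
  simp [placeOf]

theorem placeOf_union (I O I' O' : α → Prop) :
    placeOf I O ∪ placeOf I' O' = placeOf (fun t => I t ∨ I' t) (fun t => O t ∨ O' t) := by
  ext (a | a) <;> simp

theorem placeOf_eq_iff {I O I' O' : α → Prop} :
    placeOf I O = placeOf I' O' ↔ (∀ t, I t ↔ I' t) ∧ ∀ t, O t ↔ O' t := by
  refine ⟨fun h => ⟨fun t => ?_, fun t => ?_⟩, fun h => ?_⟩
  · rw [← inp_mem_placeOf (I := I) (O := O), h, inp_mem_placeOf]
  · rw [← out_mem_placeOf (I := I) (O := O), h, out_mem_placeOf]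
  · ext (a | a)
    · simpa using h.1 a
    · simpa using h.2 a

end PlaceOf

/-! ### The concrete net of an abstract box. -/

namespace BoxSys

variable {α : Type*} (B : BoxSys α)

def entPlace (p : B.Ent) : Place α := placeOf (fun _ => False) (B.entOut p)

def exPlace (p : B.Ex) : Place α := placeOf (B.exIn p) (fun _ => False)

def intPlace (p : B.Int) : Place α := placeOf (B.intIn p) (B.intOut p)

/-- The concrete net given by an abstract box. -/
def net : PetriNet (Place α) α :=
  netOfPlaces (Set.range B.entPlace ∪ Set.range B.exPlace ∪ Set.range B.intPlace) B.acts
    (Set.range B.entPlace)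

/-- The set of concrete places marked by `m`. -/
def toSet (m : B.Marking) : Set (Place α) :=
  B.entPlace '' {p | m.e p} ∪ B.exPlace '' {p | m.x p} ∪ B.intPlace '' {p | m.i p}

variable {B}

theorem toSet_subset_places (m : B.Marking) : B.toSet m ⊆ B.net.places :=
  Set.union_subset_union (Set.union_subset_union (Set.image_subset_range _ _)
    (Set.image_subset_range _ _)) (Set.image_subset_range _ _)

theorem places_cases {motive : Place α → Prop} {Z : Place α} (hZ : Z ∈ B.net.places)
    (ent : ∀ p, motive (B.entPlace p)) (ex : ∀ p, motive (B.exPlace p))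
    (int : ∀ p, motive (B.intPlace p)) : motive Z := by
  rcases hZ with (⟨p, rfl⟩ | ⟨p, rfl⟩) | ⟨p, rfl⟩
  exacts [ent p, ex p, int p]

theorem entPlace_mem (p : B.Ent) : B.entPlace p ∈ B.net.places := Or.inl (Or.inl ⟨p, rfl⟩)

theorem intPlace_mem (p : B.Int) : B.intPlace p ∈ B.net.places := Or.inr ⟨p, rfl⟩

namespace Static

theorem entPlace_inj (hB : B.Static) {p q : B.Ent} : B.entPlace p = B.entPlace q ↔ p = q :=
  ⟨fun h => hB.ent_inj p q (placeOf_eq_iff.1 h).2, congrArg _⟩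

theorem exPlace_inj (hB : B.Static) {p q : B.Ex} : B.exPlace p = B.exPlace q ↔ p = q :=
  ⟨fun h => hB.ex_inj p q (placeOf_eq_iff.1 h).1, congrArg _⟩

theorem intPlace_inj (hB : B.Static) {p q : B.Int} : B.intPlace p = B.intPlace q ↔ p = q :=
  ⟨fun h => hB.int_inj p q (placeOf_eq_iff.1 h).1 (placeOf_eq_iff.1 h).2, congrArg _⟩

/-- The labels reveal the kind of a place: entry places have no inputs, exit places have no outputs,
internal places have both. -/
theorem entPlace_ne_exPlace (hB : B.Static) (p : B.Ent) (q : B.Ex) :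
    B.entPlace p ≠ B.exPlace q := fun h =>
  (hB.entOut_nonempty p).elim fun t ht => ((placeOf_eq_iff.1 h).2 t).1 ht

theorem entPlace_ne_intPlace (hB : B.Static) (p : B.Ent) (q : B.Int) :
    B.entPlace p ≠ B.intPlace q := fun h =>
  (hB.intIn_nonempty q).elim fun t ht => ((placeOf_eq_iff.1 h).1 t).2 ht

theorem exPlace_ne_intPlace (hB : B.Static) (p : B.Ex) (q : B.Int) :
    B.exPlace p ≠ B.intPlace q := fun h =>
  (hB.intOut_nonempty q).elim fun t ht => ((placeOf_eq_iff.1 h).2 t).2 ht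

theorem entPlace_mem_toSet (hB : B.Static) {m : B.Marking} {p : B.Ent} :
    B.entPlace p ∈ B.toSet m ↔ m.e p := by
  simp [toSet, hB.entPlace_inj, (hB.entPlace_ne_exPlace _ _).symm,
    (hB.entPlace_ne_intPlace _ _).symm]

theorem exPlace_mem_toSet (hB : B.Static) {m : B.Marking} {p : B.Ex} :
    B.exPlace p ∈ B.toSet m ↔ m.x p := by
  simp [toSet, hB.exPlace_inj, hB.entPlace_ne_exPlace, (hB.exPlace_ne_intPlace _ _).symm]

theorem intPlace_mem_toSet (hB : B.Static) {m : B.Marking} {p : B.Int} :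
    B.intPlace p ∈ B.toSet m ↔ m.i p := by
  simp [toSet, hB.intPlace_inj, hB.entPlace_ne_intPlace, hB.exPlace_ne_intPlace]

end Static

theorem toSet_start : B.toSet .start = B.net.init := by
  simp [toSet, BoxMarking.start, net, netOfPlaces]

theorem mem_pre {Z : Place α} {t : α} :
    Z ∈ B.net.pre t ↔ Z ∈ B.net.places ∧ t ∈ B.acts ∧ Tagged.out t ∈ Z := Iff.rfl

theorem mem_post {Z : Place α} {t : α} :
    Z ∈ B.net.post t ↔ t ∈ B.acts ∧ Z ∈ B.net.places ∧ Tagged.inp t ∈ Z := Iff.rfl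

theorem Static.toSet_fire (hB : B.Static) (m : B.Marking) {t : α} (ht : t ∈ B.acts) :
    B.toSet (B.fire m t) = (B.toSet m \ B.net.pre t) ∪ B.net.post t := by
  ext Z
  by_cases hZ : Z ∈ B.net.places
  · simp only [Set.mem_union, Set.mem_sdiff, mem_pre, mem_post, hZ, ht, true_and]
    refine places_cases (motive := fun Z => Z ∈ B.toSet (B.fire m t) ↔
      Z ∈ B.toSet m ∧ Tagged.out t ∉ Z ∨ Tagged.inp t ∈ Z) hZ
      (fun p => ?_) (fun p => ?_) (fun p => ?_)
    · rw [hB.entPlace_mem_toSet, hB.entPlace_mem_toSet]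
      simp [entPlace, fire]
    · rw [hB.exPlace_mem_toSet, hB.exPlace_mem_toSet]
      simp [exPlace, fire]
    · rw [hB.intPlace_mem_toSet, hB.intPlace_mem_toSet]
      simp [intPlace, fire]
  · refine iff_of_false (fun h => hZ (toSet_subset_places _ h)) ?_
    rintro (h | h)
    · exact hZ (toSet_subset_places _ h.1)
    · exact hZ h.2.1

theorem CanFire.fireable (hB : B.Static) {m : B.Marking} {t : α} (ht : t ∈ B.acts)
    (h : B.CanFire m t) : B.net.Fireable (B.toSet m) t := by
  refine ⟨ht, ?_⟩
  rintro Z ⟨hZ, -, hZt⟩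
  refine places_cases (motive := fun Z => Tagged.out t ∈ Z → Z ∈ B.toSet m) hZ
    (fun p hp => ?_) (fun p hp => ?_) (fun p hp => ?_) hZt
  · exact hB.entPlace_mem_toSet.2 (h.ent p (out_mem_placeOf.1 hp))
  · exact (out_mem_placeOf.1 hp).elim
  · exact hB.intPlace_mem_toSet.2 (h.out p (out_mem_placeOf.1 hp))

theorem CanFire.safe (hB : B.Static) {m : B.Marking} {t : α} (h : B.CanFire m t) :
    B.net.post t ∩ (B.toSet m \ B.net.pre t) = ∅ := by
  rw [Set.eq_empty_iff_forall_notMem]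
  rintro Z ⟨⟨ht, hZ, hin⟩, hm, hpre⟩
  rw [mem_pre] at hpre
  refine places_cases (motive := fun Z => Tagged.inp t ∈ Z → Z ∈ B.toSet m →
    ¬ (Z ∈ B.net.places ∧ t ∈ B.acts ∧ Tagged.out t ∈ Z) → False) hZ
    (fun p hp _ _ => ?_) (fun p hp hm _ => ?_) (fun p hp hm hpre => ?_) hin hm hpre
  · exact inp_mem_placeOf.1 hp
  · exact h.ex_safe p (inp_mem_placeOf.1 hp) (hB.exPlace_mem_toSet.1 hm)
  · exact hpre ⟨intPlace_mem p, ht, out_mem_placeOf.2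
      (h.int_safe p (inp_mem_placeOf.1 hp) (hB.intPlace_mem_toSet.1 hm))⟩

/-- Every pair of an output transition of a place and some transition of that place is
covered by a place in `S`. -/
def CoveredBy (B : BoxSys α) (S : Set (Place α)) : Prop :=
  ∀ Z ∈ B.net.places, ∀ t v, Tagged.out t ∈ Z → v ∈ Z → ∃ Z' ∈ S, Tagged.out t ∈ Z' ∧ v ∈ Z'

/-- The covering place has the same kind as the given one: exit places have no outputs, and by
`out_disjoint` no transition is an output of both an entry and an internal place. -/
theorem CoveredBy.good (hB : B.Static) {S : Set (Place α)} (hS : S ⊆ B.net.places)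
    (h : B.CoveredBy S) : B.Good (fun p => B.entPlace p ∈ S) (fun p => B.intPlace p ∈ S) := by
  refine ⟨fun p t w ht hw => ?_, fun p t w ht hw => ?_, fun p t w ht hw => ?_⟩
  · obtain ⟨Z, hZ, h₁, h₂⟩ := h _ (entPlace_mem p) t (.out w) (out_mem_placeOf.2 ht)
      (out_mem_placeOf.2 hw)
    refine places_cases (motive := fun Z => Z ∈ S → Tagged.out t ∈ Z → Tagged.out w ∈ Z → _)
      (hS hZ) (fun q hq h₁ h₂ => ?_) (fun q hq h₁ h₂ => ?_) (fun q hq h₁ h₂ => ?_) hZ h₁ h₂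
    · exact ⟨q, hq, out_mem_placeOf.1 h₁, out_mem_placeOf.1 h₂⟩
    · exact (out_mem_placeOf.1 h₁).elim
    · exact (hB.out_disjoint p q t ht (out_mem_placeOf.1 h₁)).elim
  · obtain ⟨Z, hZ, h₁, h₂⟩ := h _ (intPlace_mem p) t (.out w) (out_mem_placeOf.2 ht)
      (out_mem_placeOf.2 hw)
    refine places_cases (motive := fun Z => Z ∈ S → Tagged.out t ∈ Z → Tagged.out w ∈ Z → _)
      (hS hZ) (fun q hq h₁ h₂ => ?_) (fun q hq h₁ h₂ => ?_) (fun q hq h₁ h₂ => ?_) hZ h₁ h₂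
    · exact (hB.out_disjoint q p t (out_mem_placeOf.1 h₁) ht).elim
    · exact (out_mem_placeOf.1 h₁).elim
    · exact ⟨q, hq, out_mem_placeOf.1 h₁, out_mem_placeOf.1 h₂⟩
  · obtain ⟨Z, hZ, h₁, h₂⟩ := h _ (intPlace_mem p) t (.inp w) (out_mem_placeOf.2 ht)
      (inp_mem_placeOf.2 hw)
    refine places_cases (motive := fun Z => Z ∈ S → Tagged.out t ∈ Z → Tagged.inp w ∈ Z → _)
      (hS hZ) (fun q hq h₁ h₂ => ?_) (fun q hq h₁ h₂ => ?_) (fun q hq h₁ h₂ => ?_) hZ h₁ h₂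
    · exact (inp_mem_placeOf.1 h₂).elim
    · exact (out_mem_placeOf.1 h₁).elim
    · exact ⟨q, hq, out_mem_placeOf.1 h₁, inp_mem_placeOf.1 h₂⟩

end BoxSys

/-! ### Restricting a net to a set of places. -/

namespace PetriNet

variable {π τ : Type*}

/-- `N'` is the restriction of `N` to the places in `S`. -/
structure IsRestriction (N' N : PetriNet π τ) (S : Set π) : Prop where
  trans_eq : N'.trans = N.trans
  pre_eq : ∀ t ∈ N.trans, N'.pre t = N.pre t ∩ S
  post_eq : ∀ t ∈ N.trans, N'.post t = N.post t ∩ S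
  init_eq : N'.init = N.init ∩ S

/-- `I` is an invariant set of markings of `N`, at which `N` is safe, and the restriction of
the markings in `I` to `S` is faithful and reflects fireability. -/
structure Determines (N : PetriNet π τ) (I : Set (Set π)) (S : Set π) : Prop where
  init_mem : N.init ∈ I
  fire : ∀ M ∈ I, ∀ t ∈ N.trans, N.pre t ∩ S ⊆ M →
    N.pre t ⊆ M ∧ N.post t ∩ (M \ N.pre t) = ∅ ∧ (M \ N.pre t) ∪ N.post t ∈ I
  inj : ∀ M ∈ I, ∀ M' ∈ I, M ∩ S = M' ∩ S → M = M'

variable {N N' : PetriNet π τ} {S : Set π} {I : Set (Set π)}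

theorem IsRestriction.fireable_iff (h : N'.IsRestriction N S) (hI : N.Determines I S)
    {M : Set π} (hM : M ∈ I) {t : τ} : N'.Fireable (M ∩ S) t ↔ N.Fireable M t := by
  unfold Fireable
  rw [h.trans_eq]
  refine and_congr_right fun ht => ?_
  rw [h.pre_eq t ht]
  refine ⟨fun h' => (hI.fire M hM t ht fun p hp => (h' hp).1).1, fun h' p hp => ?_⟩
  exact ⟨h' hp.1, hp.2⟩

theorem IsRestriction.next_eq (h : N'.IsRestriction N S) (M : Set π) {t : τ}
    (ht : t ∈ N.trans) :
    ((M ∩ S) \ N'.pre t) ∪ N'.post t = ((M \ N.pre t) ∪ N.post t) ∩ S := by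
  rw [h.pre_eq t ht, h.post_eq t ht]
  ext p
  simp only [Set.mem_union, Set.mem_sdiff, Set.mem_inter_iff]
  tauto

theorem Determines.step_mem (hI : N.Determines I S) {M M' : Set π} (hM : M ∈ I) {t : τ}
    (h : N.Step M t M') : M' ∈ I := by
  obtain ⟨⟨ht, hpre⟩, rfl⟩ := h
  exact (hI.fire M hM t ht fun p hp => hpre hp.1).2.2

theorem Determines.reach_subset (hI : N.Determines I S) : N.reach ⊆ I := by
  intro M hM
  induction hM with
  | refl => exact hI.init_mem
  | tail _ h ih => exact h.elim fun t ht => hI.step_mem ih ht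

theorem IsRestriction.step_iff (h : N'.IsRestriction N S) (hI : N.Determines I S)
    {M M' : Set π} (hM : M ∈ I) (hM' : M' ∈ I) {t : τ} :
    N'.Step (M ∩ S) t (M' ∩ S) ↔ N.Step M t M' := by
  unfold Step
  rw [h.fireable_iff hI hM]
  refine and_congr_right fun hf => ?_
  rw [h.next_eq M hf.1]
  refine ⟨fun h' => hI.inj _ hM' _ ?_ h', fun h' => by rw [h']⟩
  exact hI.step_mem hM ⟨hf, rfl⟩

theorem IsRestriction.inter_mem_reach (h : N'.IsRestriction N S) (hI : N.Determines I S)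
    {M : Set π} (hM : M ∈ N.reach) : M ∩ S ∈ N'.reach := by
  induction hM with
  | refl => exact h.init_eq ▸ N'.init_mem_reach
  | tail hM' hs ih =>
    obtain ⟨t, ht⟩ := hs
    have := hI.reach_subset hM'
    exact ih.tail ⟨t, (h.step_iff hI this (hI.step_mem this ht)).2 ht⟩

/-- Runs of the restricted net lift step by step, since fireability is reflected and firing commutes
with intersection with `S`. -/
theorem IsRestriction.exists_of_mem_reach (h : N'.IsRestriction N S) (hI : N.Determines I S)
    {M : Set π} (hM : M ∈ N'.reach) : ∃ M₀ ∈ N.reach, M₀ ∩ S = M := by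
  induction hM with
  | refl => exact ⟨N.init, N.init_mem_reach, h.init_eq.symm⟩
  | tail _ hs ih =>
    obtain ⟨M₀, hM₀, rfl⟩ := ih
    obtain ⟨t, hf, rfl⟩ := hs
    rw [h.fireable_iff hI (hI.reach_subset hM₀)] at hf
    exact ⟨_, hM₀.tail ⟨t, hf, rfl⟩, (h.next_eq M₀ hf.1).symm⟩

theorem IsRestriction.safe (h : N'.IsRestriction N S) (hI : N.Determines I S) : N'.Safe := by
  intro M hM t hf
  obtain ⟨M₀, hM₀, rfl⟩ := h.exists_of_mem_reach hI hM
  have hM₀' := hI.reach_subset hM₀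
  rw [h.fireable_iff hI hM₀'] at hf
  have hs := (hI.fire M₀ hM₀' t hf.1 fun p hp => hf.2 hp.1).2.1
  rw [h.post_eq t hf.1, h.pre_eq t hf.1, Set.eq_empty_iff_forall_notMem]
  rintro p ⟨⟨h₁, h₂⟩, ⟨h₃, -⟩, h₄⟩
  exact Set.eq_empty_iff_forall_notMem.1 hs p ⟨h₁, h₃, fun h => h₄ ⟨h, h₂⟩⟩

/-- The map $M\mapsto M\cap S$ on reachable markings is injective by faithfulness and surjective by
lifting of runs; the required isomorphism is its inverse. -/
theorem IsRestriction.rgIso (h : N'.IsRestriction N S) (hI : N.Determines I S) :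
    N'.RGIso N := by
  have hb : Function.Bijective
      (fun M : N.reach => (⟨M.1 ∩ S, h.inter_mem_reach hI M.2⟩ : N'.reach)) := by
    refine ⟨fun M M' hMM' => Subtype.ext ?_, fun M => ?_⟩
    · exact hI.inj _ (hI.reach_subset M.2) _ (hI.reach_subset M'.2) (congrArg Subtype.val hMM')
    · obtain ⟨M₀, hM₀, heq⟩ := h.exists_of_mem_reach hI M.2
      exact ⟨⟨M₀, hM₀⟩, Subtype.ext heq⟩
  let f := Equiv.ofBijective _ hb
  refine ⟨f.symm, ?_, fun M M' t => ?_⟩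
  · rw [Equiv.symm_apply_eq]
    exact Subtype.ext h.init_eq
  · obtain ⟨M, rfl⟩ := f.surjective M
    obtain ⟨M', rfl⟩ := f.surjective M'
    rw [Equiv.symm_apply_apply, Equiv.symm_apply_apply]
    exact h.step_iff hI (hI.reach_subset M.2) (hI.reach_subset M'.2)

end PetriNet

/-- The dichotomy in `Dynamic.fire` is what makes fireability visible on `S`: a blocked transition
lacks a token on a pre-place in `S`. -/
theorem BoxSys.CoveredBy.determines {α : Type*} {B : BoxSys α} (hB : B.Static)
    (hB' : B.Dynamic) {S : Set (Place α)} (hS : S ⊆ B.net.places) (h : B.CoveredBy S) :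
    B.net.Determines (B.toSet '' {m | B.states m}) S where
  init_mem := ⟨.start, hB'.start_mem, toSet_start⟩
  fire := by
    rintro _ ⟨m, hm, rfl⟩ t ht hpre
    rcases hB'.fire m hm t ht with hf | hf
    · exact ⟨(hf.fireable hB ht).2, hf.safe hB, _, hf.mem, hB.toSet_fire m ht⟩
    · rcases hf _ _ (h.good hB hS) with ⟨p, hp, hpt, hpm⟩ | ⟨p, hp, hpt, hpm⟩
      · exact (hpm (hB.entPlace_mem_toSet.1
          (hpre ⟨⟨entPlace_mem p, ht, out_mem_placeOf.2 hpt⟩, hp⟩))).elim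
      · exact (hpm (hB.intPlace_mem_toSet.1
          (hpre ⟨⟨intPlace_mem p, ht, out_mem_placeOf.2 hpt⟩, hp⟩))).elim
  inj := by
    rintro _ ⟨m, hm, rfl⟩ _ ⟨m', hm', rfl⟩ heq
    have key : ∀ Z ∈ S, Z ∈ B.toSet m ↔ Z ∈ B.toSet m' := fun Z hZ => by
      have := Set.ext_iff.1 heq Z
      simpa [hZ] using this
    rw [hB'.separated _ _ (h.good hB hS) m m' hm hm' (fun p hp => ?_) fun p hp => ?_]
    · simpa only [hB.entPlace_mem_toSet] using key _ hp
    · simpa only [hB.intPlace_mem_toSet] using key _ hp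

/-! ### From expressions to abstract boxes. -/

namespace BoxExpr

variable {α : Type*}

/-- The abstract box of an expression. -/
def sys : BoxExpr α → BoxSys α
  | act a => BoxSys.single a
  | seq E F => BoxSys.seq E.sys F.sys
  | choice E F => BoxSys.choice E.sys F.sys
  | par E F => BoxSys.par E.sys F.sys
  | iter E F G => BoxSys.iter E.sys F.sys G.sys

theorem sys_acts (E : BoxExpr α) : E.sys.acts = {a | a ∈ E.actions} := by
  induction E with
  | act a => ext; simp [sys, actions]
  | seq E F hE hF => ext; simp [sys, actions, hE, hF]
  | choice E F hE hF => ext; simp [sys, actions, hE, hF]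
  | par E F hE hF => ext; simp [sys, actions, hE, hF]
  | iter E F G hE hF hG => ext; simp [sys, actions, hE, hF, hG, or_assoc]

theorem disjoint_acts {E F : BoxExpr α} (h : E.actions.Disjoint F.actions) :
    Disjoint E.sys.acts F.sys.acts := by
  rw [sys_acts, sys_acts, Set.disjoint_left]
  exact fun a => @h a

theorem sys_static {E : BoxExpr α} (h : E.actions.Nodup) : E.sys.Static := by
  induction E with
  | act a => exact BoxSys.single_static a
  | seq E F hE hF =>
    obtain ⟨h₁, h₂, h₃⟩ := List.nodup_append'.1 h
    exact BoxSys.seq_static (hE h₁) (hF h₂) (disjoint_acts h₃)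
  | choice E F hE hF =>
    obtain ⟨h₁, h₂, h₃⟩ := List.nodup_append'.1 h
    exact BoxSys.choice_static (hE h₁) (hF h₂) (disjoint_acts h₃)
  | par E F hE hF =>
    obtain ⟨h₁, h₂, h₃⟩ := List.nodup_append'.1 h
    exact BoxSys.par_static (hE h₁) (hF h₂) (disjoint_acts h₃)
  | iter E F G hE hF hG =>
    obtain ⟨h₁, h₂, h₃⟩ := List.nodup_append'.1 h
    obtain ⟨h₄, h₅, h₆⟩ := List.nodup_append'.1 h₁
    obtain ⟨h₇, h₈⟩ := List.disjoint_append_left.1 h₃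
    exact BoxSys.iter_static (hE h₄) (hF h₅) (hG h₂) (disjoint_acts h₆) (disjoint_acts h₇)
      (disjoint_acts h₈)

theorem sys_exclusive {E : BoxExpr α} {X : NonTerm} (hE : Derives X E) (hX : X = .H) :
    E.sys.Exclusive := by
  induction hE with
  | actE => cases hX
  | seqE => cases hX
  | choiceE => cases hX
  | iterE => cases hX
  | parE => cases hX
  | actH a => exact BoxSys.single_exclusive a
  | seqH => exact BoxSys.seq_exclusive
  | choiceH _ _ h h' => exact BoxSys.choice_exclusive (h rfl) (h' rfl)
  | iterH => exact BoxSys.iter_exclusive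

/-- The grammar matters only at iterations, where derivability of the body from H makes it
exclusive. -/
theorem sys_dynamic {E : BoxExpr α} {X : NonTerm} (hE : Derives X E) (h : E.actions.Nodup) :
    E.sys.Dynamic := by
  induction hE with
  | actE a | actH a => exact BoxSys.single_dynamic a
  | seqE _ _ hE hF | seqH _ _ hE hF =>
    obtain ⟨h₁, h₂, h₃⟩ := List.nodup_append'.1 h
    exact BoxSys.seq_dynamic (sys_static h₁) (sys_static h₂) (hE h₁) (hF h₂) (disjoint_acts h₃)
  | choiceE _ _ hE hF | choiceH _ _ hE hF =>
    obtain ⟨h₁, h₂, h₃⟩ := List.nodup_append'.1 h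
    exact BoxSys.choice_dynamic (sys_static h₁) (sys_static h₂) (hE h₁) (hF h₂)
      (disjoint_acts h₃)
  | parE _ _ hE hF =>
    obtain ⟨h₁, h₂, h₃⟩ := List.nodup_append'.1 h
    exact BoxSys.par_dynamic (sys_static h₁) (sys_static h₂) (hE h₁) (hF h₂) (disjoint_acts h₃)
  | iterE _ hH _ hE hF hG | iterH _ hH _ hE hF hG =>
    obtain ⟨h₁, h₂, h₃⟩ := List.nodup_append'.1 h
    obtain ⟨h₄, h₅, h₆⟩ := List.nodup_append'.1 h₁
    obtain ⟨h₇, h₈⟩ := List.disjoint_append_left.1 h₃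
    exact BoxSys.iter_dynamic (sys_static h₄) (sys_static h₅) (sys_static h₂) (hE h₄) (hF h₅)
      (hG h₂) (sys_exclusive hH rfl) (disjoint_acts h₆) (disjoint_acts h₇) (disjoint_acts h₈)

theorem crossProd_range {ι κ : Type*} (f : ι → Place α) (g : κ → Place α) :
    crossProd (Set.range f) (Set.range g) = Set.range fun p : ι × κ => f p.1 ∪ g p.2 :=
  Set.image2_range _ _ _

theorem entry_eq (E : BoxExpr α) : E.entry = Set.range E.sys.entPlace := by
  induction E with
  | act a =>
    ext Z
    have : Z = {Tagged.out a} ↔ (BoxSys.single a).entPlace () = Z := by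
      rw [eq_comm]
      refine Eq.congr_left ?_
      ext (b | b) <;> simp [BoxSys.entPlace]
    exact this.trans ⟨fun h => ⟨(), h⟩, fun ⟨_, h⟩ => h⟩
  | seq E F hE hF => exact hE
  | choice E F hE hF =>
    rw [entry, hE, hF, crossProd_range]
    refine congrArg Set.range (funext fun p => ?_)
    simp [BoxSys.entPlace, placeOf_union, sys]
  | par E F hE hF =>
    rw [entry, hE, hF, ← Set.Sum.elim_range]
    refine congrArg Set.range (funext ?_)
    rintro (p | p) <;> rfl
  | iter E F G hE hF hG => exact hE

theorem exit_eq (E : BoxExpr α) : E.exit = Set.range E.sys.exPlace := by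
  induction E with
  | act a =>
    ext Z
    have : Z = {Tagged.inp a} ↔ (BoxSys.single a).exPlace () = Z := by
      rw [eq_comm]
      refine Eq.congr_left ?_
      ext (b | b) <;> simp [BoxSys.exPlace]
    exact this.trans ⟨fun h => ⟨(), h⟩, fun ⟨_, h⟩ => h⟩
  | seq E F hE hF => exact hF
  | choice E F hE hF =>
    rw [exit, hE, hF, crossProd_range]
    refine congrArg Set.range (funext fun p => ?_)
    simp [BoxSys.exPlace, placeOf_union, sys]
  | par E F hE hF =>
    rw [exit, hE, hF, ← Set.Sum.elim_range]
    refine congrArg Set.range (funext ?_)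
    rintro (p | p) <;> rfl
  | iter E F G hE hF hG => exact hG

theorem internal_eq (E : BoxExpr α) : E.internal = Set.range E.sys.intPlace := by
  induction E with
  | act a =>
    ext Z
    simp [internal, sys]
  | seq E F hE hF =>
    rw [internal, hE, hF, exit_eq, entry_eq, crossProd_range, Set.union_assoc,
      ← Set.Sum.elim_range, ← Set.Sum.elim_range]
    refine congrArg Set.range (funext ?_)
    rintro (p | p | p)
    · rfl
    · rfl
    · simp [BoxSys.exPlace, BoxSys.entPlace, BoxSys.intPlace, placeOf_union, sys]
  | choice E F hE hF | par E F hE hF =>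
    rw [internal, hE, hF, ← Set.Sum.elim_range]
    refine congrArg Set.range (funext ?_)
    rintro (p | p) <;> rfl
  | iter E F G hE hF hG =>
    have key : ∀ l : BoxSys.LoopPlace E.sys F.sys G.sys,
        (E.sys.exPlace l.exB ∪ F.sys.exPlace l.exC) ∪
          (G.sys.entPlace l.entD ∪ F.sys.entPlace l.entC) =
        (BoxSys.iter E.sys F.sys G.sys).intPlace (.inr (.inr (.inr l))) := by
      intro l
      simp [BoxSys.exPlace, BoxSys.entPlace, BoxSys.intPlace, placeOf_union]
    rw [internal, hE, hF, hG, exit_eq, exit_eq, entry_eq, entry_eq, crossProd_range,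
      crossProd_range, crossProd_range]
    ext Z
    constructor
    · rintro (((⟨p, rfl⟩ | ⟨p, rfl⟩) | ⟨p, rfl⟩) | ⟨p, rfl⟩)
      · exact ⟨.inl p, rfl⟩
      · exact ⟨.inr (.inl p), rfl⟩
      · exact ⟨.inr (.inr (.inl p)), rfl⟩
      · exact ⟨.inr (.inr (.inr ⟨p.1.1, p.1.2, p.2.1, p.2.2⟩)), (key _).symm⟩
    · rintro ⟨p | p | p | l, rfl⟩
      · exact Or.inl (Or.inl (Or.inl ⟨p, rfl⟩))
      · exact Or.inl (Or.inl (Or.inr ⟨p, rfl⟩))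
      · exact Or.inl (Or.inr ⟨p, rfl⟩)
      · exact Or.inr ⟨((l.exB, l.exC), (l.entD, l.entC)), key l⟩

theorem box_eq_net (E : BoxExpr α) : E.box = E.sys.net := by
  rw [box, BoxSys.net, entry_eq, exit_eq, internal_eq, sys_acts]

end BoxExpr

/-! ## Places as maximal cliques -/

namespace Tagged

variable {α : Type*}

/-- The action of a tagged action. -/
def act : Tagged α → α
  | inp a => a
  | out a => a

/-- The tag is `out`. -/
def IsOut : Tagged α → Prop
  | inp _ => False
  | out _ => True

end Tagged

namespace ConnGraph

variable {α : Type*}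

/-- The members of `Q` are cliques of `G`, and every clique is contained in one of them. -/
structure Represents (Q : Set (Place α)) (G : ConnGraph α) : Prop where
  isClique : ∀ Z ∈ Q, G.IsClique Z
  extend : ∀ K, G.IsClique K → ∃ Z ∈ Q, K ⊆ Z

/-- A maximal clique is contained in a member of `Q`, which is a clique and hence equal to it.
Maximality of the members of `Q` is not needed. -/
theorem Represents.mem_of_mem_maxCliques {Q : Set (Place α)} {G : ConnGraph α}
    (h : Represents Q G) {K : Set (Tagged α)} (hK : K ∈ G.maxCliques) : K ∈ Q := by
  obtain ⟨Z, hZ, hKZ⟩ := h.extend K hK.prop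
  rwa [hK.eq_of_subset (h.isClique Z hZ) hKZ]

theorem represents_single (v : Tagged α) : Represents {{v}} (single v) := by
  refine ⟨?_, fun K hK => ⟨{v}, rfl, hK.2.1⟩⟩
  rintro _ rfl
  exact ⟨Set.singleton_nonempty v, le_rfl, Set.pairwise_singleton _ _⟩

theorem represents_bot : Represents ∅ (⊥ : ConnGraph α) := by
  refine ⟨fun Z hZ => hZ.elim, fun K hK => ?_⟩
  obtain ⟨v, hv⟩ := hK.1
  exact (hK.2.1 hv).elim

theorem IsClique.mono {G G' : ConnGraph α} (h : G ≤ G') {K : Set (Tagged α)}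
    (hK : G.IsClique K) : G'.IsClique K :=
  ⟨hK.1, hK.2.1.trans h.1, hK.2.2.imp fun _ _ => fun h' => h.2 h'⟩

/-- No edge connects the two parts of a disjoint union, so a clique lies in the part of any one of
its vertices. -/
theorem isClique_of_isClique_sup {G G' : ConnGraph α} (hd : Disjoint G.verts G'.verts)
    {K : Set (Tagged α)} (hK : (G ⊔ G').IsClique K) {v : Tagged α} (hv : v ∈ K)
    (hvG : v ∈ G.verts) : G.IsClique K := by
  rw [Set.disjoint_left] at hd
  have key : ∀ w ∈ K, w ∈ G.verts := by
    intro w hw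
    by_cases hvw : v = w
    · exact hvw ▸ hvG
    · rcases hK.2.2 hv hw hvw with h | h
      · exact G.edge_vert h.symm
      · exact (hd hvG (G'.edge_vert h)).elim
  refine ⟨hK.1, key, fun u hu w hw huw => ?_⟩
  rcases hK.2.2 hu hw huw with h | h
  · exact h
  · exact (hd (key u hu) (G'.edge_vert h)).elim

theorem Represents.sup {Q Q' : Set (Place α)} {G G' : ConnGraph α} (h : Represents Q G)
    (h' : Represents Q' G') (hd : Disjoint G.verts G'.verts) :
    Represents (Q ∪ Q') (G ⊔ G') := by
  refine ⟨?_, fun K hK => ?_⟩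
  · rintro Z (hZ | hZ)
    · exact (h.isClique Z hZ).mono le_sup_left
    · exact (h'.isClique Z hZ).mono le_sup_right
  · obtain ⟨v, hv⟩ := hK.1
    rcases hK.2.1 hv with hvG | hvG
    · obtain ⟨Z, hZ, hKZ⟩ := h.extend K (isClique_of_isClique_sup hd hK hv hvG)
      exact ⟨Z, Or.inl hZ, hKZ⟩
    · rw [sup_comm] at hK
      obtain ⟨Z, hZ, hKZ⟩ := h'.extend K (isClique_of_isClique_sup hd.symm hK hv hvG)
      exact ⟨Z, Or.inr hZ, hKZ⟩

/-- A clique of a join may miss one side entirely, and then its trace there is not a clique; any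
member of the nonempty `Q` serves instead. -/
theorem Represents.exists_inter_subset {Q : Set (Place α)} {G : ConnGraph α}
    (h : Represents Q G) (hQ : Q.Nonempty) {K : Set (Tagged α)}
    (hK : K.Pairwise fun v w => v ∈ G.verts → w ∈ G.verts → G.Adj v w) :
    ∃ Z ∈ Q, K ∩ G.verts ⊆ Z := by
  rcases (K ∩ G.verts).eq_empty_or_nonempty with he | hne
  · obtain ⟨Z, hZ⟩ := hQ
    exact ⟨Z, hZ, he ▸ Set.empty_subset Z⟩
  · exact h.extend _ ⟨hne, Set.inter_subset_right,
      fun v hv w hw hvw => hK hv.1 hw.1 hvw hv.2 hw.2⟩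

theorem Represents.join {Q Q' : Set (Place α)} {G G' : ConnGraph α} (h : Represents Q G)
    (h' : Represents Q' G') (hQ : Q.Nonempty) (hQ' : Q'.Nonempty)
    (hd : Disjoint G.verts G'.verts) : Represents (crossProd Q Q') (ConnGraph.join G G') := by
  rw [Set.disjoint_left] at hd
  refine ⟨?_, fun K hK => ?_⟩
  · rintro _ ⟨Z, hZ, Z', hZ', rfl⟩
    have hc := h.isClique Z hZ
    have hc' := h'.isClique Z' hZ'
    refine ⟨hc.1.inl, Set.union_subset_union hc.2.1 hc'.2.1, ?_⟩
    rintro v (hv | hv) w (hw | hw) hvw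
    · exact Or.inl (hc.2.2 hv hw hvw)
    · exact Or.inr (Or.inr ⟨hvw, Or.inl ⟨hc.2.1 hv, hc'.2.1 hw⟩⟩)
    · exact Or.inr (Or.inr ⟨hvw, Or.inr ⟨hc'.2.1 hv, hc.2.1 hw⟩⟩)
    · exact Or.inr (Or.inl (hc'.2.2 hv hw hvw))
  · obtain ⟨Z, hZ, hKZ⟩ := h.exists_inter_subset hQ (K := K) fun v hv w hw hvw hvG hwG => by
      rcases hK.2.2 hv hw hvw with h | h | ⟨-, h | h⟩
      · exact h
      · exact (hd hvG (G'.edge_vert h)).elim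
      · exact (hd hwG h.2).elim
      · exact (hd hvG h.1).elim
    obtain ⟨Z', hZ', hKZ'⟩ := h'.exists_inter_subset hQ' (K := K) fun v hv w hw hvw hvG hwG => by
      rcases hK.2.2 hv hw hvw with h | h | ⟨-, h | h⟩
      · exact (hd (G.edge_vert h) hvG).elim
      · exact h
      · exact (hd h.1 hvG).elim
      · exact (hd h.2 hwG).elim
    refine ⟨Z ∪ Z', ⟨Z, hZ, Z', hZ', rfl⟩, fun v hv => ?_⟩
    exact (hK.2.1 hv).imp (fun hvG => hKZ ⟨hv, hvG⟩) fun hvG => hKZ' ⟨hv, hvG⟩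

end ConnGraph

theorem crossProd_comm {α : Type*} (Q R : Set (Place α)) : crossProd Q R = crossProd R Q := by
  rw [crossProd, crossProd, Set.image2_swap]
  simp only [Set.union_comm]

theorem crossProd_nonempty {α : Type*} {Q R : Set (Place α)} (hQ : Q.Nonempty)
    (hR : R.Nonempty) : (crossProd Q R).Nonempty :=
  hQ.image2 hR

/-! ### Disjointness of the parts of the connection graph, and its representation by places. -/

namespace BoxExpr

variable {α : Type*}

theorem entryGraph_verts (E : BoxExpr α) :
    ∀ v ∈ E.entryGraph.verts, v.IsOut ∧ v.act ∈ E.actions := by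
  induction E with
  | act a =>
    rintro _ rfl
    exact ⟨trivial, List.mem_singleton_self a⟩
  | seq E F hE hF => exact fun v hv => ⟨(hE v hv).1, List.mem_append_left _ (hE v hv).2⟩
  | choice E F hE hF | par E F hE hF =>
    rintro v (hv | hv)
    · exact ⟨(hE v hv).1, List.mem_append_left _ (hE v hv).2⟩
    · exact ⟨(hF v hv).1, List.mem_append_right _ (hF v hv).2⟩
  | iter E F G hE hF hG =>
    exact fun v hv => ⟨(hE v hv).1, List.mem_append_left _ (List.mem_append_left _ (hE v hv).2)⟩

theorem exitGraph_verts (E : BoxExpr α) :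
    ∀ v ∈ E.exitGraph.verts, ¬ v.IsOut ∧ v.act ∈ E.actions := by
  induction E with
  | act a =>
    rintro _ rfl
    exact ⟨not_false, List.mem_singleton_self a⟩
  | seq E F hE hF => exact fun v hv => ⟨(hF v hv).1, List.mem_append_right _ (hF v hv).2⟩
  | choice E F hE hF | par E F hE hF =>
    rintro v (hv | hv)
    · exact ⟨(hE v hv).1, List.mem_append_left _ (hE v hv).2⟩
    · exact ⟨(hF v hv).1, List.mem_append_right _ (hF v hv).2⟩
  | iter E F G hE hF hG => exact fun v hv => ⟨(hG v hv).1, List.mem_append_right _ (hG v hv).2⟩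

theorem mem_seq_internalGraph {E F : BoxExpr α} {v : Tagged α} :
    v ∈ (seq E F).internalGraph.verts ↔ v ∈ E.internalGraph.verts ∨ v ∈ F.internalGraph.verts ∨
      v ∈ E.exitGraph.verts ∨ v ∈ F.entryGraph.verts := by
  simp [internalGraph, ConnGraph.join, or_assoc]

theorem mem_iter_internalGraph {E F G : BoxExpr α} {v : Tagged α} :
    v ∈ (iter E F G).internalGraph.verts ↔ v ∈ E.internalGraph.verts ∨
      v ∈ F.internalGraph.verts ∨ v ∈ G.internalGraph.verts ∨ v ∈ E.exitGraph.verts ∨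
      v ∈ F.exitGraph.verts ∨ v ∈ F.entryGraph.verts ∨ v ∈ G.entryGraph.verts := by
  simp [internalGraph, ConnGraph.join, or_assoc]

theorem internalGraph_verts (E : BoxExpr α) :
    ∀ v ∈ E.internalGraph.verts, v.act ∈ E.actions := by
  induction E with
  | act a => exact fun v hv => hv.elim
  | seq E F hE hF =>
    intro v hv
    have h₁ := E.exitGraph_verts v
    have h₂ := F.entryGraph_verts v
    have h₃ := hE v
    have h₄ := hF v
    rw [mem_seq_internalGraph] at hv
    simp only [actions, List.mem_append]
    tauto
  | choice E F hE hF | par E F hE hF =>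
    rintro v (hv | hv)
    · exact List.mem_append_left _ (hE v hv)
    · exact List.mem_append_right _ (hF v hv)
  | iter E F G hE hF hG =>
    intro v hv
    have h₁ := E.exitGraph_verts v
    have h₂ := F.entryGraph_verts v
    have h₃ := hE v
    have h₄ := hF v
    have h₅ := hG v
    have h₆ := F.exitGraph_verts v
    have h₇ := G.entryGraph_verts v
    rw [mem_iter_internalGraph] at hv
    simp only [actions, List.mem_append]
    clear hE hF hG
    grind

/-- The vertices newly made internal are exit vertices of one component or entry vertices of
another. They differ from the remaining entry and exit vertices by their tag within one component,
and by their action across components. -/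
theorem notMem_internalGraph {E : BoxExpr α} (h : E.actions.Nodup) (v : Tagged α)
    (hv : v ∈ E.entryGraph.verts ∨ v ∈ E.exitGraph.verts) : v ∉ E.internalGraph.verts := by
  induction E with
  | act a => exact not_false
  | seq E F hE hF =>
    obtain ⟨h₁, h₂, h₃⟩ := List.nodup_append'.1 h
    have h₃ := @h₃ v.act
    have h₄ := hE h₁
    have h₅ := hF h₂
    have h₆ := E.exitGraph_verts v
    have h₇ := F.entryGraph_verts v
    have h₈ := F.exitGraph_verts v
    have h₉ := E.entryGraph_verts v
    have h₁₀ := E.internalGraph_verts v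
    have h₁₁ := F.internalGraph_verts v
    rw [mem_seq_internalGraph]
    simp only [entryGraph, exitGraph] at hv
    clear hE hF
    grind
  | choice E F hE hF | par E F hE hF =>
    obtain ⟨h₁, h₂, h₃⟩ := List.nodup_append'.1 h
    have h₃ := @h₃ v.act
    have h₄ := hE h₁
    have h₅ := hF h₂
    have h₆ := E.exitGraph_verts v
    have h₇ := F.entryGraph_verts v
    have h₈ := F.exitGraph_verts v
    have h₉ := E.entryGraph_verts v
    have h₁₀ := E.internalGraph_verts v
    have h₁₁ := F.internalGraph_verts v
    simp only [entryGraph, exitGraph, internalGraph, ConnGraph.join,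
      SimpleGraph.Subgraph.verts_sup, Set.mem_union] at hv ⊢
    clear hE hF
    grind
  | iter E F G hE hF hG =>
    obtain ⟨h₁, h₂, h₃⟩ := List.nodup_append'.1 h
    obtain ⟨h₁, h₁', h₄⟩ := List.nodup_append'.1 h₁
    obtain ⟨h₅, h₆⟩ := List.disjoint_append_left.1 h₃
    have h₄ := @h₄ v.act
    have h₅ := @h₅ v.act
    have h₆ := @h₆ v.act
    have h₇ := hE h₁
    have h₈ := hG h₂
    have h₉ := E.exitGraph_verts v
    have h₁₀ := F.entryGraph_verts v
    have h₁₁ := F.exitGraph_verts v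
    have h₁₂ := E.entryGraph_verts v
    have h₁₃ := E.internalGraph_verts v
    have h₁₄ := F.internalGraph_verts v
    have h₁₅ := G.internalGraph_verts v
    have h₁₆ := G.entryGraph_verts v
    have h₁₇ := G.exitGraph_verts v
    rw [mem_iter_internalGraph]
    simp only [entryGraph, exitGraph] at hv
    clear hE hF hG
    grind

theorem disjoint_of_actions {E F : BoxExpr α} (h : E.actions.Disjoint F.actions)
    {X Y : Set (Tagged α)} (hX : ∀ v ∈ X, v.act ∈ E.actions) (hY : ∀ v ∈ Y, v.act ∈ F.actions) :
    Disjoint X Y :=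
  Set.disjoint_left.2 fun v hv hv' => h (hX v hv) (hY v hv')

theorem entry_nonempty (E : BoxExpr α) : E.entry.Nonempty := by
  induction E with
  | act a => exact Set.singleton_nonempty _
  | seq E F hE hF => exact hE
  | choice E F hE hF => exact crossProd_nonempty hE hF
  | par E F hE hF => exact hE.inl
  | iter E F G hE hF hG => exact hE

theorem exit_nonempty (E : BoxExpr α) : E.exit.Nonempty := by
  induction E with
  | act a => exact Set.singleton_nonempty _
  | seq E F hE hF => exact hF
  | choice E F hE hF => exact crossProd_nonempty hE hF
  | par E F hE hF => exact hE.inl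
  | iter E F G hE hF hG => exact hG

theorem represents_entry {E : BoxExpr α} (h : E.actions.Nodup) :
    ConnGraph.Represents E.entry E.entryGraph := by
  induction E with
  | act a => exact ConnGraph.represents_single _
  | seq E F hE hF => exact hE (List.nodup_append'.1 h).1
  | choice E F hE hF =>
    obtain ⟨h₁, h₂, h₃⟩ := List.nodup_append'.1 h
    exact (hE h₁).join (hF h₂) E.entry_nonempty F.entry_nonempty
      (disjoint_of_actions h₃ (fun v hv => (E.entryGraph_verts v hv).2)
        fun v hv => (F.entryGraph_verts v hv).2)
  | par E F hE hF =>
    obtain ⟨h₁, h₂, h₃⟩ := List.nodup_append'.1 h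
    exact (hE h₁).sup (hF h₂)
      (disjoint_of_actions h₃ (fun v hv => (E.entryGraph_verts v hv).2)
        fun v hv => (F.entryGraph_verts v hv).2)
  | iter E F G hE hF hG => exact hE (List.nodup_append'.1 (List.nodup_append'.1 h).1).1

theorem represents_exit {E : BoxExpr α} (h : E.actions.Nodup) :
    ConnGraph.Represents E.exit E.exitGraph := by
  induction E with
  | act a => exact ConnGraph.represents_single _
  | seq E F hE hF => exact hF (List.nodup_append'.1 h).2.1
  | choice E F hE hF =>
    obtain ⟨h₁, h₂, h₃⟩ := List.nodup_append'.1 h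
    exact (hE h₁).join (hF h₂) E.exit_nonempty F.exit_nonempty
      (disjoint_of_actions h₃ (fun v hv => (E.exitGraph_verts v hv).2)
        fun v hv => (F.exitGraph_verts v hv).2)
  | par E F hE hF =>
    obtain ⟨h₁, h₂, h₃⟩ := List.nodup_append'.1 h
    exact (hE h₁).sup (hF h₂)
      (disjoint_of_actions h₃ (fun v hv => (E.exitGraph_verts v hv).2)
        fun v hv => (F.exitGraph_verts v hv).2)
  | iter E F G hE hF hG => exact hG (List.nodup_append'.1 h).2.1

theorem represents_internal {E : BoxExpr α} (h : E.actions.Nodup) :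
    ConnGraph.Represents E.internal E.internalGraph := by
  induction E with
  | act a => exact ConnGraph.represents_bot
  | choice E F hE hF | par E F hE hF =>
    obtain ⟨h₁, h₂, h₃⟩ := List.nodup_append'.1 h
    exact (hE h₁).sup (hF h₂)
      (disjoint_of_actions h₃ E.internalGraph_verts F.internalGraph_verts)
  | seq E F hE hF =>
    obtain ⟨h₁, h₂, h₃⟩ := List.nodup_append'.1 h
    refine ((hE h₁).sup (hF h₂)
      (disjoint_of_actions h₃ E.internalGraph_verts F.internalGraph_verts)).sup
      ((represents_exit h₁).join (represents_entry h₂) E.exit_nonempty F.entry_nonempty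
        (disjoint_of_actions h₃ (fun v hv => (E.exitGraph_verts v hv).2)
          fun v hv => (F.entryGraph_verts v hv).2)) ?_
    rw [Set.disjoint_left]
    rintro v (hv | hv) (hv' | hv')
    · exact notMem_internalGraph h₁ v (Or.inr hv') hv
    · exact h₃ (E.internalGraph_verts v hv) (F.entryGraph_verts v hv').2
    · exact h₃ (E.exitGraph_verts v hv').2 (F.internalGraph_verts v hv)
    · exact notMem_internalGraph h₂ v (Or.inl hv') hv
  | iter E F G hE hF hG =>
    obtain ⟨h₁, h₂, h₃⟩ := List.nodup_append'.1 h
    obtain ⟨h₁, h₄, h₅⟩ := List.nodup_append'.1 h₁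
    obtain ⟨h₆, h₇⟩ := List.disjoint_append_left.1 h₃
    have hEF : ConnGraph.Represents (crossProd E.exit F.exit) _ :=
      (represents_exit h₁).join (represents_exit h₄) E.exit_nonempty F.exit_nonempty
        (disjoint_of_actions h₅ (fun v hv => (E.exitGraph_verts v hv).2)
          fun v hv => (F.exitGraph_verts v hv).2)
    have hFG : ConnGraph.Represents (crossProd F.entry G.entry) _ :=
      (represents_entry h₄).join (represents_entry h₂) F.entry_nonempty G.entry_nonempty
        (disjoint_of_actions h₇ (fun v hv => (F.entryGraph_verts v hv).2)
          fun v hv => (G.entryGraph_verts v hv).2)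
    -- The places and the graphs combine the entry parts of `F` and `G` in opposite orders.
    rw [internal, crossProd_comm G.entry]
    refine (((hE h₁).sup (hF h₄)
      (disjoint_of_actions h₅ E.internalGraph_verts F.internalGraph_verts)).sup (hG h₂) ?_).sup
      (hEF.join hFG (crossProd_nonempty E.exit_nonempty F.exit_nonempty)
        (crossProd_nonempty F.entry_nonempty G.entry_nonempty) ?_) ?_
    · rw [Set.disjoint_left]
      rintro v (hv | hv) hv'
      · exact h₆ (E.internalGraph_verts v hv) (G.internalGraph_verts v hv')
      · exact h₇ (F.internalGraph_verts v hv) (G.internalGraph_verts v hv')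
    · rw [Set.disjoint_left]
      have hx : ∀ v ∈ (ConnGraph.join E.exitGraph F.exitGraph).verts, ¬ v.IsOut := by
        rintro v (hv | hv)
        exacts [(E.exitGraph_verts v hv).1, (F.exitGraph_verts v hv).1]
      rintro v hv (hv' | hv')
      · exact hx v hv (F.entryGraph_verts v hv').1
      · exact hx v hv (G.entryGraph_verts v hv').1
    · rw [Set.disjoint_left]
      rintro v ((hv | hv) | hv) ((hv' | hv') | (hv' | hv'))
      · exact notMem_internalGraph h₁ v (Or.inr hv') hv
      · exact h₅ (E.internalGraph_verts v hv) (F.exitGraph_verts v hv').2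
      · exact h₅ (E.internalGraph_verts v hv) (F.entryGraph_verts v hv').2
      · exact h₆ (E.internalGraph_verts v hv) (G.entryGraph_verts v hv').2
      · exact h₅ (E.exitGraph_verts v hv').2 (F.internalGraph_verts v hv)
      · exact notMem_internalGraph h₄ v (Or.inr hv') hv
      · exact notMem_internalGraph h₄ v (Or.inl hv') hv
      · exact h₇ (F.internalGraph_verts v hv) (G.entryGraph_verts v hv').2
      · exact h₆ (E.exitGraph_verts v hv').2 (G.internalGraph_verts v hv)
      · exact h₇ (F.exitGraph_verts v hv').2 (G.internalGraph_verts v hv)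
      · exact h₇ (F.entryGraph_verts v hv').2 (G.internalGraph_verts v hv)
      · exact notMem_internalGraph h₂ v (Or.inl hv') hv

/-- The places of `BOX(E)` represent the cliques of the connection graph. -/
theorem represents_places {E : BoxExpr α} (h : E.actions.Nodup) :
    ConnGraph.Represents E.box.places E.connGraph := by
  refine ((represents_entry h).sup (represents_exit h) ?_).sup (represents_internal h) ?_
  · exact Set.disjoint_left.2 fun v hv hv' =>
      (E.exitGraph_verts v hv').1 (E.entryGraph_verts v hv).1
  · exact Set.disjoint_left.2 fun v hv hv' => notMem_internalGraph h v hv hv'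

theorem entry_finite (E : BoxExpr α) : E.entry.Finite := by
  induction E with
  | act a => exact Set.finite_singleton _
  | seq E F hE hF => exact hE
  | choice E F hE hF => exact hE.image2 _ hF
  | par E F hE hF => exact hE.union hF
  | iter E F G hE hF hG => exact hE

theorem exit_finite (E : BoxExpr α) : E.exit.Finite := by
  induction E with
  | act a => exact Set.finite_singleton _
  | seq E F hE hF => exact hF
  | choice E F hE hF => exact hE.image2 _ hF
  | par E F hE hF => exact hE.union hF
  | iter E F G hE hF hG => exact hG

theorem internal_finite (E : BoxExpr α) : E.internal.Finite := by
  induction E with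
  | act a => exact Set.finite_empty
  | seq E F hE hF => exact (hE.union hF).union (E.exit_finite.image2 _ F.entry_finite)
  | choice E F hE hF | par E F hE hF => exact hE.union hF
  | iter E F G hE hF hG =>
    exact ((hE.union hF).union hG).union ((E.exit_finite.image2 _ F.exit_finite).image2 _
      (G.entry_finite.image2 _ F.entry_finite))

theorem box_places_finite (E : BoxExpr α) : E.box.places.Finite :=
  (E.entry_finite.union E.exit_finite).union E.internal_finite

end BoxExpr

/-! ## The nets of edge clique covers -/

section Cover

variable {α : Type*} {E : BoxExpr α} {C : Set (Set (Tagged α))}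

theorem subset_places_of_cover (h : E.actions.Nodup)
    (hC : E.connGraph.IsPartialEdgeCliqueCover ConnGraph.InIn C) : C ⊆ E.sys.net.places := by
  rw [← E.box_eq_net]
  exact fun Z hZ => (E.represents_places h).mem_of_mem_maxCliques (hC.subset_maxCliques hZ)

/-- Two tags in a place are equal or adjacent, and an edge at a vertex $t^{out}$ is never exempt
from covering. -/
theorem coveredBy_of_cover (h : E.actions.Nodup)
    (hC : E.connGraph.IsPartialEdgeCliqueCover ConnGraph.InIn C) : E.sys.CoveredBy C := by
  intro Z hZ t v ht hv
  rw [← E.box_eq_net] at hZ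
  have hcl := (E.represents_places h).isClique Z hZ
  have hcov : ∀ w, E.connGraph.Adj (.out t) w → ∃ K ∈ C, Tagged.out t ∈ K ∧ w ∈ K :=
    fun w hw => hC.covers_edge _ w hw fun hin => by
      obtain ⟨⟨a, ha⟩, -⟩ := hin
      cases ha
  by_cases hvt : Tagged.out t = v
  -- The vertex alone is covered as an isolated vertex or through any of its edges.
  · subst hvt
    by_cases hiso : ∀ w, ¬ E.connGraph.Adj (.out t) w
    · obtain ⟨K, hK, htK⟩ := hC.covers_isolated _ (hcl.2.1 ht) hiso
      exact ⟨K, hK, htK, htK⟩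
    · push Not at hiso
      obtain ⟨w, hw⟩ := hiso
      obtain ⟨K, hK, htK, -⟩ := hcov w hw
      exact ⟨K, hK, htK, htK⟩
  · exact hcov v (hcl.2.2 ht hv hvt)

theorem BoxSys.CoveredBy.exists_out {B : BoxSys α} (hB : B.Static) {S : Set (Place α)}
    (h : B.CoveredBy S) {t : α} (ht : t ∈ B.acts) : ∃ Z ∈ S, Tagged.out t ∈ Z := by
  rcases hB.exists_out t ht with ⟨p, hp⟩ | ⟨p, hp⟩
  · obtain ⟨Z, hZ, htZ, -⟩ := h _ (entPlace_mem p) t (.out t) (out_mem_placeOf.2 hp)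
      (out_mem_placeOf.2 hp)
    exact ⟨Z, hZ, htZ⟩
  · obtain ⟨Z, hZ, htZ, -⟩ := h _ (intPlace_mem p) t (.out t) (out_mem_placeOf.2 hp)
      (out_mem_placeOf.2 hp)
    exact ⟨Z, hZ, htZ⟩

theorem BoxSys.Static.act_mem {B : BoxSys α} (hB : B.Static) {Z : Place α}
    (hZ : Z ∈ B.net.places) {v : Tagged α} (hv : v ∈ Z) : v.act ∈ B.acts := by
  refine places_cases (motive := fun Z => v ∈ Z → v.act ∈ B.acts) hZ
    (fun p hp => ?_) (fun p hp => ?_) (fun p hp => ?_) hv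
  · rcases v with a | a
    · exact (inp_mem_placeOf.1 hp).elim
    · exact hB.entOut_mem p a (out_mem_placeOf.1 hp)
  · rcases v with a | a
    · exact hB.exIn_mem p a (inp_mem_placeOf.1 hp)
    · exact (out_mem_placeOf.1 hp).elim
  · rcases v with a | a
    · exact hB.intIn_mem p a (inp_mem_placeOf.1 hp)
    · exact hB.intOut_mem p a (out_mem_placeOf.1 hp)

/-- Exit and internal places have inputs and entry places have none, so the initial marking of $N_C$
is the trace of that of BOX(E). -/
theorem BoxSys.Static.mem_init_iff {B : BoxSys α} (hB : B.Static) {Z : Place α}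
    (hZ : Z ∈ B.net.places) : Z ∈ B.net.init ↔ ∀ t, Tagged.inp t ∉ Z := by
  constructor
  · rintro ⟨p, rfl⟩ t ht
    exact inp_mem_placeOf.1 ht
  · refine places_cases (motive := fun Z => (∀ t, Tagged.inp t ∉ Z) → Z ∈ B.net.init) hZ
      (fun p _ => ⟨p, rfl⟩) (fun p hp => ?_) (fun p hp => ?_)
    · obtain ⟨t, ht⟩ := hB.exIn_nonempty p
      exact (hp t (inp_mem_placeOf.2 ht)).elim
    · obtain ⟨t, ht⟩ := hB.intIn_nonempty p
      exact (hp t (inp_mem_placeOf.2 ht)).elim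

theorem cliqueNet_trans {B : BoxSys α} (hB : B.Static) (hC : C ⊆ B.net.places)
    (hcov : B.CoveredBy C) : (cliqueNet C).trans = B.acts := by
  ext t
  constructor
  · rintro (⟨Z, hZ, ht⟩ | ⟨Z, hZ, ht⟩)
    · exact hB.act_mem (hC hZ) ht
    · exact hB.act_mem (hC hZ) ht
  · exact fun ht => Or.inr (hcov.exists_out hB ht)

theorem cliqueNet_isRestriction {B : BoxSys α} (hB : B.Static) (hC : C ⊆ B.net.places)
    (hcov : B.CoveredBy C) : (cliqueNet C).IsRestriction B.net C := by
  have htr := cliqueNet_trans hB hC hcov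
  refine ⟨htr, fun t ht => ?_, fun t ht => ?_, ?_⟩
  · ext Z
    exact ⟨fun h => ⟨⟨hC h.1, ht, h.2.2⟩, h.1⟩, fun h => ⟨h.2, htr.ge ht, h.1.2.2⟩⟩
  · ext Z
    exact ⟨fun h => ⟨⟨ht, hC h.2.1, h.2.2⟩, h.2.1⟩, fun h => ⟨htr.ge ht, h.2, h.1.2.2⟩⟩
  · ext Z
    exact ⟨fun h => ⟨(hB.mem_init_iff (hC h.1)).2 h.2, h.1⟩,
      fun h => ⟨h.2, (hB.mem_init_iff (hC h.2)).1 h.1⟩⟩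

/-- The places that survive the deletion of the places without output transitions. -/
def nonSinks (C : Set (Set (Tagged α))) : Set (Place α) :=
  {Z ∈ C | ((cliqueNet C).outputs Z).Nonempty}

/-- A place that covers a pair containing $t^{out}$ has the output `t`, so it survives the deletion.
-/
theorem coveredBy_nonSinks {B : BoxSys α} (hB : B.Static) (hC : C ⊆ B.net.places)
    (hcov : B.CoveredBy C) : B.CoveredBy (nonSinks C) := by
  intro Z hZ t v ht hv
  obtain ⟨Z', hZ', ht', hv'⟩ := hcov Z hZ t v ht hv
  exact ⟨Z', ⟨hZ', t, hZ', (cliqueNet_trans hB hC hcov).ge (hB.act_mem hZ ht), ht'⟩, ht', hv'⟩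

theorem deleteSinks_isRestriction {B : BoxSys α} (hB : B.Static) (hC : C ⊆ B.net.places)
    (hcov : B.CoveredBy C) : (cliqueNet C).deleteSinks.IsRestriction B.net (nonSinks C) := by
  have h := cliqueNet_isRestriction hB hC hcov
  refine ⟨h.trans_eq, fun t ht => ?_, fun t ht => ?_, ?_⟩
  · ext Z
    have := Set.ext_iff.1 (h.pre_eq t ht) Z
    exact ⟨fun h' => ⟨(this.1 h'.1).1, (this.1 h'.1).2, h'.2⟩,
      fun h' => ⟨this.2 ⟨h'.1, h'.2.1⟩, h'.2.2⟩⟩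
  · ext Z
    have := Set.ext_iff.1 (h.post_eq t ht) Z
    exact ⟨fun h' => ⟨(this.1 h'.1).1, (this.1 h'.1).2, h'.2⟩,
      fun h' => ⟨this.2 ⟨h'.1, h'.2.1⟩, h'.2.2⟩⟩
  · ext Z
    have := Set.ext_iff.1 h.init_eq Z
    exact ⟨fun h' => ⟨(this.1 h'.1).1, (this.1 h'.1).2, h'.2⟩,
      fun h' => ⟨this.2 ⟨h'.1, h'.2.1⟩, h'.2.2⟩⟩

theorem cliqueNet_isMarkedNet {B : BoxSys α} (hB : B.Static) (hC : C ⊆ B.net.places)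
    (hcov : B.CoveredBy C) (hfin : C.Finite) (hacts : B.acts.Finite)
    (hne : ∀ Z ∈ C, Z.Nonempty) : (cliqueNet C).IsMarkedNet where
  finite_places := hfin
  finite_trans := (cliqueNet_trans hB hC hcov).symm ▸ hacts
  arcTP_mem _ _ h := ⟨h.1, h.2.1⟩
  arcPT_mem _ _ h := ⟨h.1, h.2.1⟩
  init_subset _ h := h.1
  place_connected Z hZ := by
    obtain ⟨a | a, ha⟩ := hne Z hZ
    · exact Or.inl ⟨a, Or.inl ⟨Z, hZ, ha⟩, hZ, ha⟩
    · exact Or.inr ⟨a, hZ, Or.inr ⟨Z, hZ, ha⟩, ha⟩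
  pre_nonempty t ht := by
    obtain ⟨Z, hZ, htZ⟩ := hcov.exists_out hB ((cliqueNet_trans hB hC hcov).le ht)
    exact ⟨Z, hZ, ht, htZ⟩

theorem PetriNet.IsMarkedNet.deleteSinks {π τ : Type*} {N : PetriNet π τ}
    (h : N.IsMarkedNet) : N.deleteSinks.IsMarkedNet where
  finite_places := h.finite_places.subset fun _ hp => hp.1
  finite_trans := h.finite_trans
  arcTP_mem t p hp := ⟨(h.arcTP_mem t p hp.1).1, (h.arcTP_mem t p hp.1).2, hp.2⟩
  arcPT_mem p t hp := ⟨⟨(h.arcPT_mem p t hp.1).1, hp.2⟩, (h.arcPT_mem p t hp.1).2⟩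
  init_subset _ hp := ⟨h.init_subset hp.1, hp.2⟩
  place_connected _ hp := Or.inr (hp.2.imp fun _ ht => ⟨ht, hp.2⟩)
  pre_nonempty t ht := (h.pre_nonempty t ht).imp fun _ hp => ⟨hp, t, hp⟩

/-- The claim for partial edge clique covers. -/
theorem partialCover_nets {X : NonTerm} (hE : Derives X E) (hnodup : E.actions.Nodup)
    (hC : E.connGraph.IsPartialEdgeCliqueCover ConnGraph.InIn C) :
    ((cliqueNet C).IsMarkedNet ∧ (cliqueNet C).Safe ∧ (cliqueNet C).RGIso E.box) ∧
      ((cliqueNet C).deleteSinks.IsMarkedNet ∧ (cliqueNet C).deleteSinks.Safe ∧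
        (cliqueNet C).deleteSinks.RGIso E.box) := by
  have hs := E.sys_static hnodup
  have hd := E.sys_dynamic hE hnodup
  have hsub := subset_places_of_cover hnodup hC
  have hcov := coveredBy_of_cover hnodup hC
  have hnet : (cliqueNet C).IsMarkedNet := by
    refine cliqueNet_isMarkedNet hs hsub hcov ?_ ?_ fun Z hZ => (hC.subset_maxCliques hZ).prop.1
    · rw [← E.box_eq_net] at hsub
      exact E.box_places_finite.subset hsub
    · rw [E.sys_acts]
      exact List.finite_toSet _
  have hr := cliqueNet_isRestriction hs hsub hcov
  have hr' := deleteSinks_isRestriction hs hsub hcov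
  have hdet := hcov.determines hs hd hsub
  have hdet' := (coveredBy_nonSinks hs hsub hcov).determines hs hd fun Z hZ => hsub hZ.1
  rw [E.box_eq_net]
  exact ⟨⟨hnet, hr.safe hdet, hr.rgIso hdet⟩, hnet.deleteSinks, hr'.safe hdet',
    hr'.rgIso hdet'⟩

theorem ConnGraph.IsEdgeCliqueCover.isPartialEdgeCliqueCover {G : ConnGraph α}
    (hC : G.IsEdgeCliqueCover C) (D : Tagged α → Tagged α → Prop) :
    G.IsPartialEdgeCliqueCover D C :=
  ⟨hC.subset_maxCliques, fun v w h _ => hC.covers_edge v w h not_false, hC.covers_isolated⟩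

end Cover

theorem theorem6p1 {α : Type*} (E : BoxExpr α) (hE : Derives NonTerm.E E)
    (hnodup : E.actions.Nodup) :
    (∀ C : Set (Set (Tagged α)), E.connGraph.IsEdgeCliqueCover C →
      ((cliqueNet C).IsMarkedNet ∧ (cliqueNet C).Safe ∧ (cliqueNet C).RGIso E.box) ∧
      ((cliqueNet C).deleteSinks.IsMarkedNet ∧ (cliqueNet C).deleteSinks.Safe ∧
        (cliqueNet C).deleteSinks.RGIso E.box)) ∧
    (∀ C : Set (Set (Tagged α)), E.connGraph.IsPartialEdgeCliqueCover ConnGraph.InIn C →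
      ((cliqueNet C).IsMarkedNet ∧ (cliqueNet C).Safe ∧ (cliqueNet C).RGIso E.box) ∧
      ((cliqueNet C).deleteSinks.IsMarkedNet ∧ (cliqueNet C).deleteSinks.Safe ∧
        (cliqueNet C).deleteSinks.RGIso E.box)) :=
  ⟨fun _ hC => partialCover_nets hE hnodup (hC.isPartialEdgeCliqueCover _),
    fun _ hC => partialCover_nets hE hnodup hC⟩
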